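/- **Setting.** Let $\eta>0$, $\alpha\in\mathbb R$, $L$ even, $N=L/2$, and put $$K(\mu)=\frac{\sinh 2\eta}{2\pi\sin(\mu+i\eta)\sin(\mu-i\eta)},\qquad p_0'(\mu)=\frac{\sinh\eta}{\sin(\mu+i\eta/2)\sin(\mu-i\eta/2)},$$ $\theta(\lambda)=2\pi i\int_{-\pi/2}^{\lambda}K$, $p_0(\lambda)=\int_{-\pi/2}^{\lambda}p_0'$, integrated along the segments $[-\frac\pi2,-\frac\pi2+i\,\Im\lambda]\cup[-\frac\pi2+i\,\Im\lambda,\lambda]$. Let $\{\mu_a\}_1^N$ solve the $\alpha$-twisted Bethe equations $$-e^{2\pi i\alpha}=\Big(\frac{\sin(\mu_a-i\eta/2)}{\sin(\mu_a+i\eta/2)}\Big)^{L}\prod_{b=1}^N\frac{\sin(\mu_a-\mu_b+i\eta)}{\sin(\mu_a-\mu_b-i\eta)},\qquad a=1,\dots,N,$$ with pairwise distinct $\mu_a$, $\Re\mu_a\in[-\frac\pi2,\frac\pi2)$, and let $$\hat\xi_\mu(\omega)=\frac{p_0(\omega)}{2\pi}-\frac1{2\pi i L}\sum_{k=1}^N\theta(\omega-\mu_k)+\frac{1-2\alpha}{2L}$$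 be its counting function. Fix $n\in\mathbb N$ and $\varkappa,\varepsilon>0$ independent of $L$ and suppose: 1. exactly $n$ of the $\mu_a$ are non-real; 2. $\hat\xi_\mu$ is real-valued and strictly increasing on $[-\frac\pi2,\frac\pi2]$, and $\hat\xi_\mu'>\varkappa$ there; 3. every non-real root satisfies $\big||\Im\mu_a|-\eta\big|\ge\varepsilon$. Let $n_w$, $n_c=n-n_w$ be the numbers of non-real roots with $|\Im\mu_a|>\eta$ and $|\Im\mu_a|<\eta$ respectively, let $\nu_1,\nu_2,\dots$ be all $x\in[-\frac\pi2,\frac\pi2)$ with $e^{2\pi i L\hat\xi_\mu(x)}=1$, and let the holes $\nu_{h_b}$ be those $\nu_a$ that are not Bethe roots. $O(L^{-\infty})$ means $O(L^{-m})$ for every $m$; below, all such bounds, the rate of convergence in (a), and the meaning of "$L$ large" depend only on $\eta,\alpha,n,\varkappa,\varepsilon$. **Proposition.** For $L$ large, the following holds. (a) There are exactly $N+n_w$ numbers $\nu_a$, and they fill $[-\frac\pi2,\frac\pi2]$ densely as $L\to\infty$: $\sup_{x\in[-\pi/2,\pi/2]}\min_a|x-\nu_a|\to0$. (b) There are $n_h=n+n_w$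 holes. $n_w$ and $n_c$ are even, and the non-real roots are, without repetition, wide pairs $\{y_a,\bar y_a\}$, $1\le a\le\frac{n_w}2$, with $\Im y_a>\eta$, and strings $\{w_a,\,w_a-i\eta+\delta_a\}$, $1\le a\le\frac{n_c}2$ (second member modulo $\pi$), with $0<\Im w_a<\eta$, $-\eta<\Im(w_a-i\eta+\delta_a)<0$ and $\delta_a=O(L^{-\infty})$. (c) Up to $O(L^{-\infty})$ the following higher-level Bethe equations hold, for $x=w_a$ ($a\le\frac{n_c}2$) and for $x=y_a$ ($a\le\frac{n_w}2$): $$1=-e^{-2\pi i\alpha}\prod_{b=1}^{n_h}\frac{\sin(x-\nu_{h_b}-i\eta)}{\sin(x-\nu_{h_b})}\prod_{b=1}^{n_c/2}\frac{\sin(x-w_b+i\eta)}{\sin(x-w_b-i\eta)}\prod_{b=1}^{n_w/2}\frac{\sin(x-y_b+i\eta)\sin(x-\bar y_b)}{\sin(x-y_b-i\eta)\sin(x-\bar y_b-2i\eta)},$$ and for $x=\bar y_a$ ($a\le\frac{n_w}2$): $$1=-e^{-2\pi i\alpha}\prod_{b=1}^{n_h}\frac{\sin(x-\nu_{h_b})}{\sin(x-\nu_{h_b}+i\eta)}\prod_{b=1}^{n_c/2}\frac{\sin(x-w_b+2i\eta)}{\sin(x-w_b)}\prod_{b=1}^{n_w/2}\frac{\sin(x-y_b+2i\eta)\sin(x-\bar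 y_b+i\eta)}{\sin(x-y_b)\sin(x-\bar y_b-i\eta)}.$$ (d) Put $n_\chi=\frac{n_c}2+n_w$, so that $n_h=2n_\chi$, and let $\chi_1,\dots,\chi_{n_\chi}$ be the numbers $y_a-\frac{i\eta}2$, $\bar y_a+\frac{i\eta}2$ ($a\le\frac{n_w}2$) and $w_a-\frac{i\eta}2$ ($a\le\frac{n_c}2$). Up to $O(L^{-\infty})$, for $a=1,\dots,n_\chi$, $$e^{2\pi i\alpha}=-\prod_{b=1}^{2n_\chi}\frac{\sin(\chi_a-\nu_{h_b}-i\eta/2)}{\sin(\chi_a-\nu_{h_b}+i\eta/2)}\prod_{b=1}^{n_\chi}\frac{\sin(\chi_a-\chi_b+i\eta)}{\sin(\chi_a-\chi_b-i\eta)}.$$ (e) If, along a sequence of such solutions with $L\to\infty$, constant $n_w,n_c$, and roots organised as in (b) with $\delta_a\to0$, the holes $\nu_{h_b}$ and the roots $y_a$, $w_a$ converge, then the limits satisfy all the equations in (c) and (d) exactly. In all these equations the denominators are non-zero. -/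

import Mathlib

open Filter Topology Asymptotics

noncomputable section

namespace XXZ

/-- The kernel `K(z) = sinh(2η) / (2π sin(z + iη) sin(z - iη))`. -/
def kernelK (η : ℝ) (z : ℂ) : ℂ :=
  Complex.sinh (2 * η) /
    (2 * Real.pi * Complex.sin (z + Complex.I * η) * Complex.sin (z - Complex.I * η))

/-- The derivative `p₀'(z) = sinh(η) / (sin(z + iη/2) sin(z - iη/2))` of the bare momentum. -/
def bareMomentumDeriv (η : ℝ) (z : ℂ) : ℂ :=
  Complex.sinh η /
    (Complex.sin (z + Complex.I * η / 2) * Complex.sin (z - Complex.I * η / 2))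

/-- The integral of `f` along the vertical segment from `-π/2` to `-π/2 + i Im z`, followed by
the horizontal segment from `-π/2 + i Im z` to `z`. -/
def pathIntegral (f : ℂ → ℂ) (z : ℂ) : ℂ :=
  (∫ t in (0 : ℝ)..z.im, f (-(Real.pi : ℂ) / 2 + Complex.I * t) * Complex.I) +
    ∫ s in (-Real.pi / 2)..z.re, f ((s : ℂ) + Complex.I * z.im)

/-- The bare phase `θ`. -/
def barePhase (η : ℝ) (z : ℂ) : ℂ :=
  2 * Complex.I * Real.pi * pathIntegral (kernelK η) z

/-- The bare momentum `p₀`. -/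
def bareMomentum (η : ℝ) (z : ℂ) : ℂ :=
  pathIntegral (bareMomentumDeriv η) z

/-- The counting function associated with the parameters `μ`. -/
def countingFunction (η α : ℝ) (L : ℕ) {N : ℕ} (μ : Fin N → ℂ) (ω : ℂ) : ℂ :=
  bareMomentum η ω / (2 * Real.pi)
    - 1 / (2 * Complex.I * Real.pi * L) * ∑ k, barePhase η (ω - μ k)
    + (1 - 2 * α) / (2 * L)

/-- The `α`-twisted Bethe equations for a chain of length `L`. As the left-hand side does not
vanish, the equations force every denominator to be non-zero. -/
def BetheEquations (η α : ℝ) (L : ℕ) {N : ℕ} (μ : Fin N → ℂ) : Prop :=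
  ∀ a, -Complex.exp (2 * Complex.I * Real.pi * α) =
    (Complex.sin (μ a - Complex.I * η / 2) / Complex.sin (μ a + Complex.I * η / 2)) ^ L *
      ∏ b, Complex.sin (μ a - μ b + Complex.I * η) / Complex.sin (μ a - μ b - Complex.I * η)

/-- Solutions of the twisted Bethe equations with `N = L / 2` roots, `L` even, which are pairwise
distinct and reduced modulo `π`, which contain precisely `n` non-real roots, and whose counting
function is real and strictly increasing on `[-π/2, π/2]` with derivative larger than `κ`. -/
structure AdmissibleSolution (η α κ : ℝ) (n L : ℕ) (μ : Fin (L / 2) → ℂ) : Prop where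
  even_length : Even L
  bethe : BetheEquations η α L μ
  distinct : Function.Injective μ
  reduced : ∀ a, (μ a).re ∈ Set.Ico (-Real.pi / 2) (Real.pi / 2)
  complex_count : {a | (μ a).im ≠ 0}.ncard = n
  counting_real : ∀ x ∈ Set.Icc (-Real.pi / 2) (Real.pi / 2),
    (countingFunction η α L μ (x : ℂ)).im = 0
  counting_strictMono : StrictMonoOn (fun x : ℝ => (countingFunction η α L μ (x : ℂ)).re)
    (Set.Icc (-Real.pi / 2) (Real.pi / 2))
  counting_deriv : ∀ x ∈ Set.Icc (-Real.pi / 2) (Real.pi / 2),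
    κ < deriv (fun x : ℝ => (countingFunction η α L μ (x : ℂ)).re) x

/-- The non-real roots have distance at least `ε` from the two lines `Im z = ± η`. -/
def AwayFromLines (η ε : ℝ) {N : ℕ} (μ : Fin N → ℂ) : Prop :=
  ∀ a, (μ a).im ≠ 0 → ε ≤ |(|(μ a).im| - η)|

/-- The set of all real numbers `ν` in `[-π/2, π/2)` with `exp(2 i π L ξ(ν)) = 1`. -/
def realSolutions (η α : ℝ) (L : ℕ) {N : ℕ} (μ : Fin N → ℂ) : Set ℝ :=
  {x | x ∈ Set.Ico (-Real.pi / 2) (Real.pi / 2) ∧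
    Complex.exp (2 * Complex.I * Real.pi * L * countingFunction η α L μ (x : ℂ)) = 1}

/-- The holes: the real solutions that are not Bethe roots. -/
def holeSet (η α : ℝ) (L : ℕ) {N : ℕ} (μ : Fin N → ℂ) : Set ℝ :=
  {x | x ∈ realSolutions η α L μ ∧ ∀ a, μ a ≠ (x : ℂ)}

/-- The `n` non-real roots are the `mw` wide pairs `y a, conj (y a)` and the `mc` strings
`w a, w a - iη + δ a`, and `ν` enumerates the `n + n_w = n + 2 mw` holes. By the count
`2 mw + 2 mc = n`, the listing of the `n` non-real roots is without repetitions. Bethe roots matter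
only modulo `π`, and the second member of a string is understood modulo `π` (the integers `s a`):
its representative with real part in `[-π/2, π/2)` can lie at the other end of this interval. -/
structure RootPattern (η α : ℝ) (n L : ℕ) {N : ℕ} (μ : Fin N → ℂ) (mw mc : ℕ)
    (ν : Fin (n + 2 * mw) → ℝ) (y : Fin mw → ℂ) (w δ : Fin mc → ℂ) : Prop where
  count : 2 * mw + 2 * mc = n
  wide : ∀ a, η < (y a).im
  close_upper : ∀ a, 0 < (w a).im ∧ (w a).im < η
  close_lower : ∀ a, -η < (w a - Complex.I * η + δ a).im ∧ (w a - Complex.I * η + δ a).im < 0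
  roots : ∃ s : Fin mc → ℤ, {z | z ∈ Set.range μ ∧ z.im ≠ 0} =
    Set.range y ∪ Set.range (fun a => starRingEnd ℂ (y a)) ∪
      (Set.range w ∪ Set.range (fun a => w a - Complex.I * η + δ a + s a * Real.pi))
  holes_injective : Function.Injective ν
  holes_range : Set.range ν = holeSet η α L μ

/-- The right-hand side of the higher-level Bethe equations for the close roots (`x = w a`) and
for the wide roots in the upper half plane (`x = y a`). -/
def upperRHS (η α : ℝ) {nh mw mc : ℕ} (ν : Fin nh → ℝ) (y : Fin mw → ℂ) (w : Fin mc → ℂ)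
    (x : ℂ) : ℂ :=
  -Complex.exp (-2 * Complex.I * Real.pi * α) *
    (∏ b, Complex.sin (x - ν b - Complex.I * η) / Complex.sin (x - ν b)) *
    (∏ b, Complex.sin (x - w b + Complex.I * η) / Complex.sin (x - w b - Complex.I * η)) *
    ∏ b, (Complex.sin (x - y b + Complex.I * η) * Complex.sin (x - starRingEnd ℂ (y b))) /
      (Complex.sin (x - y b - Complex.I * η) *
        Complex.sin (x - starRingEnd ℂ (y b) - 2 * Complex.I * η))

/-- The right-hand side of the higher-level Bethe equations for the wide roots in the lower half
plane (`x = conj (y a)`). -/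
def lowerRHS (η α : ℝ) {nh mw mc : ℕ} (ν : Fin nh → ℝ) (y : Fin mw → ℂ) (w : Fin mc → ℂ)
    (x : ℂ) : ℂ :=
  -Complex.exp (-2 * Complex.I * Real.pi * α) *
    (∏ b, Complex.sin (x - ν b) / Complex.sin (x - ν b + Complex.I * η)) *
    (∏ b, Complex.sin (x - w b + 2 * Complex.I * η) / Complex.sin (x - w b)) *
    ∏ b, (Complex.sin (x - y b + 2 * Complex.I * η) *
        Complex.sin (x - starRingEnd ℂ (y b) + Complex.I * η)) /
      (Complex.sin (x - y b) * Complex.sin (x - starRingEnd ℂ (y b) - Complex.I * η))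

/-- The reparametrised roots: `y a - iη/2`, `conj (y a) + iη/2` and `w a - iη/2`. -/
def chi (η : ℝ) {mw mc : ℕ} (y : Fin mw → ℂ) (w : Fin mc → ℂ) :
    (Fin mw ⊕ Fin mw) ⊕ Fin mc → ℂ :=
  Sum.elim
    (Sum.elim (fun a => y a - Complex.I * η / 2)
      (fun a => starRingEnd ℂ (y a) + Complex.I * η / 2))
    (fun a => w a - Complex.I * η / 2)

/-- The right-hand side of the symmetric form of the higher-level Bethe equations. -/
def symmetricRHS (η : ℝ) {nh : ℕ} {ι : Type} [Fintype ι] (ν : Fin nh → ℝ) (χ : ι → ℂ)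
    (x : ℂ) : ℂ :=
  -(∏ b, Complex.sin (x - ν b - Complex.I * η / 2) / Complex.sin (x - ν b + Complex.I * η / 2)) *
    ∏ b, Complex.sin (x - χ b + Complex.I * η) / Complex.sin (x - χ b - Complex.I * η)

/-- The higher-level Bethe equations, in both forms, hold up to an error of at most `r`. For
`r = 0` this is their exact validity. A quotient by zero has the value `0` here, so that the
equations (for `r < 1`) also say that no denominator vanishes. -/
structure HigherLevelBethe (η α : ℝ) {nh mw mc : ℕ} (ν : Fin nh → ℝ) (y : Fin mw → ℂ)
    (w : Fin mc → ℂ) (r : ℝ) : Prop where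
  close : ∀ a, ‖1 - upperRHS η α ν y w (w a)‖ ≤ r
  wide_upper : ∀ a, ‖1 - upperRHS η α ν y w (y a)‖ ≤ r
  wide_lower : ∀ a, ‖1 - lowerRHS η α ν y w (starRingEnd ℂ (y a))‖ ≤ r
  symmetric : ∀ a, ‖Complex.exp (2 * Complex.I * Real.pi * α)
    - symmetricRHS η ν (chi η y w) (chi η y w a)‖ ≤ r

/-- `ρ(L) = O(L^{-∞})`. -/
def RapidlyDecreasing (ρ : ℕ → ℝ) : Prop :=
  ∀ m : ℕ, ρ =O[atTop] fun L : ℕ => ((L : ℝ) ^ m)⁻¹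

end XXZ

end

namespace XXZ

open Complex ComplexConjugate

/-! Write `phi` for the product whose value on the real axis is the exponential of 2πiL times the
counting function. All Bethe roots solve `phi = 1`. On the axis `|phi| = 1` and its phase increases
at a rate of at least 2πLκ, so `phi` decays exponentially just above the axis, and its inverse just
below: the size there is `E = exp(-πLκδ)`. Hence the solutions of `phi = 1` near the axis are real
and simple, and they are exactly the real roots and the holes. As `|phi| = 1` on the axis, the set
of roots is closed under conjugation. The winding of the counting function over a period counts real
roots and holes together.

No integral equation is solved. Instead, `psi` collects the real roots, the holes and some factors
from the non-real roots, so that it is holomorphic in the upper half plane and, by the hole count,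
extends as a function of Z = exp(2iz) to the whole unit disc. In a strip around the axis `psi = (1 -
phi) * quot` with `quot` holomorphic, and a constant phase makes `quot` real on the axis. Above the
axis `phi` is negligible, so a function on the disc nearly agrees near its boundary circle with a
function that is real on that circle. This forces it to be nearly constant
(`near_const_of_factorization`, `exists_psi_near`). This one fact replaces all knowledge about the
real roots.

Shifting the argument by iη gives `phi z * psi (z - iη) = const * upper z * psi z`, where `upper`
contains only holes and non-real roots (`phi_mul_psi`). At a wide root both values of `psi` are
close to the same constant, which gives the wide equations, at first with conjugate close roots in
place of strings. Lower bounds for the denominators come from going through the wide roots in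
descending order of height (`Good.chain_bound`, `Good.gap`).

Between the lines Im z = δ and Im z = η - 2δ, `phi` becomes O(E) once its poles at the points
conj(w) + iη are removed. So the equation `phi w = 1` says that the numbers exp(2iw) are zeros of a
slightly perturbed polynomial whose unperturbed zeros are the shifted conjugates. A quantitative
matching (`exists_matching`) pairs them, with a power of E as error; these pairs are the strings.
The Bethe equations of the two members of a string are singular separately, since each contains
small differences. The factorization given by the matching shows that these differences cancel up to
a sign (`Good.near_prod_sin`), and the product of the two equations is the close equation.

All constants depend only on η, κ, ε and n, and every denominator has a uniform lower bound. So the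
errors are exponentially small in L up to polynomial factors, and one may pass to the limit. -/

/-! ### Functions on a disc that are nearly real near its boundary -/

theorem norm_le_on_strip {f : ℂ → ℂ} {a b A C : ℝ} (hab : a < b)
    (hd : DiffContOnCl ℂ f (im ⁻¹' Set.Ioo a b))
    (hA : ∀ z : ℂ, a < z.im → z.im < b → ‖f z‖ ≤ A)
    (ha : ∀ z : ℂ, z.im = a → ‖f z‖ ≤ C) (hb : ∀ z : ℂ, z.im = b → ‖f z‖ ≤ C)
    {z : ℂ} (hza : a ≤ z.im) (hzb : z.im ≤ b) : ‖f z‖ ≤ C := by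
  refine PhragmenLindelof.horizontal_strip hd ⟨0, by
    have := Real.pi_pos
    have := sub_pos.2 hab
    positivity, 0, ?_⟩
    ha hb hza hzb
  refine IsBigO.of_bound A ?_
  refine eventually_inf_principal.2 (Eventually.of_forall fun z hz => ?_)
  simpa using hA z hz.1 hz.2

/-- The harmonic function Im T is compared with the linear function having the same bounds on the
two edges, by applying the strip principle to exp(-i(T z - (B/b) z)). At half height it gains a
factor 1/2, which is what makes the argument in `near_const_of_factorization` close up. -/
theorem im_le_linear_on_strip {T : ℂ → ℂ} {b A B : ℝ} (hb : 0 < b)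
    (hd : DiffContOnCl ℂ T (im ⁻¹' Set.Ioo 0 b))
    (hA : ∀ z : ℂ, 0 < z.im → z.im < b → ‖T z‖ ≤ A) (hB0 : 0 ≤ B)
    (h0 : ∀ z : ℂ, z.im = 0 → (T z).im ≤ 0) (hB : ∀ z : ℂ, z.im = b → (T z).im ≤ B)
    {z : ℂ} (hz0 : 0 ≤ z.im) (hzb : z.im ≤ b) : (T z).im ≤ B / b * z.im := by
  have key : ∀ z : ℂ, ‖exp (-I * (T z - (B / b : ℝ) * z))‖ =
      Real.exp ((T z).im - B / b * z.im) := by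
    intro z
    rw [norm_exp]
    congr 1
    simp [mul_re, sub_im, mul_im]
  have := norm_le_on_strip (f := fun z => exp (-I * (T z - (B / b : ℝ) * z))) (a := 0) (b := b)
    (A := Real.exp A) (C := 1) hb ?_ ?_ ?_ ?_ hz0 hzb
  · simp only [key, Real.exp_le_one_iff] at this
    linarith
  · exact Differentiable.comp_diffContOnCl differentiable_exp
      (DiffContOnCl.const_smul (c := -I) (hd.sub
        (Differentiable.diffContOnCl (differentiable_id.const_mul _))))
  · intro z h1 h2
    rw [key, Real.exp_le_exp]
    have h3 := hA z h1 h2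
    have h4 := (abs_le.1 (abs_im_le_norm (T z))).2
    have : 0 ≤ B / b * z.im := by positivity
    linarith
  · intro z hz
    rw [key, hz]
    simpa using h0 z hz
  · intro z hz
    rw [key, hz, Real.exp_le_one_iff, div_mul_cancel₀ _ hb.ne']
    linarith [hB z hz]

theorem im_le_on_ball {f : ℂ → ℂ} {R c : ℝ} (hR : 0 < R)
    (hf : DiffContOnCl ℂ f (Metric.ball 0 R))
    (h : ∀ Z : ℂ, ‖Z‖ = R → (f Z).im ≤ c) {Z : ℂ} (hZ : ‖Z‖ ≤ R) : (f Z).im ≤ c := by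
  have key : ∀ z : ℂ, ‖exp (-I * f z)‖ = Real.exp ((f z).im) := by
    intro z
    rw [norm_exp]
    congr 1
    simp [mul_re]
  have := Complex.norm_le_of_forall_mem_frontier_norm_le (f := fun z => exp (-I * f z))
    (U := Metric.ball 0 R) Metric.isBounded_ball (C := Real.exp c) ?_ ?_ (z := Z) ?_
  · rwa [key, Real.exp_le_exp] at this
  · exact Differentiable.comp_diffContOnCl differentiable_exp
      (DiffContOnCl.const_smul (c := -I) hf)
  · intro z hz
    rw [frontier_ball _ hR.ne'] at hz
    rw [key, Real.exp_le_exp]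
    exact h z (by simpa using hz)
  · rw [closure_ball _ hR.ne']
    simpa using hZ

theorem exists_exp_two_I_mul {Z : ℂ} (hZ : Z ≠ 0) :
    ∃ z : ℂ, exp (2 * I * z) = Z ∧ z.im = -Real.log ‖Z‖ / 2 := by
  refine ⟨-I / 2 * log Z, ?_, ?_⟩
  · rw [show 2 * I * (-I / 2 * log Z) = -(I * I) * log Z by ring, I_mul_I, neg_neg, one_mul,
      exp_log hZ]
  · have : -I / 2 * log Z = (1 / 2 : ℝ) * (-I * log Z) := by push_cast; ring
    rw [this, im_ofReal_mul]
    simp [log_re]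
    ring

theorem norm_exp_two_I_mul (z : ℂ) : ‖exp (2 * I * z)‖ = Real.exp (-(2 * z.im)) := by
  rw [norm_exp]
  congr 1
  simp [mul_re]

/-- Two opposite comparisons are played against each other. As Im T vanishes on the axis, its
supremum at height δ is at most half its supremum `B` at height 2δ. For f the maximum principle on
the disc goes the other way: Im f at height 2δ is bounded by its values at height δ. As f and T
differ by O(E) between these heights, `B` is O(E), hence so is Im f on the disc, and
Borel–Carathéodory makes f nearly constant. -/
theorem near_const_of_factorization {δ : ℝ} (hδ : 0 < δ) : ∃ C : ℝ, 0 < C ∧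
    ∀ (E : ℝ) (f T Φ : ℂ → ℂ), 0 ≤ E → C * E ≤ 1 →
    DifferentiableOn ℂ f (Metric.ball 0 1) →
    DifferentiableOn ℂ T {z | |z.im| < 3 * δ} →
    (∃ A, ∀ z : ℂ, |z.im| ≤ 2 * δ → ‖T z‖ ≤ A) →
    (∀ z : ℂ, |z.im| ≤ 2 * δ → T (conj z) = conj (T z)) →
    (∀ z : ℂ, δ ≤ z.im → z.im ≤ 2 * δ → f (exp (2 * I * z)) = (1 - Φ z) * T z) →
    (∀ z : ℂ, δ ≤ z.im → z.im ≤ 2 * δ → ‖Φ z‖ ≤ E) →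
    (∀ Z : ℂ, ‖Z‖ ≤ Real.exp (-(4 * δ)) → ‖f Z - f 0‖ ≤ C * E * ‖f 0‖) ∧
      |(f 0).im| ≤ C * E * ‖f 0‖ := by
  set R := Real.exp (-(2 * δ)) with hR
  set r := Real.exp (-(4 * δ)) with hr
  have hrR : r < R := Real.exp_lt_exp.2 (by linarith)
  have hR0 : 0 < R := Real.exp_pos _
  have hr0 : 0 < r := Real.exp_pos _
  have hR1 : R < 1 := (Real.exp_lt_one_iff (x := -(2 * δ))).2 (by linarith)
  -- The Borel–Carathéodory factor between the circles that correspond to the heights δ (radius R)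
  -- and 2δ (radius r).
  set K := 2 * r / (R - r) with hK
  have hK0 : 0 < K := div_pos (by linarith) (by linarith)
  -- The bounds below are 6KEτ and 3Eτ with τ ≤ 4‖f 0‖, which gives 24K and 12. The same constant
  -- makes C E ≤ 1 imply the smallness used for τ.
  refine ⟨24 * K + 12, by linarith, ?_⟩
  intro E f T Φ hE hCE hf hT hTb hTc hfac hΦ
  have hKE : 24 * (K * E) ≤ 1 := by nlinarith
  have hE12 : 12 * E ≤ 1 := by nlinarith [mul_nonneg hK0.le hE]
  obtain ⟨A, hA⟩ := hTb
  let τ := sSup ((fun z => ‖T z‖) '' {z : ℂ | |z.im| ≤ 2 * δ})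
  have hbd : BddAbove ((fun z => ‖T z‖) '' {z : ℂ | |z.im| ≤ 2 * δ}) :=
    ⟨A, by rintro _ ⟨z, hz, rfl⟩; exact hA z hz⟩
  have hτ : ∀ z : ℂ, |z.im| ≤ 2 * δ → ‖T z‖ ≤ τ := fun z hz => le_csSup hbd ⟨z, hz, rfl⟩
  have hτ0 : 0 ≤ τ := (norm_nonneg (T 0)).trans (hτ 0 (by simp; linarith))
  let B := sSup ((fun z => |(T z).im|) '' {z : ℂ | z.im = 2 * δ})
  have h2 : ∀ z : ℂ, z.im = 2 * δ → |z.im| ≤ 2 * δ := fun z hz => by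
    rw [hz, abs_of_pos (by linarith)]
  have hbdB : BddAbove ((fun z => |(T z).im|) '' {z : ℂ | z.im = 2 * δ}) :=
    ⟨A, by rintro _ ⟨z, hz, rfl⟩; exact (abs_im_le_norm _).trans (hA z (h2 z hz))⟩
  have hB : ∀ z : ℂ, z.im = 2 * δ → |(T z).im| ≤ B := fun z hz => le_csSup hbdB ⟨z, hz, rfl⟩
  have hneB : ((fun z => |(T z).im|) '' {z : ℂ | z.im = 2 * δ}).Nonempty :=
    ⟨_, ⟨(2 * δ : ℝ) * I, by simp, rfl⟩⟩
  have hB0 : 0 ≤ B := (abs_nonneg _).trans (hB ((2 * δ : ℝ) * I) (by simp))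
  have hTd : DiffContOnCl ℂ T (im ⁻¹' Set.Ioo 0 (2 * δ)) := by
    refine DifferentiableOn.diffContOnCl (hT.mono ?_)
    refine (closure_minimal (t := im ⁻¹' Set.Icc 0 (2 * δ)) (fun z hz => ⟨hz.1.le, hz.2.le⟩)
      (isClosed_Icc.preimage continuous_im)).trans fun z hz => ?_
    simp only [Set.mem_ofPred_eq]
    rw [abs_of_nonneg hz.1]
    linarith [hz.2]
  have hreal : ∀ z : ℂ, z.im = 0 → (T z).im = 0 := by
    intro z hz
    have h := hTc z (by rw [hz]; simp; linarith)
    rw [conj_eq_iff_im.2 hz] at h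
    exact conj_eq_iff_im.1 h.symm
  have hlin : ∀ z : ℂ, 0 ≤ z.im → z.im ≤ 2 * δ → |(T z).im| ≤ B / (2 * δ) * z.im := by
    intro z h0 h1
    rw [abs_le']
    constructor
    · exact im_le_linear_on_strip (by linarith) hTd
        (fun z h0 h1 => hτ z (by rw [abs_of_pos h0]; exact h1.le)) hB0
        (fun z hz => (hreal z hz).le) (fun z hz => (abs_le.1 (hB z hz)).2) h0 h1
    · have := im_le_linear_on_strip (T := fun z => -T z) (by linarith) hTd.neg
        (fun z h0 h1 => by rw [norm_neg]; exact hτ z (by rw [abs_of_pos h0]; exact h1.le)) hB0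
        (fun z hz => by simp [hreal z hz]) (fun z hz => by
          have := (abs_le.1 (hB z hz)).1; simp only [neg_im]; linarith) h0 h1
      simpa using this
  have hdiff : ∀ z : ℂ, δ ≤ z.im → z.im ≤ 2 * δ → ‖f (exp (2 * I * z)) - T z‖ ≤ E * τ := by
    intro z h0 h1
    rw [hfac z h0 h1, show (1 - Φ z) * T z - T z = -(Φ z * T z) by ring, norm_neg, norm_mul]
    exact mul_le_mul (hΦ z h0 h1) (hτ z (by rw [abs_of_nonneg (by linarith)]; exact h1))
      (norm_nonneg _) hE
  have himdiff : ∀ z : ℂ, δ ≤ z.im → z.im ≤ 2 * δ →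
      |(f (exp (2 * I * z))).im - (T z).im| ≤ E * τ := fun z h0 h1 => by
    rw [← sub_im]; exact (abs_im_le_norm _).trans (hdiff z h0 h1)
  have hfR : DifferentiableOn ℂ f (Metric.closedBall 0 R) :=
    hf.mono (Metric.closedBall_subset_ball hR1)
  have hfR' : DiffContOnCl ℂ f (Metric.ball 0 R) :=
    DifferentiableOn.diffContOnCl (hfR.mono Metric.closure_ball_subset_closedBall)
  have hsph : ∀ Z : ℂ, ‖Z‖ = R → |(f Z).im| ≤ B / 2 + E * τ := by
    intro Z hZ
    obtain ⟨z, rfl, hz⟩ := exists_exp_two_I_mul (Z := Z) (by rintro rfl; simp at hZ; linarith)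
    rw [hZ, hR, Real.log_exp] at hz
    have hz' : z.im = δ := by linarith
    have h1 := hlin z (by linarith) (by linarith)
    have h2 := himdiff z (by linarith) (by linarith)
    rw [hz', show B / (2 * δ) * δ = B / 2 by field_simp] at h1
    have := abs_sub_abs_le_abs_sub (f (exp (2 * I * z))).im (T z).im
    linarith
  have hball : ∀ Z : ℂ, ‖Z‖ ≤ R → |(f Z).im| ≤ B / 2 + E * τ := by
    intro Z hZ
    rw [abs_le']
    constructor
    · exact im_le_on_ball hR0 hfR' (fun Z hZ => (abs_le.1 (hsph Z hZ)).2) hZ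
    · have := im_le_on_ball (f := fun z => -f z) hR0 hfR'.neg (c := B / 2 + E * τ) (fun Z hZ => by
        have := (abs_le.1 (hsph Z hZ)).1; simp only [neg_im]; linarith) hZ
      simpa using this
  -- At height 2δ: Im T is within Eτ of Im f, and Im f is at most B/2 + Eτ by the maximum principle.
  -- Absorb B/2.
  have hBle : B ≤ 4 * (E * τ) := by
    have : B ≤ B / 2 + E * τ + E * τ := by
      refine csSup_le hneB ?_
      rintro _ ⟨z, hz, rfl⟩
      rw [Set.mem_ofPred_eq] at hz
      have h1 := himdiff z (by linarith) hz.le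
      have h2 := hball (exp (2 * I * z)) (by
        rw [norm_exp_two_I_mul, hz, hR, Real.exp_le_exp]; linarith)
      rw [abs_sub_comm] at h1
      have := abs_sub_abs_le_abs_sub (T z).im (f (exp (2 * I * z))).im
      simp only
      linarith
    linarith
  have hball' : ∀ Z : ℂ, ‖Z‖ ≤ R → |(f Z).im| ≤ 3 * (E * τ) := fun Z hZ => by
    linarith [hball Z hZ]
  have hf0 := hball' 0 (by simpa using hR0.le)
  have hBC : ∀ Z : ℂ, ‖Z‖ ≤ r → ‖f Z - f 0‖ ≤ 6 * (E * τ) * K := by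
    intro Z hZ
    -- Borel–Carathéodory needs a positive bound and a strict inequality, while Eτ may vanish; θ
    -- supplies the slack.
    refine le_of_forall_pos_le_add fun θ hθ => ?_
    have hM : 0 < 6 * (E * τ) + θ / K := by positivity
    have := borelCaratheodory_zero (f := fun z => -I * (f z - f 0)) (R := R) (z := Z) hM
      (((hf.mono (Metric.ball_subset_ball hR1.le)).sub_const _).const_mul _) ?_ hR0
      (by simpa using hZ.trans_lt hrR) (by simp)
    · simp only [norm_mul, norm_neg, norm_I, one_mul] at this
      refine this.trans ?_
      have h1 : 2 * (6 * (E * τ) + θ / K) * ‖Z‖ / (R - ‖Z‖) ≤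
          2 * (6 * (E * τ) + θ / K) * r / (R - r) := by
        gcongr
      refine h1.trans (le_of_eq ?_)
      rw [show 2 * (6 * (E * τ) + θ / K) * r / (R - r) = (6 * (E * τ) + θ / K) * K by
        rw [hK]; ring]
      field_simp
    · intro z hz
      have h1 := (abs_le.1 (hball' z (by simpa using (Metric.mem_ball.1 hz).le))).2
      have h2 := (abs_le.1 hf0).1
      have h3 : 0 < θ / K := by positivity
      simp only [Set.mem_ofPred_eq, neg_mul, neg_re, mul_re, I_re, I_im, sub_im, sub_re]
      linarith
  -- On the edges of the strip T is f divided by a factor of modulus at least 1/2, the lower edge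
  -- being the reflection of the upper one. The strip principle carries the bound 2(‖f 0‖ + 6EτK) to
  -- the interior, and 24KE ≤ 1 absorbs the term with τ.
  have hτle : τ ≤ 4 * ‖f 0‖ := by
    have hedge : ∀ z : ℂ, z.im = 2 * δ → ‖T z‖ ≤ 2 * (‖f 0‖ + 6 * (E * τ) * K) := by
      intro z hz
      have h1 := hfac z (by linarith) hz.le
      have h2 := hBC (exp (2 * I * z)) (by
        rw [norm_exp_two_I_mul, hz, hr, Real.exp_le_exp]
        linarith)
      have h3 := hΦ z (by linarith) hz.le
      have h4 : 1 / 2 ≤ ‖1 - Φ z‖ := by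
        have := norm_sub_norm_le 1 (Φ z)
        rw [norm_one] at this
        linarith
      have h5 : ‖f (exp (2 * I * z))‖ ≤ ‖f 0‖ + 6 * (E * τ) * K := by
        have := norm_sub_norm_le (f (exp (2 * I * z))) (f 0)
        linarith
      rw [h1, norm_mul] at h5
      nlinarith [norm_nonneg (T z)]
    have : τ ≤ 2 * (‖f 0‖ + 6 * (E * τ) * K) := by
      refine csSup_le ⟨_, ⟨0, by simp; linarith, rfl⟩⟩ ?_
      rintro _ ⟨z, hz, rfl⟩
      rw [Set.mem_ofPred_eq, abs_le] at hz
      refine norm_le_on_strip (a := -(2 * δ)) (b := 2 * δ) (A := τ) (by linarith) ?_ ?_ ?_ hedge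
        hz.1 hz.2
      · refine DifferentiableOn.diffContOnCl (hT.mono ?_)
        refine (closure_minimal (t := im ⁻¹' Set.Icc (-(2 * δ)) (2 * δ))
          (fun z hz => ⟨hz.1.le, hz.2.le⟩)
          (isClosed_Icc.preimage continuous_im)).trans fun z hz => ?_
        simp only [Set.mem_ofPred_eq]
        have := abs_le.2 hz
        linarith
      · exact fun z h0 h1 => hτ z (abs_le.2 ⟨h0.le, h1.le⟩)
      · intro z hz
        have h1 := hTc z (by rw [hz, abs_neg, abs_of_pos (by linarith)])
        rw [← norm_conj, ← h1]
        exact hedge _ (by rw [conj_im, hz]; ring)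
    nlinarith
  have hEτ : E * τ ≤ E * (4 * ‖f 0‖) := mul_le_mul_of_nonneg_left hτle hE
  have hn := norm_nonneg (f 0)
  constructor
  · intro Z hZ
    refine (hBC Z hZ).trans ?_
    nlinarith [mul_le_mul_of_nonneg_right hEτ hK0.le, mul_nonneg hE hn]
  · refine hf0.trans ?_
    nlinarith [mul_nonneg (mul_nonneg hK0.le hE) hn]


/-! ### Zeros of a slightly perturbed polynomial -/

theorem prod_norm_sub_le {k : ℕ} (y : Fin k → ℂ) (z t : ℂ) :
    ‖∏ l, (z - y l)‖ ≤ ∏ l, (‖z - t‖ + ‖y l - t‖) := by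
  rw [norm_prod]
  refine Finset.prod_le_prod (fun _ _ => norm_nonneg _) fun l _ => ?_
  rw [show z - y l = (z - t) - (y l - t) by ring]
  exact norm_sub_le _ _

/-- Pigeonhole: if every factor exceeded e₁ times its weight, the product would exceed the assumed
bound. -/
theorem exists_close_zero {k : ℕ} (y : Fin (k + 1) → ℂ) (x t : ℂ) {e₁ : ℝ} (he : 0 ≤ e₁)
    (hx : x ≠ t)
    (h : ‖∏ l, (x - y l)‖ ≤ e₁ ^ (k + 1) * ∏ l, (‖x - t‖ + ‖y l - t‖)) :
    ∃ l, ‖x - y l‖ ≤ e₁ * (‖x - t‖ + ‖y l - t‖) := by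
  by_contra! hne
  have hpos : 0 < ‖x - t‖ := norm_pos_iff.2 (sub_ne_zero.2 hx)
  rw [norm_prod] at h
  rcases he.eq_or_lt with he0 | he0
  · rw [← he0, zero_pow (by omega), zero_mul] at h
    refine h.not_gt (Finset.prod_pos fun l _ => ?_)
    have := hne l
    rw [← he0, zero_mul] at this
    exact this
  · have : ∏ l, (e₁ * (‖x - t‖ + ‖y l - t‖)) < ∏ l, ‖x - y l‖ :=
      Finset.prod_lt_prod_of_nonempty (fun l _ => by positivity) (fun l _ => hne l)
        Finset.univ_nonempty
    rw [Finset.prod_mul_distrib, Finset.prod_const, Finset.card_univ, Fintype.card_fin] at this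
    linarith

/-- Divide out one known zero x₀ and keep the form "polynomial minus small perturbation". The new
perturbation satisfies (z - x₀) ε₁ = ε - (x₀ - y₀) P, where P is the remaining polynomial. This
bounds it outside a disc around x₀ of radius proportional to ‖x₀ - t‖; inside, the maximum principle
applies. The weights relative to t survive because this disc stays away from t. -/
theorem deflation {k : ℕ} {c e e₁ : ℝ} (hc : 0 < c) (hc1 : c ≤ 1 / 2) (he : 0 ≤ e) (hee : e ≤ e₁)
    (he₁ : 4 * e₁ ≤ 1)
    {Ω : Set ℂ} (hΩ : IsOpen Ω) {t x₀ y₀ : ℂ} {y : Fin k → ℂ} {ε : ℂ → ℂ}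
    (hε : DifferentiableOn ℂ ε Ω)
    (hεb : ∀ z ∈ Ω, ‖ε z‖ ≤ e * ((‖z - t‖ + ‖y₀ - t‖) * ∏ l, (‖z - t‖ + ‖y l - t‖)))
    (hx₀ : x₀ ≠ t) (hball : Metric.closedBall x₀ (c * ‖x₀ - t‖) ⊆ Ω)
    (hxy : ‖x₀ - y₀‖ ≤ 4 * e₁ * ‖x₀ - t‖)
    (hroot : (x₀ - y₀) * ∏ l, (x₀ - y l) = ε x₀) :
    ∃ ε₁ : ℂ → ℂ, DifferentiableOn ℂ ε₁ Ω ∧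
      (∀ z ∈ Ω, ‖ε₁ z‖ ≤ 6 * 3 ^ k * (1 + 2 / c) * e₁ * ∏ l, (‖z - t‖ + ‖y l - t‖)) ∧
      ∀ z, (z - y₀) * ∏ l, (z - y l) - ε z = (z - x₀) * (∏ l, (z - y l) - ε₁ z) := by
  have hpos : 0 < ‖x₀ - t‖ := norm_pos_iff.2 (sub_ne_zero.2 hx₀)
  have hx₀Ω : x₀ ∈ Ω := hball (Metric.mem_closedBall_self (by positivity))
  have he₁0 : 0 ≤ e₁ := he.trans hee
  set m : ℂ → ℝ := fun z => ∏ l, (‖z - t‖ + ‖y l - t‖) with hm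
  have hm0 : ∀ z, 0 ≤ m z := fun z => Finset.prod_nonneg fun l _ => by positivity
  set P : ℂ → ℂ := fun z => ∏ l, (z - y l) with hP
  have hPd : Differentiable ℂ P := by
    simp only [hP]; fun_prop
  set g : ℂ → ℂ := fun z => (z - y₀) * P z - ε z with hg
  have hg0 : g x₀ = 0 := by simp only [hg, hP]; rw [hroot, sub_self]
  have hgd : DifferentiableOn ℂ g Ω :=
    (((differentiable_id.sub_const _).mul hPd).differentiableOn).sub hε
  have hslope : ∀ z, (z - x₀) * dslope g x₀ z = g z := by
    intro z
    have := sub_smul_dslope g x₀ z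
    rwa [hg0, sub_zero, smul_eq_mul] at this
  have hε₁d : DifferentiableOn ℂ (fun z => P z - dslope g x₀ z) Ω :=
    hPd.differentiableOn.sub ((Complex.differentiableOn_dslope (hΩ.mem_nhds hx₀Ω)).2 hgd)
  have hy₀ : ‖y₀ - t‖ ≤ 2 * ‖x₀ - t‖ := by
    have : y₀ - t = (x₀ - t) - (x₀ - y₀) := by ring
    rw [this]
    refine (norm_sub_le _ _).trans ?_
    nlinarith
  have hout : ∀ z ∈ Ω, c * ‖x₀ - t‖ ≤ ‖z - x₀‖ →
      ‖P z - dslope g x₀ z‖ ≤ 6 * (1 + 2 / c) * e₁ * m z := by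
    intro z hz hzx
    have hzx0 : 0 < ‖z - x₀‖ := lt_of_lt_of_le (by positivity) hzx
    have h1 : (z - x₀) * (P z - dslope g x₀ z) = ε z - (x₀ - y₀) * P z := by
      rw [mul_sub, hslope]; simp only [hg]; ring
    have h2 : ‖z - x₀‖ * ‖P z - dslope g x₀ z‖ ≤
        e * ((‖z - t‖ + ‖y₀ - t‖) * m z) + 4 * e₁ * ‖x₀ - t‖ * m z := by
      rw [← norm_mul, h1]
      refine (norm_sub_le _ _).trans (add_le_add (hεb z hz) ?_)
      rw [norm_mul]
      exact mul_le_mul hxy (prod_norm_sub_le y z t) (norm_nonneg _) (by positivity)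
    have h3 : e * ((‖z - t‖ + ‖y₀ - t‖) * m z) ≤ e₁ * ((‖z - t‖ + 2 * ‖x₀ - t‖) * m z) := by
      gcongr
    have h4 : ‖z - t‖ + ‖x₀ - t‖ ≤ (1 + 2 / c) * ‖z - x₀‖ := by
      have h5 : ‖z - t‖ ≤ ‖z - x₀‖ + ‖x₀ - t‖ := by
        rw [show z - t = (z - x₀) + (x₀ - t) by ring]; exact norm_add_le _ _
      have h6 : ‖x₀ - t‖ ≤ ‖z - x₀‖ / c := by rw [le_div_iff₀ hc]; linarith
      have : (1 + 2 / c) * ‖z - x₀‖ = ‖z - x₀‖ + 2 * (‖z - x₀‖ / c) := by ring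
      linarith
    have h5 : ‖z - x₀‖ * ‖P z - dslope g x₀ z‖ ≤ ‖z - x₀‖ * (6 * (1 + 2 / c) * e₁ * m z) := by
      have h7 : e₁ * m z * (‖z - t‖ + ‖x₀ - t‖) ≤ e₁ * m z * ((1 + 2 / c) * ‖z - x₀‖) :=
        mul_le_mul_of_nonneg_left h4 (mul_nonneg he₁0 (hm0 z))
      have h8 : 0 ≤ e₁ * m z * ‖z - t‖ := mul_nonneg (mul_nonneg he₁0 (hm0 z)) (norm_nonneg _)
      nlinarith
    exact le_of_mul_le_mul_left h5 hzx0
  refine ⟨fun z => P z - dslope g x₀ z, hε₁d, ?_, fun z => ?_⟩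
  · intro z hz
    have h3k : (1 : ℝ) ≤ 3 ^ k := one_le_pow₀ (by norm_num)
    by_cases hzx : c * ‖x₀ - t‖ ≤ ‖z - x₀‖
    · refine (hout z hz hzx).trans ?_
      have : 0 ≤ 6 * (1 + 2 / c) * e₁ * m z := by have := hm0 z; positivity
      calc 6 * (1 + 2 / c) * e₁ * m z ≤ 3 ^ k * (6 * (1 + 2 / c) * e₁ * m z) :=
            le_mul_of_one_le_left this h3k
        _ = _ := by ring
    · push Not at hzx
      have hzt : (1 - c) * ‖x₀ - t‖ ≤ ‖z - t‖ := by
        have : ‖x₀ - t‖ ≤ ‖z - x₀‖ + ‖z - t‖ := by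
          rw [show x₀ - t = (z - t) - (z - x₀) by ring, add_comm]; exact norm_sub_le _ _
        linarith
      refine Complex.norm_le_of_forall_mem_frontier_norm_le
        (U := Metric.ball x₀ (c * ‖x₀ - t‖)) Metric.isBounded_ball
        (DifferentiableOn.diffContOnCl
          (hε₁d.mono (Metric.closure_ball_subset_closedBall.trans hball))) ?_
        (subset_closure (by simpa [dist_eq_norm] using hzx))
      intro z' hz'
      rw [frontier_ball _ (by positivity), mem_sphere_iff_norm] at hz'
      refine (hout z' (hball (by simpa [dist_eq_norm] using hz'.le)) hz'.ge).trans ?_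
      -- Moving across the disc changes ‖z - t‖ by at most 2c‖x₀ - t‖, which is at most 2‖z - t‖
      -- since c ≤ 1/2; hence a factor 3 for each weight.
      have hmz : m z' ≤ 3 ^ k * m z := by
        have h3 : (3 : ℝ) ^ k = ∏ _l : Fin k, (3 : ℝ) := by simp
        rw [hm, h3, ← Finset.prod_mul_distrib]
        refine Finset.prod_le_prod (fun l _ => by positivity) fun l _ => ?_
        have h1 : ‖z' - t‖ ≤ ‖z' - x₀‖ + ‖z - x₀‖ + ‖z - t‖ := by
          rw [show z' - t = (z' - x₀) - (z - x₀) + (z - t) by ring]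
          exact (norm_add_le _ _).trans (add_le_add_left (norm_sub_le _ _) _)
        have := norm_nonneg (y l - t)
        nlinarith
      have h4 : 0 ≤ 6 * (1 + 2 / c) * e₁ := by positivity
      calc 6 * (1 + 2 / c) * e₁ * m z' ≤ 6 * (1 + 2 / c) * e₁ * (3 ^ k * m z) := by gcongr
        _ = _ := by ring
  · change g z = (z - x₀) * (P z - (P z - dslope g x₀ z))
    rw [sub_sub_cancel, hslope]

/-- Induction on the degree: some y is close to the last x by pigeonhole, that zero is divided out,
and the rest is matched by the induction hypothesis. Dividing out the zeros one at a time is what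
makes σ injective even if the y cluster or coincide. The price is a root of e at each step, hence
the exponent γ. All distances are relative to the base point t, and the final factorization is
recorded because the cancellation within strings needs it. -/
theorem exists_matching (k : ℕ) {c : ℝ} (hc : 0 < c) (hc1 : c ≤ 1 / 2) :
    ∃ C γ : ℝ, 1 ≤ C ∧ 0 < γ ∧ γ ≤ 1 ∧
    ∀ (e : ℝ) (Ω : Set ℂ) (t : ℂ) (x y : Fin k → ℂ) (ε : ℂ → ℂ), 0 ≤ e → e ≤ 1 →
      4 * (C * e ^ γ) ≤ 1 → IsOpen Ω → DifferentiableOn ℂ ε Ω →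
      (∀ z ∈ Ω, ‖ε z‖ ≤ e * ∏ l, (‖z - t‖ + ‖y l - t‖)) →
      Function.Injective x →
      (∀ j, x j ≠ t ∧ Metric.closedBall (x j) (c * ‖x j - t‖) ⊆ Ω) →
      (∀ j, ∏ l, (x j - y l) = ε (x j)) →
      ∃ σ : Fin k → Fin k, Function.Injective σ ∧
        (∀ j, ‖x j - y (σ j)‖ ≤ C * e ^ γ * ‖x j - t‖) ∧
        ∃ ε' : ℂ → ℂ, (∀ z ∈ Ω, ‖ε' z‖ ≤ C * e ^ γ) ∧
          ∀ z, ∏ l, (z - y l) - ε z = (∏ j, (z - x j)) * (1 - ε' z) := by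
  induction k with
  | zero =>
    refine ⟨1, 1, le_rfl, one_pos, le_rfl, ?_⟩
    intro e Ω t x y ε he he1 _ _ _ hb _ _ _
    refine ⟨id, Function.injective_id, fun j => j.elim0, ε, fun z hz => ?_, fun z => by simp⟩
    simpa using hb z hz
  | succ k ih =>
    obtain ⟨C, γ, hC, hγ, hγ1, H⟩ := ih
    set A : ℝ := 6 * 3 ^ k * (1 + 2 / c) with hA
    have hA6 : 6 ≤ A := by
      have h3k : (1 : ℝ) ≤ 3 ^ k := one_le_pow₀ (by norm_num)
      have : 0 < 2 / c := by positivity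
      nlinarith
    have hk1 : (1 : ℝ) ≤ (k + 1 : ℕ) := by exact_mod_cast Nat.le_add_left 1 k
    refine ⟨C * A, γ / (k + 1 : ℕ), by nlinarith, by positivity,
      (div_le_self hγ.le hk1).trans hγ1, ?_⟩
    intro e Ω t x y ε he he1 hsmall hΩ hε hεb hinj hball hroot
    -- The size that one of k + 1 factors must have when their product is of size e.
    set e₁ : ℝ := e ^ ((k + 1 : ℕ) : ℝ)⁻¹ with he₁
    have he₁0 : 0 ≤ e₁ := Real.rpow_nonneg he _
    have he₁1 : e₁ ≤ 1 := Real.rpow_le_one he he1 (by positivity)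
    have hpow : e₁ ^ (k + 1) = e := Real.rpow_inv_natCast_pow he (by omega)
    have hγe : e ^ (γ / (k + 1 : ℕ)) = e₁ ^ γ := by
      rw [he₁, ← Real.rpow_mul he]; congr 1; field_simp
    rw [hγe] at hsmall ⊢
    have hle : e₁ ≤ e₁ ^ γ := by
      rcases he₁0.eq_or_lt with h0 | h0
      · rw [← h0]; exact Real.rpow_nonneg le_rfl _
      · simpa using Real.rpow_le_rpow_of_exponent_ge h0 he₁1 hγ1
    have hAe : A * e₁ ≤ C * A * e₁ ^ γ := by
      calc A * e₁ ≤ A * e₁ ^ γ := by gcongr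
        _ ≤ C * (A * e₁ ^ γ) := le_mul_of_one_le_left (by positivity) hC
        _ = _ := by ring
    have hee : e ≤ e₁ := by
      rw [← hpow, pow_succ]
      exact mul_le_of_le_one_left he₁0 (pow_le_one₀ he₁0 he₁1)
    have hAγ : C * (A * e₁) ^ γ ≤ C * A * e₁ ^ γ := by
      rw [Real.mul_rpow (by linarith) he₁0, ← mul_assoc]
      gcongr
      simpa using Real.rpow_le_rpow_of_exponent_le (x := A) (by linarith) hγ1
    set x₀ := x (Fin.last k)
    have hx₀ := hball (Fin.last k)
    have hx₀Ω : x₀ ∈ Ω := hx₀.2 (Metric.mem_closedBall_self (by positivity))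
    obtain ⟨l₀, hl₀⟩ := exists_close_zero y x₀ t he₁0 hx₀.1 (by
      rw [hroot, hpow]; exact hεb _ hx₀Ω)
    have h4e : 24 * e₁ ≤ 1 := by nlinarith
    have hxy : ‖x₀ - y l₀‖ ≤ 4 * e₁ * ‖x₀ - t‖ := by
      have : ‖y l₀ - t‖ ≤ ‖x₀ - t‖ + ‖x₀ - y l₀‖ := by
        rw [show y l₀ - t = (x₀ - t) - (x₀ - y l₀) by ring]; exact norm_sub_le _ _
      have h0 := norm_nonneg (x₀ - t)
      have h1 := norm_nonneg (x₀ - y l₀)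
      nlinarith [mul_nonneg he₁0 h0, mul_nonneg he₁0 h1, mul_le_mul_of_nonneg_left this he₁0]
    have hsplit : ∀ f : Fin (k + 1) → ℂ, ∏ l, f l = f l₀ * ∏ l, f (l₀.succAbove l) :=
      fun f => Fin.prod_univ_succAbove f l₀
    have hsplit' : ∀ f : Fin (k + 1) → ℝ, ∏ l, f l = f l₀ * ∏ l, f (l₀.succAbove l) :=
      fun f => Fin.prod_univ_succAbove f l₀
    obtain ⟨ε₁, hε₁d, hε₁b, hε₁⟩ := deflation (y := fun l => y (l₀.succAbove l)) (y₀ := y l₀)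
      hc hc1 he hee (by linarith) hΩ hε
      (fun z hz => by rw [← hsplit' fun l => ‖z - t‖ + ‖y l - t‖]; exact hεb z hz)
      hx₀.1 hx₀.2 hxy (by rw [← hsplit fun l => x₀ - y l]; exact hroot _)
    obtain ⟨σ, hσ, hσx, ε', hε'b, hε'⟩ := H (A * e₁) Ω t (fun j => x j.castSucc)
      (fun l => y (l₀.succAbove l)) ε₁ (by positivity) (by linarith) (by linarith) hΩ hε₁d hε₁b
      (hinj.comp (Fin.castSucc_injective k)) (fun j => hball _) (fun j => by
        -- The other zeros remain zeros of the deflated function, since they differ from x₀.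
        have h1 := hε₁ (x j.castSucc)
        rw [← hsplit fun l => x j.castSucc - y l, hroot, sub_self, eq_comm, mul_eq_zero] at h1
        rcases h1 with h1 | h1
        · exact absurd (hinj (sub_eq_zero.1 h1)) (Fin.castSucc_lt_last j).ne
        · exact sub_eq_zero.1 h1)
    refine ⟨Fin.lastCases l₀ fun j => l₀.succAbove (σ j), ?_, ?_, ε', ?_, ?_⟩
    · intro i j
      induction i using Fin.lastCases with
      | last =>
        induction j using Fin.lastCases with
        | last => simp
        | cast j => intro h; simp only [Fin.lastCases_last, Fin.lastCases_castSucc] at h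
                    exact absurd h.symm (Fin.succAbove_ne _ _)
      | cast i =>
        induction j using Fin.lastCases with
        | last => intro h; simp only [Fin.lastCases_last, Fin.lastCases_castSucc] at h
                  exact absurd h (Fin.succAbove_ne _ _)
        | cast j => intro h; simp only [Fin.lastCases_castSucc] at h
                    rw [hσ (Fin.succAbove_right_injective h)]
    · intro j
      induction j using Fin.lastCases with
      | last =>
        simp only [Fin.lastCases_last]
        refine hxy.trans ?_
        gcongr
        nlinarith
      | cast j =>
        simp only [Fin.lastCases_castSucc]
        refine (hσx j).trans ?_
        gcongr
    · exact fun z hz => (hε'b z hz).trans hAγ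
    · intro z
      rw [hsplit fun l => z - y l, hε₁, hε', Fin.prod_univ_castSucc]
      ring


/-! ### Elementary bounds for the sine -/

theorem sq_norm_sin (z : ℂ) : ‖sin z‖ ^ 2 = Real.sin z.re ^ 2 + Real.sinh z.im ^ 2 := by
  rw [Complex.sq_norm, normSq_apply, sin_eq]
  simp only [← ofReal_sin, ← ofReal_cos, ← ofReal_sinh, ← ofReal_cosh, add_re, mul_re, add_im,
    mul_im, ofReal_re, ofReal_im, I_re, I_im]
  have h1 := Real.sin_sq_add_cos_sq z.re
  have h2 := Real.cosh_sq z.im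
  ring_nf
  rw [h2]
  linear_combination Real.sinh z.im ^ 2 * h1

theorem abs_im_le_norm_sin (z : ℂ) : |z.im| ≤ ‖sin z‖ := by
  refine abs_le_of_sq_le_sq' ?_ (norm_nonneg _) |> abs_le.2
  rw [sq_norm_sin]
  have h : z.im ^ 2 ≤ Real.sinh z.im ^ 2 := by
    rw [← sq_abs, ← sq_abs (Real.sinh _), Real.abs_sinh]
    gcongr
    exact Real.self_le_sinh_iff.2 (abs_nonneg _)
  nlinarith [sq_nonneg (Real.sin z.re)]

theorem le_norm_sin_of_le_im {z : ℂ} {c : ℝ} (h : c ≤ z.im) : c ≤ ‖sin z‖ :=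
  (h.trans (le_abs_self _)).trans (abs_im_le_norm_sin z)

theorem le_norm_sin_of_im_le {z : ℂ} {c : ℝ} (h : z.im ≤ -c) : c ≤ ‖sin z‖ :=
  ((le_neg.1 h).trans (neg_le_abs _)).trans (abs_im_le_norm_sin z)

theorem sin_ne_zero_of_norm {z : ℂ} {c : ℝ} (hc : 0 < c) (h : c ≤ ‖sin z‖) : sin z ≠ 0 :=
  norm_pos_iff.1 (hc.trans_le h)

theorem sin_ne_zero_of_im_pos {z : ℂ} (h : 0 < z.im) : sin z ≠ 0 :=
  sin_ne_zero_of_norm h (le_norm_sin_of_le_im le_rfl)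

theorem sin_ne_zero_of_im_neg {z : ℂ} (h : z.im < 0) : sin z ≠ 0 :=
  sin_ne_zero_of_norm (neg_pos.2 h) (le_norm_sin_of_im_le (by simp))

theorem norm_cos_le {u : ℂ} {c : ℝ} (hc : 0 < c) (h : c ≤ ‖sin u‖) :
    ‖cos u‖ ≤ (1 + 1 / c) * ‖sin u‖ := by
  have h1 : ‖cos u‖ ^ 2 ≤ 1 + ‖sin u‖ ^ 2 := by
    rw [← norm_pow, ← norm_pow, cos_sq']
    simpa only [norm_one] using norm_sub_le 1 (sin u ^ 2)
  have h2 : ‖cos u‖ ≤ 1 + ‖sin u‖ := by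
    refine abs_le_of_sq_le_sq' ?_ (by positivity) |>.2
    nlinarith [norm_nonneg (sin u)]
  have h3 : 1 ≤ 1 / c * ‖sin u‖ := by rw [one_div, inv_mul_eq_div, le_div_iff₀ hc]; linarith
  linarith

theorem norm_sin_le_exp (a : ℂ) : ‖sin a‖ ≤ Real.exp ‖a‖ := by
  have h1 : ‖exp (-a * I)‖ ≤ Real.exp ‖a‖ := by
    refine (norm_exp_le_exp_norm _).trans (by simp)
  have h2 : ‖exp (a * I)‖ ≤ Real.exp ‖a‖ := by
    refine (norm_exp_le_exp_norm _).trans (by simp)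
  rw [Complex.sin, norm_div, norm_mul, norm_I, mul_one, Complex.norm_ofNat]
  linarith [norm_sub_le (exp (-a * I)) (exp (a * I))]

theorem norm_cos_le_exp (a : ℂ) : ‖cos a‖ ≤ Real.exp ‖a‖ := by
  have h1 : ‖exp (-a * I)‖ ≤ Real.exp ‖a‖ := by
    refine (norm_exp_le_exp_norm _).trans (by simp)
  have h2 : ‖exp (a * I)‖ ≤ Real.exp ‖a‖ := by
    refine (norm_exp_le_exp_norm _).trans (by simp)
  rw [Complex.cos, norm_div, Complex.norm_ofNat]
  linarith [norm_add_le (exp (a * I)) (exp (-a * I))]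

/-- Away from the zeros of the sine, cos u is bounded by a multiple of sin u. So the estimate is
relative and uniform in Im u, which is not bounded for wide roots. -/
theorem norm_sin_add_le {u a : ℂ} {c : ℝ} (hc : 0 < c) (h : c ≤ ‖sin u‖) :
    ‖sin (u + a)‖ ≤ (2 + 1 / c) * Real.exp ‖a‖ * ‖sin u‖ := by
  rw [sin_add]
  refine (norm_add_le _ _).trans ?_
  rw [norm_mul, norm_mul]
  have h1 := norm_cos_le hc h
  have h2 := norm_sin_le_exp a
  have h3 := norm_cos_le_exp a
  calc ‖sin u‖ * ‖cos a‖ + ‖cos u‖ * ‖sin a‖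
      ≤ ‖sin u‖ * Real.exp ‖a‖ + (1 + 1 / c) * ‖sin u‖ * Real.exp ‖a‖ := by gcongr
    _ = _ := by ring

theorem norm_sin_le_two_mul {a : ℂ} (ha : ‖a‖ ≤ 1) : ‖sin a‖ ≤ 2 * ‖a‖ := by
  have h1 : ‖exp (-a * I) - 1‖ ≤ 2 * ‖a‖ := by
    simpa using norm_exp_sub_one_le (x := -a * I) (by simpa using ha)
  have h2 : ‖exp (a * I) - 1‖ ≤ 2 * ‖a‖ := by
    simpa using norm_exp_sub_one_le (x := a * I) (by simpa using ha)
  rw [Complex.sin, norm_div, norm_mul, norm_I, mul_one, Complex.norm_ofNat]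
  have := norm_sub_le (exp (-a * I) - 1) (exp (a * I) - 1)
  rw [sub_sub_sub_cancel_right] at this
  linarith

/-! ### Multiplicative closeness -/

/-- `a` and `b` agree up to a factor `exp t` with `‖t‖ ≤ e`. -/
def Near (e : ℝ) (a b : ℂ) : Prop := ∃ t : ℂ, ‖t‖ ≤ e ∧ a = b * exp t

namespace Near

variable {e e' : ℝ} {a b a' b' c : ℂ}

theorem refl (a : ℂ) : Near 0 a a := ⟨0, by simp, by simp⟩

theorem nonneg (h : Near e a b) : 0 ≤ e := (norm_nonneg _).trans h.choose_spec.1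

theorem mono (h : Near e a b) (hee : e ≤ e') : Near e' a b :=
  let ⟨t, ht, h⟩ := h; ⟨t, ht.trans hee, h⟩

theorem symm (h : Near e a b) : Near e b a := by
  obtain ⟨t, ht, rfl⟩ := h
  exact ⟨-t, by simpa, by rw [mul_assoc, ← exp_add]; simp⟩

theorem trans (h : Near e a b) (h' : Near e' b c) : Near (e + e') a c := by
  obtain ⟨t, ht, rfl⟩ := h
  obtain ⟨t', ht', rfl⟩ := h'
  exact ⟨t + t', (norm_add_le _ _).trans (add_le_add ht ht'), by rw [exp_add]; ring⟩

theorem mul (h : Near e a b) (h' : Near e' a' b') : Near (e + e') (a * a') (b * b') := by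
  obtain ⟨t, ht, rfl⟩ := h
  obtain ⟨t', ht', rfl⟩ := h'
  exact ⟨t + t', (norm_add_le _ _).trans (add_le_add ht ht'), by rw [exp_add]; ring⟩

theorem inv (h : Near e a b) : Near e a⁻¹ b⁻¹ := by
  obtain ⟨t, ht, rfl⟩ := h
  exact ⟨-t, by simpa, by rw [mul_inv, exp_neg]⟩

theorem div (h : Near e a b) (h' : Near e' a' b') : Near (e + e') (a / a') (b / b') := by
  rw [div_eq_mul_inv, div_eq_mul_inv]
  exact h.mul h'.inv

theorem const_mul (h : Near e a b) (c : ℂ) : Near e (c * a) (c * b) := by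
  simpa using (Near.refl c).mul h

theorem pow (h : Near e a b) (n : ℕ) : Near (n * e) (a ^ n) (b ^ n) := by
  obtain ⟨t, ht, rfl⟩ := h
  refine ⟨n * t, ?_, by rw [mul_pow, exp_nat_mul]⟩
  rw [norm_mul, norm_natCast]
  gcongr

theorem prod {ι : Type*} (s : Finset ι) {f g : ι → ℂ} (h : ∀ i ∈ s, Near e (f i) (g i)) :
    Near (s.card * e) (∏ i ∈ s, f i) (∏ i ∈ s, g i) := by
  classical
  induction s using Finset.induction_on with
  | empty => simpa using Near.refl 1
  | insert i s hi ih =>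
    rw [Finset.prod_insert hi, Finset.prod_insert hi, Finset.card_insert_of_notMem hi]
    refine ((h i (by simp)).mul (ih fun j hj => h j (by simp [hj]))).mono (le_of_eq ?_)
    push_cast
    ring

theorem prod_fin {k : ℕ} {f g : Fin k → ℂ} (h : ∀ i, Near e (f i) (g i)) :
    Near (k * e) (∏ i, f i) (∏ i, g i) := by
  simpa using Near.prod Finset.univ fun i _ => h i

theorem map_conj (h : Near e a b) : Near e (conj a) (conj b) := by
  obtain ⟨t, ht, rfl⟩ := h
  exact ⟨starRingEnd ℂ t, by simpa, by rw [map_mul, exp_conj]⟩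

theorem of_norm_sub_one_le {u : ℂ} (h : ‖u - 1‖ ≤ e) (he : e ≤ 1 / 2) : Near (2 * e) u 1 := by
  have h1 := norm_log_one_add_half_le_self (z := u - 1) (h.trans he)
  rw [add_sub_cancel] at h1
  have hu : u ≠ 0 := by rintro rfl; norm_num at h; linarith
  have := norm_nonneg (u - 1)
  exact ⟨log u, by linarith, by rw [one_mul, exp_log hu]⟩

theorem of_norm_sub_le (hb : b ≠ 0) (h : ‖a - b‖ ≤ e * ‖b‖) (he : e ≤ 1 / 2) :
    Near (2 * e) a b := by
  have h1 : ‖a / b - 1‖ ≤ e := by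
    rw [div_sub_one hb, norm_div, div_le_iff₀ (norm_pos_iff.2 hb)]
    exact h
  simpa [hb] using (of_norm_sub_one_le h1 he).mul (Near.refl b)

theorem norm_sub_one_le (h : Near e a 1) (he : e ≤ 1) : ‖a - 1‖ ≤ 2 * e := by
  obtain ⟨t, ht, rfl⟩ := h
  rw [one_mul]
  exact (norm_exp_sub_one_le (ht.trans he)).trans (by linarith)

theorem norm_le (h : Near e a b) : ‖a‖ ≤ Real.exp e * ‖b‖ := by
  obtain ⟨t, ht, rfl⟩ := h
  rw [norm_mul, mul_comm]
  gcongr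
  exact (norm_exp_le_exp_norm t).trans (Real.exp_le_exp.2 ht)

theorem ne_zero_iff (h : Near e a b) : a ≠ 0 ↔ b ≠ 0 := by
  obtain ⟨t, ht, rfl⟩ := h
  simp

end Near

theorem near_sin_add {u d : ℂ} {c : ℝ} (hc : 0 < c) (h : c ≤ ‖sin u‖) (hd1 : ‖d‖ ≤ 1)
    (hd : (4 + 2 / c) * ‖d‖ ≤ 1 / 2) : Near (2 * ((4 + 2 / c) * ‖d‖)) (sin (u + d)) (sin u) := by
  refine Near.of_norm_sub_le (sin_ne_zero_of_norm hc h) ?_ hd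
  have hd2 : ‖d / 2‖ = ‖d‖ / 2 := by simp
  have h0 := norm_nonneg d
  have h1 : ‖cos d - 1‖ ≤ 2 * ‖d‖ := by
    have : cos d - 1 = -2 * sin (d / 2) ^ 2 := by
      have h3 := cos_sq' (d / 2)
      have h4 := cos_two_mul (d / 2)
      rw [mul_div_cancel₀ d two_ne_zero] at h4
      rw [h4, h3]; ring
    rw [this, norm_mul, norm_pow]
    have h5 := norm_sin_le_two_mul (a := d / 2) (by rw [hd2]; linarith)
    rw [hd2] at h5
    have : ‖sin (d / 2)‖ ^ 2 ≤ (2 * (‖d‖ / 2)) ^ 2 := by gcongr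
    norm_num
    nlinarith
  have h2 := norm_sin_le_two_mul hd1
  have h3 := norm_cos_le hc h
  have h4 := norm_nonneg (sin u)
  have : sin (u + d) - sin u = sin u * (cos d - 1) + cos u * sin d := by rw [sin_add]; ring
  rw [this]
  refine (norm_add_le _ _).trans ?_
  rw [norm_mul, norm_mul]
  calc ‖sin u‖ * ‖cos d - 1‖ + ‖cos u‖ * ‖sin d‖
      ≤ ‖sin u‖ * (2 * ‖d‖) + (1 + 1 / c) * ‖sin u‖ * (2 * ‖d‖) := by gcongr
    _ = _ := by ring

/-! ### The scattering factor -/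

/-- The two-body factor `sin(u + iη) / sin(u - iη)` of the Bethe equations. -/
noncomputable def scat (η : ℝ) (u : ℂ) : ℂ := sin (u + I * η) / sin (u - I * η)

theorem scat_add_pi (η : ℝ) (u : ℂ) : scat η (u + Real.pi) = scat η u := by
  rw [scat, show u + Real.pi + I * η = u + I * η + Real.pi by ring,
    show u + Real.pi - I * η = u - I * η + Real.pi by ring, sin_add_pi, sin_add_pi, neg_div_neg_eq,
    scat]

theorem conj_scat (η : ℝ) (u : ℂ) : conj (scat η u) = (scat η (conj u))⁻¹ := by
  rw [scat, scat, inv_div, map_div₀, ← sin_conj, ← sin_conj]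
  simp [sub_eq_add_neg]

theorem scat_neg (η : ℝ) (u : ℂ) : scat η (-u) = (scat η u)⁻¹ := by
  rw [scat, scat, inv_div, show -u + I * η = -(u - I * η) by ring,
    show -u - I * η = -(u + I * η) by ring, sin_neg, sin_neg, neg_div_neg_eq]

/-- Both sines have the same real part in their argument, so only sinh² of Im u ± η has to be
compared. -/
theorem one_lt_norm_scat_iff {η : ℝ} (hη : 0 < η) {u : ℂ} (h : 1 < ‖scat η u‖) : 0 < u.im := by
  by_contra! hu
  refine h.not_ge ?_
  rw [scat, norm_div]
  refine div_le_one_of_le₀ ?_ (norm_nonneg _)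
  refine abs_le_of_sq_le_sq' ?_ (norm_nonneg _) |>.2
  rw [sq_norm_sin, sq_norm_sin]
  simp only [add_re, sub_re, mul_re, I_re, I_im, ofReal_re, ofReal_im, add_im, sub_im, mul_im]
  have : Real.sinh (u.im + η) ^ 2 ≤ Real.sinh (u.im - η) ^ 2 := by
    rw [← sq_abs, ← sq_abs (Real.sinh (u.im - η)), Real.abs_sinh, Real.abs_sinh]
    have : |u.im + η| ≤ |u.im - η| := by
      rw [abs_of_neg (a := u.im - η) (by linarith), abs_le]
      constructor <;> linarith
    have h2 := Real.sinh_le_sinh.2 this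
    have h3 := Real.sinh_nonneg_iff.2 (abs_nonneg (u.im + η))
    gcongr
  simpa using this


/-! ### The functions `phi`, `psi`, `psiBar` and the identities between them -/

/-- Real roots `x`, holes `ν`, wide roots `y` and close roots `w` of the upper half plane. The
non-real roots of the lower half plane are the conjugates of the `y` and `w`. -/
structure RootData where
  nr : ℕ
  nh : ℕ
  mw : ℕ
  mc : ℕ
  x : Fin nr → ℝ
  ν : Fin nh → ℝ
  y : Fin mw → ℂ
  w : Fin mc → ℂ

namespace RootData

variable (D : RootData) (η α : ℝ)

/-- The length of the chain. -/
def len : ℕ := 2 * (D.nr + 2 * D.mw + 2 * D.mc)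

/-- The exponential of `2πiL` times the counting function. -/
noncomputable def phi (z : ℂ) : ℂ :=
  -exp (-2 * I * Real.pi * α) * (sin (z - I * η / 2) / sin (z + I * η / 2)) ^ D.len *
    (∏ j, scat η (z - D.x j)) * (∏ b, scat η (z - D.y b) * scat η (z - conj (D.y b))) *
    ∏ b, scat η (z - D.w b) * scat η (z - conj (D.w b))

/-- The product over the zeros of `1 - phi` on the real axis, normalised to be bounded in the
upper half plane. -/
noncomputable def psi (z : ℂ) : ℂ :=
  (sin (z + I * η / 2) ^ D.len)⁻¹ * (∏ j, sin (z - D.x j) * sin (z - D.x j + I * η)) *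
    (∏ j, sin (z - D.ν j)) *
    (∏ b, sin (z - conj (D.y b) + I * η) / sin (z - conj (D.y b) - I * η)) *
    ∏ b, sin (z - D.w b + I * η) * sin (z - conj (D.w b) + I * η)

/-- The reflection of `psi` in the real axis. -/
noncomputable def psiBar (z : ℂ) : ℂ :=
  (sin (z - I * η / 2) ^ D.len)⁻¹ * (∏ j, sin (z - D.x j) * sin (z - D.x j - I * η)) *
    (∏ j, sin (z - D.ν j)) *
    (∏ b, sin (z - D.y b - I * η) / sin (z - D.y b + I * η)) *
    ∏ b, sin (z - D.w b - I * η) * sin (z - conj (D.w b) - I * η)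

/-- The higher-level product before the close roots of the lower half plane are eliminated. -/
noncomputable def upper (z : ℂ) : ℂ :=
  (∏ j, sin (z - D.ν j - I * η) / sin (z - D.ν j)) *
    (∏ b, scat η (z - D.y b) *
      (sin (z - conj (D.y b)) / sin (z - conj (D.y b) - 2 * I * η))) *
    ∏ b, (sin (z - D.w b) / sin (z - D.w b - I * η)) *
      (sin (z - conj (D.w b)) / sin (z - conj (D.w b) - I * η))

theorem conj_psi (z : ℂ) : conj (D.psi η z) = D.psiBar η (conj z) := by
  have h1 : ∀ a : ℂ, conj (sin (z - a)) = sin (conj z - conj a) := fun a => by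
    rw [← sin_conj, map_sub]
  have h2 : ∀ a : ℂ, conj (sin (z - a + I * η)) = sin (conj z - conj a - I * η) := fun a => by
    rw [← sin_conj]; simp [sub_eq_add_neg]
  have h3 : ∀ a : ℂ, conj (sin (z - a - I * η)) = sin (conj z - conj a + I * η) := fun a => by
    rw [← sin_conj]; simp [sub_eq_add_neg]
  have h4 : conj (sin (z + I * η / 2)) = sin (conj z - I * η / 2) := by
    rw [← sin_conj]; simp [sub_eq_add_neg, neg_div, map_ofNat]
  simp only [psi, psiBar, map_mul, map_inv₀, map_pow, map_prod, map_div₀, h1, h2, h3, h4,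
    conj_ofReal, Complex.conj_conj]
  congr 1
  exact Finset.prod_congr rfl fun b _ => mul_comm _ _

theorem conj_phi (z : ℂ) : conj (D.phi η α z) = (D.phi η α (conj z))⁻¹ := by
  have h1 : ∀ a : ℂ, conj (scat η (z - a)) = (scat η (conj z - conj a))⁻¹ := fun a => by
    rw [conj_scat, map_sub]
  have h4 : conj (sin (z + I * η / 2)) = sin (conj z - I * η / 2) := by
    rw [← sin_conj]; simp [sub_eq_add_neg, neg_div, map_ofNat]
  have h5 : conj (sin (z - I * η / 2)) = sin (conj z + I * η / 2) := by
    rw [← sin_conj]; simp [sub_eq_add_neg, neg_div, map_ofNat]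
  have h6 : conj (exp (-2 * I * Real.pi * α)) = (exp (-2 * I * Real.pi * α))⁻¹ := by
    rw [← exp_conj, ← exp_neg]; simp [map_ofNat]
  simp only [phi, map_mul, map_neg, map_pow, map_prod, map_div₀, h1, h4, h5, h6, conj_ofReal,
    Complex.conj_conj, mul_inv, inv_neg, ← inv_pow, inv_div, ← Finset.prod_inv_distrib]
  simp only [mul_comm]

theorem psi_add_pi {D : RootData} (η : ℝ) (hν : Even D.nh) (z : ℂ) :
    D.psi η (z + Real.pi) = D.psi η z := by
  have h1 : ∀ a : ℂ, sin (z + Real.pi - a) = -sin (z - a) := fun a => by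
    rw [show z + Real.pi - a = z - a + Real.pi by ring, sin_add_pi]
  have h2 : ∀ a b : ℂ, sin (z + Real.pi - a + b) = -sin (z - a + b) := fun a b => by
    rw [show z + Real.pi - a + b = z - a + b + Real.pi by ring, sin_add_pi]
  have h3 : ∀ a b : ℂ, sin (z + Real.pi - a - b) = -sin (z - a - b) := fun a b => by
    rw [show z + Real.pi - a - b = z - a - b + Real.pi by ring, sin_add_pi]
  have h4 : sin (z + Real.pi + I * η / 2) = -sin (z + I * η / 2) := by
    rw [show z + Real.pi + I * η / 2 = z + I * η / 2 + Real.pi by ring, sin_add_pi]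
  have hl : Even D.len := even_two_mul _
  simp only [psi, h1, h2, h3, h4, neg_mul_neg, neg_div_neg_eq, hl.neg_pow, Finset.prod_neg,
    Finset.card_univ, Fintype.card_fin, hν.neg_one_pow, one_mul]

theorem phi_add_pi (z : ℂ) : D.phi η α (z + Real.pi) = D.phi η α z := by
  have h1 : ∀ a : ℂ, scat η (z + Real.pi - a) = scat η (z - a) := fun a => by
    rw [show z + Real.pi - a = z - a + Real.pi by ring, scat_add_pi]
  have h4 : sin (z + Real.pi + I * η / 2) = -sin (z + I * η / 2) := by
    rw [show z + Real.pi + I * η / 2 = z + I * η / 2 + Real.pi by ring, sin_add_pi]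
  have h5 : sin (z + Real.pi - I * η / 2) = -sin (z - I * η / 2) := by
    rw [show z + Real.pi - I * η / 2 = z - I * η / 2 + Real.pi by ring, sin_add_pi]
  simp only [phi, h1, h4, h5, neg_div_neg_eq]

/-- The jump relation across the real axis. Factor by factor, the quotient of `psi` and its
reflection is the corresponding factor of `phi`; holes and the sines sin(z - x) are common to both.
-/
theorem psi_eq {z : ℂ} (hz : sin (z - I * η / 2) ≠ 0)
    (hx : ∀ j, sin (z - D.x j - I * η) ≠ 0)
    (hy : ∀ b, sin (z - D.y b - I * η) ≠ 0)
    (hy' : ∀ b, sin (z - D.y b + I * η) ≠ 0)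
    (hw : ∀ b, sin (z - D.w b - I * η) ≠ 0)
    (hw' : ∀ b, sin (z - conj (D.w b) - I * η) ≠ 0) :
    D.psi η z = -exp (2 * I * Real.pi * α) * (D.phi η α z * D.psiBar η z) := by
  have he : -exp (2 * I * Real.pi * α) * -exp (-2 * I * Real.pi * α) = 1 := by
    rw [neg_mul_neg, ← exp_add]; simp
  have key : D.psi η z = (sin (z - I * η / 2) / sin (z + I * η / 2)) ^ D.len *
    (∏ j, scat η (z - D.x j)) * (∏ b, scat η (z - D.y b) * scat η (z - conj (D.y b))) *
    (∏ b, scat η (z - D.w b) * scat η (z - conj (D.w b))) * D.psiBar η z := by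
    have h0 : (sin (z + I * η / 2) ^ D.len)⁻¹ =
        (sin (z - I * η / 2) / sin (z + I * η / 2)) ^ D.len * (sin (z - I * η / 2) ^ D.len)⁻¹ := by
      rw [div_pow, div_mul_eq_mul_div, mul_inv_cancel₀ (pow_ne_zero _ hz), one_div]
    have h1 : ∏ j, sin (z - D.x j) * sin (z - D.x j + I * η) =
        (∏ j, scat η (z - D.x j)) * ∏ j, sin (z - D.x j) * sin (z - D.x j - I * η) := by
      rw [← Finset.prod_mul_distrib]
      refine Finset.prod_congr rfl fun j _ => ?_
      rw [scat]; field_simp [hx j]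
    have h2 : ∏ b, sin (z - conj (D.y b) + I * η) / sin (z - conj (D.y b) - I * η) =
        (∏ b, scat η (z - D.y b) * scat η (z - conj (D.y b))) *
          ∏ b, sin (z - D.y b - I * η) / sin (z - D.y b + I * η) := by
      rw [← Finset.prod_mul_distrib]
      refine Finset.prod_congr rfl fun b _ => ?_
      rw [scat, scat]; field_simp [hy b, hy' b]
    have h3 : ∏ b, sin (z - D.w b + I * η) * sin (z - conj (D.w b) + I * η) =
        (∏ b, scat η (z - D.w b) * scat η (z - conj (D.w b))) *
          ∏ b, sin (z - D.w b - I * η) * sin (z - conj (D.w b) - I * η) := by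
      rw [← Finset.prod_mul_distrib]
      refine Finset.prod_congr rfl fun b _ => ?_
      rw [scat, scat]; field_simp [hw b, hw' b]
    rw [psi, h0, h1, h2, h3, psiBar]
    ring
  rw [key, phi]
  linear_combination (-(sin (z - I * η / 2) / sin (z + I * η / 2)) ^ D.len *
    (∏ j, scat η (z - D.x j)) * (∏ b, scat η (z - D.y b) * scat η (z - conj (D.y b))) *
    (∏ b, scat η (z - D.w b) * scat η (z - conj (D.w b))) * D.psiBar η z) * he

/-- Here the real roots drop out. The pairs sin(z - x) sin(z - x + iη) and the power of length `len`
in `psi` telescope under the shift by iη and reproduce exactly their factors in `phi`. Only holes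
and non-real roots are left, in `upper`. -/
theorem phi_mul_psi {z : ℂ} (hz : sin (z - I * η / 2) ≠ 0)
    (hx : ∀ j, sin (z - D.x j - I * η) ≠ 0) (hν : ∀ j, sin (z - D.ν j) ≠ 0) :
    D.phi η α z * D.psi η (z - I * η) =
      -exp (-2 * I * Real.pi * α) * (D.upper η z * D.psi η z) := by
  have h0 : (sin (z + I * η / 2) ^ D.len)⁻¹ =
      (sin (z - I * η / 2) / sin (z + I * η / 2)) ^ D.len *
        (sin (z - I * η + I * η / 2) ^ D.len)⁻¹ := by
    rw [div_pow, show z - I * η + I * η / 2 = z - I * η / 2 by ring, div_mul_eq_mul_div,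
      mul_inv_cancel₀ (pow_ne_zero _ hz), one_div]
  have h1 : ∏ j, sin (z - D.x j) * sin (z - D.x j + I * η) =
      (∏ j, scat η (z - D.x j)) *
        ∏ j, sin (z - I * η - D.x j) * sin (z - I * η - D.x j + I * η) := by
    rw [← Finset.prod_mul_distrib]
    refine Finset.prod_congr rfl fun j _ => ?_
    rw [scat, show z - I * η - D.x j = z - D.x j - I * η by ring, sub_add_cancel]
    field_simp [hx j]
  have h2 : ∏ j, sin (z - I * η - D.ν j) =
      (∏ j, sin (z - D.ν j - I * η) / sin (z - D.ν j)) * ∏ j, sin (z - D.ν j) := by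
    rw [← Finset.prod_mul_distrib]
    refine Finset.prod_congr rfl fun j _ => ?_
    rw [show z - I * η - D.ν j = z - D.ν j - I * η by ring, div_mul_cancel₀ _ (hν j)]
  have h3 : (∏ b, scat η (z - D.y b) * scat η (z - conj (D.y b))) *
      (∏ b, sin (z - I * η - conj (D.y b) + I * η) / sin (z - I * η - conj (D.y b) - I * η)) =
      (∏ b, scat η (z - D.y b) * (sin (z - conj (D.y b)) / sin (z - conj (D.y b) - 2 * I * η))) *
      ∏ b, sin (z - conj (D.y b) + I * η) / sin (z - conj (D.y b) - I * η) := by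
    rw [← Finset.prod_mul_distrib, ← Finset.prod_mul_distrib]
    refine Finset.prod_congr rfl fun b _ => ?_
    rw [scat, scat, show z - I * η - conj (D.y b) + I * η = z - conj (D.y b) by ring,
      show z - I * η - conj (D.y b) - I * η = z - conj (D.y b) - 2 * I * η by ring]
    ring
  have h4 : (∏ b, scat η (z - D.w b) * scat η (z - conj (D.w b))) *
      (∏ b, sin (z - I * η - D.w b + I * η) * sin (z - I * η - conj (D.w b) + I * η)) =
      (∏ b, (sin (z - D.w b) / sin (z - D.w b - I * η)) *
        (sin (z - conj (D.w b)) / sin (z - conj (D.w b) - I * η))) *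
      ∏ b, sin (z - D.w b + I * η) * sin (z - conj (D.w b) + I * η) := by
    rw [← Finset.prod_mul_distrib, ← Finset.prod_mul_distrib]
    refine Finset.prod_congr rfl fun b _ => ?_
    rw [scat, scat, show z - I * η - conj (D.w b) + I * η = z - conj (D.w b) by ring,
      show z - I * η - D.w b + I * η = z - D.w b by ring]
    ring
  rw [phi, psi, psi, upper, h0, h1, h2]
  linear_combination (-exp (-2 * I * Real.pi * α) *
    (sin (z - I * η / 2) / sin (z + I * η / 2)) ^ D.len *
    (sin (z - I * η + I * η / 2) ^ D.len)⁻¹ * (∏ j, scat η (z - D.x j)) *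
    (∏ j, sin (z - I * η - D.x j) * sin (z - I * η - D.x j + I * η)) *
    (∏ j, sin (z - D.ν j - I * η) / sin (z - D.ν j)) * (∏ j, sin (z - D.ν j))) *
    (((∏ b, scat η (z - D.w b) * scat η (z - conj (D.w b))) *
      (∏ b, sin (z - I * η - D.w b + I * η) * sin (z - I * η - conj (D.w b) + I * η))) * h3 +
      ((∏ b, scat η (z - D.y b) * (sin (z - conj (D.y b)) / sin (z - conj (D.y b) - 2 * I * η))) *
      ∏ b, sin (z - conj (D.y b) + I * η) / sin (z - conj (D.y b) - I * η)) * h4)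

/-! ### The product as a function on the disc -/

/-- The function of `Z = exp(2iz)` proportional to `sin (z - a)`. -/
noncomputable def discSin (a Z : ℂ) : ℂ := exp (I * a) - Z * exp (-(I * a))

theorem sin_eq_discSin (z a : ℂ) :
    sin (z - a) = I / 2 * exp (-(I * z)) * discSin a (exp (2 * I * z)) := by
  rw [discSin, Complex.sin, mul_sub, ← mul_assoc, mul_assoc (I / 2), mul_assoc (I / 2),
    ← exp_add, ← exp_add, mul_assoc (I / 2), ← exp_add,
    show -(z - a) * I = -(I * z) + I * a by ring,
    show (z - a) * I = -(I * z) + 2 * I * z + -(I * a) by ring]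
  ring

/-- The function on the unit disc that corresponds to `psi`. -/
noncomputable def discPsi (Z : ℂ) : ℂ :=
  (discSin (-(I * η / 2)) Z ^ D.len)⁻¹ *
    (∏ j, discSin (D.x j) Z * discSin (D.x j - I * η) Z) * (∏ j, discSin (D.ν j) Z) *
    (∏ b, discSin (conj (D.y b) - I * η) Z / discSin (conj (D.y b) + I * η) Z) *
    ∏ b, discSin (D.w b - I * η) Z * discSin (conj (D.w b) - I * η) Z

/-- Each sine is the common factor `g` times a function linear in Z. With this number of holes,
numerator and denominator contain equally many sines, so `g` cancels and `psi` has a finite value at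
Z = 0, that is, at +i∞. -/
theorem psi_eq_discPsi {D : RootData} (η : ℝ) (hν : D.nh = 2 * D.mc + 4 * D.mw) (z : ℂ) :
    D.psi η z = D.discPsi η (exp (2 * I * z)) := by
  set g := I / 2 * exp (-(I * z)) with hg
  have hg0 : g ≠ 0 := by simp [hg]
  have h1 : ∀ a b : ℂ, sin (z - a + b) = g * discSin (a - b) (exp (2 * I * z)) := fun a b => by
    rw [show z - a + b = z - (a - b) by ring, sin_eq_discSin]
  have h2 : ∀ a b : ℂ, sin (z - a - b) = g * discSin (a + b) (exp (2 * I * z)) := fun a b => by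
    rw [show z - a - b = z - (a + b) by ring, sin_eq_discSin]
  have h3 : ∀ a : ℂ, sin (z - a) = g * discSin a (exp (2 * I * z)) := fun a => sin_eq_discSin z a
  have h4 : sin (z + I * η / 2) = g * discSin (-(I * η / 2)) (exp (2 * I * z)) := by
    rw [← h3, sub_neg_eq_add]
  simp only [psi, discPsi, h1, h2, h3, h4, mul_pow, mul_div_mul_left _ _ hg0,
    mul_mul_mul_comm g, Finset.prod_mul_distrib, Finset.prod_const, Finset.card_univ,
    Fintype.card_fin, mul_inv]
  have hl : g ^ D.len = (g ^ D.nr * g ^ D.nr) * g ^ D.nh * (g ^ D.mc * g ^ D.mc) := by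
    rw [← pow_add, ← pow_add, ← pow_add, ← pow_add, hν, len]
    congr 1
    ring
  rw [hl]
  field_simp

theorem discSin_ne_zero {a Z : ℂ} (ha : a.im < 0) (hZ : ‖Z‖ < 1) : discSin a Z ≠ 0 := by
  rw [discSin, sub_ne_zero]
  intro h
  have h1 : ‖exp (I * a)‖ = Real.exp (-a.im) := by rw [norm_exp]; simp
  have h2 : ‖exp (-(I * a))‖ = Real.exp (a.im) := by rw [norm_exp]; simp
  have h3 := congrArg norm h
  rw [norm_mul, h1, h2] at h3
  have h4 : Real.exp a.im < Real.exp (-a.im) := Real.exp_lt_exp.2 (by linarith)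
  have := Real.exp_pos a.im
  nlinarith [norm_nonneg Z]

theorem differentiable_discSin (a : ℂ) : Differentiable ℂ (discSin a) := by
  unfold discSin; fun_prop

theorem differentiableOn_discPsi {D : RootData} {η : ℝ} (hη : 0 < η)
    (hy : ∀ b, η < (D.y b).im) : DifferentiableOn ℂ (D.discPsi η) (Metric.ball 0 1) := by
  have hd : ∀ a, DifferentiableOn ℂ (discSin a) (Metric.ball 0 1) :=
    fun a => (differentiable_discSin a).differentiableOn
  unfold discPsi
  refine DifferentiableOn.mul (DifferentiableOn.mul (DifferentiableOn.mul (DifferentiableOn.mul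
    (DifferentiableOn.inv ((hd _).pow _) ?_) ?_) ?_) ?_) ?_
  · intro Z hZ
    refine pow_ne_zero _ (discSin_ne_zero ?_ (by simpa using hZ))
    simp
    linarith
  · exact DifferentiableOn.fun_finsetProd fun j _ => (hd _).mul (hd _)
  · exact DifferentiableOn.fun_finsetProd fun j _ => hd _
  · refine DifferentiableOn.fun_finsetProd fun b _ => (hd _).div (hd _) fun Z hZ =>
      discSin_ne_zero ?_ (by simpa using hZ)
    simp
    linarith [hy b]
  · exact DifferentiableOn.fun_finsetProd fun j _ => (hd _).mul (hd _)

theorem discPsi_zero_ne_zero : D.discPsi η 0 ≠ 0 := by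
  simp [discPsi, discSin, Finset.prod_ne_zero_iff]

end RootData


/-! ### Near-constancy of `psi` away from the real axis -/

namespace RootData

/-- The properties of the roots and holes of a solution of the Bethe equations that are used in
the derivation of the higher-level equations. -/
structure Good (D : RootData) (η α δ E : ℝ) : Prop where
  δ_pos : 0 < δ
  δ_le : 8 * δ ≤ η
  E_nonneg : 0 ≤ E
  holes : D.nh = 2 * D.mc + 4 * D.mw
  y_im : ∀ b, η + 4 * δ ≤ (D.y b).im
  w_im : ∀ b, 3 * δ ≤ (D.w b).im
  w_im_le : ∀ b, (D.w b).im ≤ η - 4 * δ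
  w_inj : ∀ a b, exp (2 * I * D.w a) = exp (2 * I * D.w b) → a = b
  phi_y : ∀ b, D.phi η α (D.y b) = 1
  phi_w : ∀ b, D.phi η α (D.w b) = 1
  phi_le : ∀ z : ℂ, δ ≤ z.im → z.im ≤ 2 * δ → ‖D.phi η α z‖ ≤ E
  zeros : ∀ z : ℂ, |z.im| < 3 * δ → D.phi η α z = 1 →
    (∃ j, sin (z - D.x j) = 0) ∨ ∃ j, sin (z - D.ν j) = 0
  deriv_ne_zero : ∀ z : ℂ, |z.im| < 3 * δ → D.phi η α z = 1 → deriv (D.phi η α) z ≠ 0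

theorem isOpen_strip (δ : ℝ) : IsOpen {z : ℂ | |z.im| < 3 * δ} :=
  isOpen_lt (continuous_abs.comp continuous_im) continuous_const

theorem differentiableAt_scat {η : ℝ} {a z : ℂ} (h : sin (z - a - I * η) ≠ 0) :
    DifferentiableAt ℂ (fun z => scat η (z - a)) z := by
  unfold scat
  refine DifferentiableAt.div ?_ ?_ h <;> fun_prop

theorem scat_ne_zero {η : ℝ} {u : ℂ} (h : sin (u + I * η) ≠ 0) (h' : sin (u - I * η) ≠ 0) :
    scat η u ≠ 0 := div_ne_zero h h'

variable {D : RootData} {η α δ E : ℝ}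

/-- The quotient of `psi` and `1 - phi`, with the zeros of the denominator removed. -/
noncomputable def quot (D : RootData) (η α : ℝ) (z : ℂ) : ℂ :=
  open Classical in
  if D.phi η α z = 1 then deriv (D.psi η) z / -deriv (D.phi η α) z
  else D.psi η z / (1 - D.phi η α z)

namespace Good

variable (h : D.Good η α δ E)
include h

theorem η_pos : 0 < η := by linarith [h.δ_pos, h.δ_le]

theorem strip_ne_zero {z : ℂ} (hz : |z.im| < 3 * δ) :
    sin (z + I * η / 2) ≠ 0 ∧ sin (z - I * η / 2) ≠ 0 ∧
    (∀ j, sin (z - D.x j + I * η) ≠ 0 ∧ sin (z - D.x j - I * η) ≠ 0) ∧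
    (∀ b, (sin (z - D.y b + I * η) ≠ 0 ∧ sin (z - D.y b - I * η) ≠ 0) ∧
      sin (z - conj (D.y b) + I * η) ≠ 0 ∧ sin (z - conj (D.y b) - I * η) ≠ 0) ∧
    ∀ b, (sin (z - D.w b + I * η) ≠ 0 ∧ sin (z - D.w b - I * η) ≠ 0) ∧
      sin (z - conj (D.w b) + I * η) ≠ 0 ∧ sin (z - conj (D.w b) - I * η) ≠ 0 := by
  have hδ := h.δ_pos
  have hδη := h.δ_le
  obtain ⟨h1, h2⟩ := abs_lt.1 hz
  refine ⟨?_, ?_, fun j => ⟨?_, ?_⟩, fun b => ⟨⟨?_, ?_⟩, ?_, ?_⟩, fun b => ⟨⟨?_, ?_⟩, ?_, ?_⟩⟩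
  · apply sin_ne_zero_of_im_pos; simp; linarith
  · apply sin_ne_zero_of_im_neg; simp; linarith
  · apply sin_ne_zero_of_im_pos; simp; linarith
  · apply sin_ne_zero_of_im_neg; simp; linarith
  all_goals first | have h3 := h.y_im b | have h3 := h.w_im b
  all_goals try have h4 := h.w_im_le b
  · apply sin_ne_zero_of_im_neg; simp; linarith
  · apply sin_ne_zero_of_im_neg; simp; linarith
  · apply sin_ne_zero_of_im_pos; simp; linarith
  · apply sin_ne_zero_of_im_pos; simp; linarith
  · apply sin_ne_zero_of_im_pos; simp; linarith
  · apply sin_ne_zero_of_im_neg; simp; linarith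
  · apply sin_ne_zero_of_im_pos; simp; linarith
  · apply sin_ne_zero_of_im_neg; simp; linarith

theorem differentiableAt_phi {z : ℂ} (hz : |z.im| < 3 * δ) :
    DifferentiableAt ℂ (D.phi η α) z := by
  obtain ⟨h1, h2, h3, h4, h5⟩ := h.strip_ne_zero hz
  have hp : DifferentiableAt ℂ
      (fun z : ℂ => (sin (z - I * η / 2) / sin (z + I * η / 2)) ^ D.len) z :=
    DifferentiableAt.fun_pow (DifferentiableAt.fun_div (c := fun z : ℂ => sin (z - I * η / 2))
      (d := fun z : ℂ => sin (z + I * η / 2)) (by fun_prop) (by fun_prop) h1) _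
  have hx : DifferentiableAt ℂ (fun z : ℂ => ∏ j, scat η (z - D.x j)) z :=
    DifferentiableAt.fun_finsetProd fun j _ => differentiableAt_scat (h3 j).2
  have hy : DifferentiableAt ℂ
      (fun z : ℂ => ∏ b, scat η (z - D.y b) * scat η (z - conj (D.y b))) z :=
    DifferentiableAt.fun_finsetProd fun b _ =>
      (differentiableAt_scat (h4 b).1.2).fun_mul (differentiableAt_scat (h4 b).2.2)
  have hw : DifferentiableAt ℂ
      (fun z : ℂ => ∏ b, scat η (z - D.w b) * scat η (z - conj (D.w b))) z :=
    DifferentiableAt.fun_finsetProd fun b _ =>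
      (differentiableAt_scat (h5 b).1.2).fun_mul (differentiableAt_scat (h5 b).2.2)
  exact (((hp.const_mul _).fun_mul hx).fun_mul hy).fun_mul hw

theorem differentiableAt_psi {z : ℂ} (hz : |z.im| < 3 * δ) :
    DifferentiableAt ℂ (D.psi η) z := by
  obtain ⟨h1, h2, h3, h4, h5⟩ := h.strip_ne_zero hz
  unfold psi
  refine DifferentiableAt.mul (DifferentiableAt.mul (DifferentiableAt.mul (DifferentiableAt.mul
    (DifferentiableAt.inv (DifferentiableAt.pow ?_ _) (pow_ne_zero _ h1)) ?_) ?_) ?_) ?_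
  · fun_prop
  · fun_prop
  · fun_prop
  · refine DifferentiableAt.fun_finsetProd fun b _ => DifferentiableAt.div ?_ ?_ (h4 b).2.2 <;>
      fun_prop
  · fun_prop

theorem phi_ne_zero {z : ℂ} (hz : |z.im| < 3 * δ) : D.phi η α z ≠ 0 := by
  obtain ⟨h1, h2, h3, h4, h5⟩ := h.strip_ne_zero hz
  unfold phi
  refine mul_ne_zero (mul_ne_zero (mul_ne_zero (mul_ne_zero (by simp)
    (pow_ne_zero _ (div_ne_zero h2 h1))) ?_) ?_) ?_
  · exact Finset.prod_ne_zero_iff.2 fun j _ => scat_ne_zero (h3 j).1 (h3 j).2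
  · exact Finset.prod_ne_zero_iff.2 fun b _ => mul_ne_zero (scat_ne_zero (h4 b).1.1 (h4 b).1.2)
      (scat_ne_zero (h4 b).2.1 (h4 b).2.2)
  · exact Finset.prod_ne_zero_iff.2 fun b _ => mul_ne_zero (scat_ne_zero (h5 b).1.1 (h5 b).1.2)
      (scat_ne_zero (h5 b).2.1 (h5 b).2.2)

theorem psi_eq_zero {z : ℂ} (hz : |z.im| < 3 * δ) (h1 : D.phi η α z = 1) : D.psi η z = 0 := by
  rcases h.zeros z hz h1 with ⟨j, hj⟩ | ⟨j, hj⟩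
  · have : ∏ j, sin (z - D.x j) * sin (z - D.x j + I * η) = 0 :=
      Finset.prod_eq_zero (Finset.mem_univ j) (by rw [hj, zero_mul])
    simp only [psi, this, mul_zero, zero_mul]
  · have : ∏ j, sin (z - D.ν j) = 0 := Finset.prod_eq_zero (Finset.mem_univ j) hj
    simp only [psi, this, mul_zero, zero_mul]

theorem psi_eq_mul_quot {z : ℂ} (hz : |z.im| < 3 * δ) :
    D.psi η z = (1 - D.phi η α z) * D.quot η α z := by
  by_cases h1 : D.phi η α z = 1
  · rw [h.psi_eq_zero hz h1, h1, sub_self, zero_mul]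
  · rw [quot, if_neg h1, mul_div_cancel₀ _ (sub_ne_zero.2 (Ne.symm h1))]

theorem eventually_phi_ne_one {z₀ : ℂ} (hz : |z₀.im| < 3 * δ) :
    ∀ᶠ z in 𝓝[≠] z₀, D.phi η α z ≠ 1 := by
  by_cases h1 : D.phi η α z₀ = 1
  · exact (h.differentiableAt_phi hz).hasDerivAt.eventually_ne (h.deriv_ne_zero z₀ hz h1)
  · exact ((h.differentiableAt_phi hz).continuousAt.eventually_ne h1).filter_mono
      nhdsWithin_le_nhds

/-- The zeros of 1 - `phi` are simple and `psi` vanishes there, so near such a point the quotient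
equals that of the two difference quotients `dslope`, whose denominator is non-zero. -/
theorem differentiableAt_quot {z₀ : ℂ} (hz : |z₀.im| < 3 * δ) :
    DifferentiableAt ℂ (D.quot η α) z₀ := by
  by_cases h1 : D.phi η α z₀ = 1
  · have hs : {z : ℂ | |z.im| < 3 * δ} ∈ 𝓝 z₀ := (isOpen_strip δ).mem_nhds hz
    have hφ : DifferentiableAt ℂ (dslope (D.phi η α) z₀) z₀ :=
      ((Complex.differentiableOn_dslope hs).2 fun z hz =>
        (h.differentiableAt_phi hz).differentiableWithinAt).differentiableAt hs
    have hψ : DifferentiableAt ℂ (dslope (D.psi η) z₀) z₀ :=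
      ((Complex.differentiableOn_dslope hs).2 fun z hz =>
        (h.differentiableAt_psi hz).differentiableWithinAt).differentiableAt hs
    have hne : dslope (D.phi η α) z₀ z₀ ≠ 0 := by
      rw [dslope_same]; exact h.deriv_ne_zero z₀ hz h1
    refine (hψ.div hφ.neg (neg_ne_zero.2 hne)).congr_of_eventuallyEq ?_
    have hev := eventually_nhdsWithin_iff.1 (h.eventually_phi_ne_one hz)
    filter_upwards [hev] with z hz'
    by_cases hzz : z = z₀
    · subst hzz
      simp only [quot, if_pos h1, Pi.div_apply, Pi.neg_apply, dslope_same]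
    · have h2 := hz' hzz
      have h3 := sub_ne_zero.2 hzz
      have e1 := sub_smul_dslope (D.phi η α) z₀ z
      have e2 := sub_smul_dslope (D.psi η) z₀ z
      rw [h1, smul_eq_mul] at e1
      rw [h.psi_eq_zero hz h1, sub_zero, smul_eq_mul] at e2
      simp only [quot, if_neg h2, Pi.div_apply, Pi.neg_apply]
      rw [← e2, show 1 - D.phi η α z = (z - z₀) * -dslope (D.phi η α) z₀ z by
        rw [mul_neg, e1]; ring, mul_div_mul_left _ _ h3]
  · have h2 := (h.differentiableAt_phi hz).continuousAt.eventually_ne h1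
    refine ((h.differentiableAt_psi hz).div ((h.differentiableAt_phi hz).const_sub 1)
      (sub_ne_zero.2 (Ne.symm h1))).congr_of_eventuallyEq ?_
    filter_upwards [h2] with z hz'
    simp only [quot, if_neg hz', Pi.div_apply]

theorem even_holes : Even D.nh := by
  rw [h.holes]; exact ⟨D.mc + 2 * D.mw, by ring⟩

theorem quot_add_pi (z : ℂ) : D.quot η α (z + Real.pi) = D.quot η α z := by
  have h1 : deriv (D.psi η) (z + Real.pi) = deriv (D.psi η) z := by
    rw [← deriv_comp_add_const (D.psi η) (Real.pi : ℂ) z]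
    exact congrArg (fun f => deriv f z) (funext fun z => psi_add_pi η h.even_holes z)
  have h2 : deriv (D.phi η α) (z + Real.pi) = deriv (D.phi η α) z := by
    rw [← deriv_comp_add_const (D.phi η α) (Real.pi : ℂ) z]
    exact congrArg (fun f => deriv f z) (funext fun z => phi_add_pi D η α z)
  simp only [quot, h1, h2, phi_add_pi, psi_add_pi η h.even_holes]

theorem quot_bounded : ∃ A, ∀ z : ℂ, |z.im| ≤ 2 * δ → ‖D.quot η α z‖ ≤ A := by
  have hδ := h.δ_pos
  have hK : IsCompact (Set.Icc 0 Real.pi ×ℂ Set.Icc (-(2 * δ)) (2 * δ)) :=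
    isCompact_Icc.reProdIm isCompact_Icc
  obtain ⟨A, hA⟩ := hK.exists_bound_of_continuousOn (f := D.quot η α) fun z hz => by
    refine (h.differentiableAt_quot ?_).continuousAt.continuousWithinAt
    have := abs_le.2 hz.2
    linarith
  refine ⟨A, fun z hz => ?_⟩
  have hper : Function.Periodic (fun x : ℝ => D.quot η α (x + z.im * I)) Real.pi := fun x => by
    have := h.quot_add_pi (x + z.im * I)
    simp only
    rw [← this]
    push_cast
    ring_nf
  obtain ⟨x, hx, hxe⟩ := hper.exists_mem_Ico₀ Real.pi_pos z.re
  have hz2 : D.quot η α z = D.quot η α (x + z.im * I) := by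
    have : D.quot η α (z.re + z.im * I) = D.quot η α (x + z.im * I) := hxe
    rwa [re_add_im] at this
  rw [hz2]
  refine hA _ ⟨?_, ?_⟩
  · simpa using ⟨hx.1, hx.2.le⟩
  · simpa using abs_le.1 hz

theorem psi_eq_psiBar {z : ℂ} (hz : |z.im| < 3 * δ) :
    D.psi η z = -exp (2 * I * Real.pi * α) * (D.phi η α z * D.psiBar η z) := by
  obtain ⟨h1, h2, h3, h4, h5⟩ := h.strip_ne_zero hz
  exact D.psi_eq η α h2 (fun j => (h3 j).2) (fun b => (h4 b).1.2) (fun b => (h4 b).1.1)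
    (fun b => (h5 b).1.2) (fun b => (h5 b).2.2)

/-- Conjugation inverts `phi` and turns `psi` into `psiBar`; the jump relation turns `psiBar` back
into `psi`, leaving only the twist, which is split evenly between both sides. This works where `phi
≠ 1`; the isolated exceptional points follow by continuity. -/
theorem quot_conj {z : ℂ} (hz : |z.im| < 3 * δ) :
    exp (-(I * Real.pi * α)) * D.quot η α (conj z) =
      conj (exp (-(I * Real.pi * α)) * D.quot η α z) := by
  have hc : ∀ {z : ℂ}, |z.im| < 3 * δ → |(conj z).im| < 3 * δ := fun h => by simpa using h
  have key : ∀ z : ℂ, |z.im| < 3 * δ → D.phi η α z ≠ 1 →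
      exp (-(I * Real.pi * α)) * D.quot η α (conj z) =
      conj (exp (-(I * Real.pi * α)) * D.quot η α z) := by
    intro z hz h1
    have h0 := h.phi_ne_zero hz
    have hφ : D.phi η α (conj z) = (conj (D.phi η α z))⁻¹ := by
      rw [conj_phi, inv_inv]
    have hcφ : conj (D.phi η α z) ≠ 0 := by simpa using h0
    have h1' : D.phi η α (conj z) ≠ 1 := by
      rw [hφ]; intro h2
      rw [inv_eq_one, ← map_one conj] at h2
      exact h1 (starRingEnd ℂ |>.injective h2)
    have h2 := h.psi_eq_psiBar (hc hz)
    rw [← Complex.conj_conj z, ← conj_psi, Complex.conj_conj, hφ] at h2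
    simp only [Complex.conj_conj] at h2
    have h3 : 1 - conj (D.phi η α z) ≠ 0 := by
      intro h4
      rw [← map_one conj, ← map_sub] at h4
      exact h1 (sub_eq_zero.1 ((map_eq_zero _).1 h4)).symm
    rw [quot, quot, if_neg h1, if_neg h1', h2, hφ, map_mul, map_div₀, map_sub, map_one]
    have h4 : conj (exp (-(I * Real.pi * α))) = exp (I * Real.pi * α) := by
      rw [← exp_conj]; simp
    have h5 : exp (-(I * Real.pi * α)) * exp (2 * I * Real.pi * α) = exp (I * Real.pi * α) := by
      rw [← exp_add]; ring_nf
    have h6 : 1 - (conj (D.phi η α z))⁻¹ = -((1 - conj (D.phi η α z)) / conj (D.phi η α z)) := by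
      field_simp; ring
    rw [h4, h6, ← h5]
    field_simp
  have hcont1 : ContinuousAt (fun z => exp (-(I * Real.pi * α)) * D.quot η α (conj z)) z :=
    continuousAt_const.mul (ContinuousAt.comp (f := fun z => conj z) (g := D.quot η α)
      (h.differentiableAt_quot (hc hz)).continuousAt continuous_conj.continuousAt)
  have hcont2 : ContinuousAt (fun z => conj (exp (-(I * Real.pi * α)) * D.quot η α z)) z :=
    continuous_conj.continuousAt.comp
      (continuousAt_const.mul (h.differentiableAt_quot hz).continuousAt)
  refine tendsto_nhds_unique_of_eventuallyEq (hcont1.tendsto.mono_left nhdsWithin_le_nhds)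
    (hcont2.tendsto.mono_left (nhdsWithin_le_nhds (s := {z}ᶜ))) ?_
  filter_upwards [h.eventually_phi_ne_one hz,
    nhdsWithin_le_nhds ((isOpen_strip δ).mem_nhds hz)] with z hz1 hz2
  exact key z hz2 hz1

end Good

/-- `near_const_of_factorization` with f = c `discPsi`, T = c `quot` and Φ = `phi`. The statement on
`psiBar` is the reflected one. Its constant is conj C₀, and since Im(c C₀) is small this agrees with
the twisted C₀ up to O(E). -/
theorem exists_psi_near {δ : ℝ} (hδ : 0 < δ) : ∃ C : ℝ, 0 < C ∧
    ∀ (D : RootData) (η α E : ℝ), D.Good η α δ E → C * E ≤ 1 → ∃ C₀ : ℂ, C₀ ≠ 0 ∧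
      (∀ z : ℂ, 2 * δ ≤ z.im → Near (C * E) (D.psi η z) C₀) ∧
      ∀ z : ℂ, z.im ≤ -(2 * δ) →
        Near (C * E) (D.psiBar η z) (exp (-2 * I * Real.pi * α) * C₀) := by
  obtain ⟨C, hC, H⟩ := near_const_of_factorization hδ
  refine ⟨8 * C, by linarith, ?_⟩
  intro D η α E h hE
  have hη := h.η_pos
  have hE0 := h.E_nonneg
  have hCE : 0 ≤ C * E := by positivity
  -- Half of the twist: the phase that makes `quot` real on the axis.
  set c := exp (-(I * Real.pi * α)) with hc
  have hc1 : ‖c‖ = 1 := by rw [hc, norm_exp]; simp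
  have hc0 : c ≠ 0 := exp_ne_zero _
  obtain ⟨H1, H2⟩ := H E (fun Z => c * D.discPsi η Z) (fun z => c * D.quot η α z) (D.phi η α)
    hE0 (by nlinarith)
    ((differentiableOn_discPsi hη fun b => by linarith [h.y_im b]).const_mul _)
    (fun z hz => ((h.differentiableAt_quot hz).const_mul c).differentiableWithinAt)
    (by
      obtain ⟨A, hA⟩ := h.quot_bounded
      exact ⟨A, fun z hz => by rw [norm_mul, hc1, one_mul]; exact hA z hz⟩)
    (fun z hz => h.quot_conj (by linarith))
    (fun z h1 h2 => by
      rw [← psi_eq_discPsi η h.holes, h.psi_eq_mul_quot (by rw [abs_lt]; constructor <;> linarith)]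
      ring)
    h.phi_le
  set C₀ := D.discPsi η 0 with hC₀
  have hC₀0 : C₀ ≠ 0 := D.discPsi_zero_ne_zero η
  have hpsi : ∀ z : ℂ, 2 * δ ≤ z.im → Near (2 * (C * E)) (D.psi η z) C₀ := by
    intro z hz
    refine Near.of_norm_sub_le hC₀0 ?_ (by linarith)
    have h1 := H1 (exp (2 * I * z)) (by
      rw [norm_exp_two_I_mul, Real.exp_le_exp]; linarith)
    simp only [← psi_eq_discPsi η h.holes, ← mul_sub, norm_mul, hc1, one_mul] at h1
    exact h1
  refine ⟨C₀, hC₀0, fun z hz => (hpsi z hz).mono (by linarith), fun z hz => ?_⟩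
  have h1 := (hpsi (conj z) (by rw [conj_im]; linarith)).map_conj
  rw [conj_psi, Complex.conj_conj] at h1
  -- The difference of the two sides is -2i c Im(c C₀), because |c| = 1.
  have h2 : Near (2 * (2 * (C * E))) (conj C₀) (exp (-2 * I * Real.pi * α) * C₀) := by
    have hcc : exp (-2 * I * Real.pi * α) = c * c := by rw [hc, ← exp_add]; ring_nf
    have hcconj : c * conj c = 1 := by
      rw [mul_conj, normSq_eq_norm_sq, hc1]; simp
    refine Near.of_norm_sub_le (by simp [hC₀0]) ?_ (by linarith)
    have h3 : conj C₀ - exp (-2 * I * Real.pi * α) * C₀ = c * (-2 * I * ((c * C₀).im : ℂ)) := by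
      have h4 := sub_conj (c * C₀)
      rw [map_mul] at h4
      rw [hcc]
      push_cast at h4
      linear_combination (-conj C₀) * hcconj - c * h4
    rw [h3]
    simp only [norm_mul, hc1, one_mul, norm_neg, Complex.norm_ofNat, norm_I, mul_one, norm_real,
      Real.norm_eq_abs] at H2 ⊢
    rw [hcc, norm_mul, hc1]
    linarith
  exact (h1.trans h2).mono (by linarith)

end RootData


/-! ### Lower bounds for the denominators -/

/-- A zero of sin v cannot be compensated by a zero of sin(v + a) when sin a is not small: near sin
v = 0 the numerator is about cos v sin a. So a bounded quotient keeps sin v away from 0. -/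
theorem sin_lower_bound {v a : ℂ} {B r : ℝ} (hr : 0 < r) (hB : 0 ≤ B) (ha : r ≤ ‖sin a‖)
    (hv : sin v ≠ 0) (h : ‖sin (v + a) / sin v‖ ≤ B) :
    r / (B + Real.exp ‖a‖ + r) ≤ ‖sin v‖ := by
  have he := Real.exp_pos ‖a‖
  rw [norm_div, div_le_iff₀ (norm_pos_iff.2 hv)] at h
  have h1 : ‖cos v‖ * ‖sin a‖ ≤ ‖sin (v + a)‖ + ‖sin v‖ * ‖cos a‖ := by
    rw [← norm_mul, ← norm_mul]
    have : cos v * sin a = sin (v + a) - sin v * cos a := by rw [sin_add]; ring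
    rw [this]
    exact norm_sub_le _ _
  have h2 : 1 ≤ ‖cos v‖ + ‖sin v‖ := by
    have h3 : (1 : ℝ) ≤ ‖cos v‖ ^ 2 + ‖sin v‖ ^ 2 := by
      rw [← norm_pow, ← norm_pow]
      have := norm_add_le (cos v ^ 2) (sin v ^ 2)
      rwa [add_comm (cos v ^ 2), sin_sq_add_cos_sq, norm_one] at this
    nlinarith [norm_nonneg (cos v), norm_nonneg (sin v)]
  have h3 := norm_cos_le_exp a
  have hs := norm_nonneg (sin v)
  have hcn := norm_nonneg (cos v)
  rw [div_le_iff₀ (by positivity)]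
  have h4 : r * (1 - ‖sin v‖) ≤ ‖cos v‖ * ‖sin a‖ := by
    calc r * (1 - ‖sin v‖) ≤ r * ‖cos v‖ := by gcongr; linarith
      _ ≤ ‖sin a‖ * ‖cos v‖ := by gcongr
      _ = _ := mul_comm _ _
  have h5 : ‖sin v‖ * ‖cos a‖ ≤ ‖sin v‖ * Real.exp ‖a‖ := by gcongr
  nlinarith

theorem pow_le_prod {k : ℕ} {f : Fin k → ℝ} {l : ℝ} (hl : 0 ≤ l) (h : ∀ i, l ≤ f i) :
    l ^ k ≤ ∏ i, f i := by
  calc l ^ k = ∏ _i : Fin k, l := by simp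
    _ ≤ _ := Finset.prod_le_prod (fun _ _ => hl) fun i _ => h i

/-- Isolates one factor while the others are bounded below. As l ≤ 1, the exponent may be k instead
of k - 1, which keeps the bookkeeping uniform. -/
theorem mul_pow_le_prod {k : ℕ} {f : Fin k → ℝ} {l : ℝ} (hl : 0 ≤ l) (hl1 : l ≤ 1)
    (h : ∀ i, l ≤ f i) (i₀ : Fin k) : f i₀ * l ^ k ≤ ∏ i, f i := by
  rw [← Finset.mul_prod_erase _ f (Finset.mem_univ i₀)]
  have h0 : 0 ≤ f i₀ := hl.trans (h i₀)
  gcongr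
  have h1 : l ^ (Finset.univ.erase i₀).card ≤ ∏ i ∈ Finset.univ.erase i₀, f i := by
    rw [← Finset.prod_const]
    exact Finset.prod_le_prod (fun _ _ => hl) fun i _ => h i
  refine le_trans (pow_le_pow_of_le_one hl hl1 ?_) h1
  exact (Finset.card_le_univ _).trans (by simp)

theorem one_le_norm_scat {η : ℝ} (hη : 0 < η) {u : ℂ} (hu : 0 ≤ u.im)
    (h : scat η u ≠ 0) : 1 ≤ ‖scat η u‖ := by
  by_contra! hlt
  have h1 : 1 < ‖scat η (-u)‖ := by
    rw [scat_neg, norm_inv]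
    exact (one_lt_inv₀ (norm_pos_iff.2 h)).2 hlt
  have := one_lt_norm_scat_iff hη h1
  rw [neg_im] at this
  linarith

/-- A bound for the ratio of two sines. -/
noncomputable def ratioBound (η δ : ℝ) : ℝ := (2 + 1 / δ) * Real.exp (2 * η)

theorem one_le_ratioBound {η δ : ℝ} (hη : 0 < η) (hδ : 0 < δ) : 1 ≤ ratioBound η δ := by
  have h1 : 1 ≤ Real.exp (2 * η) := Real.one_le_exp (by linarith)
  have h2 : 0 < 1 / δ := by positivity
  unfold ratioBound
  nlinarith

theorem norm_sin_add_le_ratioBound {η δ : ℝ} (hδ : 0 < δ) {u a : ℂ} (h : δ ≤ ‖sin u‖)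
    (ha : ‖a‖ ≤ 2 * η) : ‖sin (u + a)‖ ≤ ratioBound η δ * ‖sin u‖ := by
  refine (norm_sin_add_le hδ h).trans ?_
  unfold ratioBound
  gcongr

theorem norm_sin_div_le_ratioBound {η δ : ℝ} (hδ : 0 < δ) {u v : ℂ} (h : δ ≤ ‖sin u‖)
    (ha : ‖v - u‖ ≤ 2 * η) : ‖sin v / sin u‖ ≤ ratioBound η δ := by
  rw [norm_div, div_le_iff₀ (hδ.trans_le h)]
  have := norm_sin_add_le_ratioBound hδ h ha
  rwa [add_sub_cancel] at this

theorem inv_ratioBound_le {η δ : ℝ} (hδ : 0 < δ) {u v : ℂ} (h : δ ≤ ‖sin u‖)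
    (ha : ‖v - u‖ ≤ 2 * η) (hv : sin v ≠ 0) : (ratioBound η δ)⁻¹ ≤ ‖sin u / sin v‖ := by
  have h1 := norm_sin_div_le_ratioBound hδ h ha
  have h2 : 0 < ‖sin v / sin u‖ := norm_pos_iff.2 (div_ne_zero hv (sin_ne_zero_of_norm hδ h))
  have h3 := inv_anti₀ h2 h1
  rwa [← norm_inv, inv_div] at h3

/-- The bounds for the scattering factors of the wide roots, obtained step by step, starting from
the wide roots with the largest imaginary part. -/
noncomputable def chainBound (M : ℝ) (K : ℕ) : ℕ → ℝ
  | 0 => 1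
  | j + 1 => Real.exp 2 * (M * chainBound M K j) ^ K

theorem one_le_chainBound {M : ℝ} (hM : 1 ≤ M) (K j : ℕ) : 1 ≤ chainBound M K j := by
  induction j with
  | zero => simp [chainBound]
  | succ j ih =>
    rw [chainBound]
    exact one_le_mul_of_one_le_of_one_le (Real.one_le_exp (by norm_num))
      (one_le_pow₀ (one_le_mul_of_one_le_of_one_le hM ih))

namespace RootData

/-- The number of holes and non-real roots. -/
def size (D : RootData) : ℕ := D.nh + 2 * D.mw + 2 * D.mc

/-- The number of wide roots above the given one. -/
noncomputable def rank (D : RootData) (a : Fin D.mw) : ℕ :=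
  (Finset.univ.filter fun b => (D.y a).im < (D.y b).im).card

variable {D : RootData} {η α δ E : ℝ}

theorem scat_ne_zero_of_phi {z : ℂ} (h : D.phi η α z ≠ 0) :
    (D.len ≠ 0 → sin (z - I * η / 2) ≠ 0 ∧ sin (z + I * η / 2) ≠ 0) ∧
    (∀ b, scat η (z - D.y b) ≠ 0 ∧ scat η (z - conj (D.y b)) ≠ 0) ∧
    ∀ b, scat η (z - D.w b) ≠ 0 ∧ scat η (z - conj (D.w b)) ≠ 0 := by
  unfold phi at h
  obtain ⟨h1, hw⟩ := mul_ne_zero_iff.1 h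
  obtain ⟨h2, hy⟩ := mul_ne_zero_iff.1 h1
  obtain ⟨h3, -⟩ := mul_ne_zero_iff.1 h2
  obtain ⟨-, h4⟩ := mul_ne_zero_iff.1 h3
  refine ⟨fun hl => ?_, fun b => ?_, fun b => ?_⟩
  · have := (pow_ne_zero_iff hl).1 h4
    exact div_ne_zero_iff.1 this
  · exact mul_ne_zero_iff.1 (Finset.prod_ne_zero_iff.1 hy b (Finset.mem_univ b))
  · exact mul_ne_zero_iff.1 (Finset.prod_ne_zero_iff.1 hw b (Finset.mem_univ b))

theorem rank_lt_rank {a b : Fin D.mw} (h : (D.y a).im < (D.y b).im) : D.rank b < D.rank a := by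
  refine Finset.card_lt_card (Finset.ssubset_iff_of_subset ?_ |>.2 ⟨b, by simp [h], by simp⟩)
  intro c hc
  simp only [Finset.mem_filter, Finset.mem_univ, true_and] at hc ⊢
  exact h.trans hc

theorem rank_le (a : Fin D.mw) : D.rank a ≤ D.mw :=
  (Finset.card_le_univ _).trans (by simp)

namespace Good

variable (h : D.Good η α δ E)
include h

theorem y_wide (b : Fin D.mw) : η < (D.y b).im := by linarith [h.y_im b, h.δ_pos]

/-- The product `upper` at y_a is bounded, and each of its factors is bounded below by l = 1/(M B);
hence each single factor is bounded above by the bound of the product times a power of 1/l. The only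
factors that could be small without the assumption `hhigh` are those of wide roots above y_a. -/
theorem norm_upper_ge {a : Fin D.mw} {B : ℝ} (hB : 1 ≤ B)
    (hhigh : ∀ b, (D.y a).im < (D.y b).im → ‖scat η (D.y b - D.y a)‖ ≤ B) {K : ℕ}
    (hK : D.size ≤ K) (hup : ‖D.upper η (D.y a)‖ ≤ Real.exp 2) :
    (∀ b, ‖scat η (D.y a - D.y b)‖ ≤ Real.exp 2 * (ratioBound η δ * B) ^ K) ∧
    ∀ b, ‖sin (D.y a - D.w b) / sin (D.y a - D.w b - I * η)‖ ≤
      Real.exp 2 * (ratioBound η δ * B) ^ K := by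
  have hδ := h.δ_pos
  have hδη := h.δ_le
  have hη := h.η_pos
  have hya := h.y_im a
  set M := ratioBound η δ with hM
  have hM1 : 1 ≤ M := one_le_ratioBound hη hδ
  have hMB : 1 ≤ M * B := one_le_mul_of_one_le_of_one_le hM1 hB
  set l := (M * B)⁻¹ with hl
  have hl0 : 0 < l := by positivity
  have hl1 : l ≤ 1 := inv_le_one_of_one_le₀ hMB
  have hlM : l ≤ M⁻¹ := inv_anti₀ (by positivity) (le_mul_of_one_le_right (by positivity) hB)
  have hlB : l ≤ B⁻¹ := inv_anti₀ (by positivity) (le_mul_of_one_le_left (by positivity) hM1)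
  obtain ⟨-, hne1, hne2⟩ := scat_ne_zero_of_phi (D := D) (η := η) (α := α) (z := D.y a)
    (by rw [h.phi_y]; exact one_ne_zero)
  have hIη : ‖I * (η : ℂ)‖ ≤ 2 * η := by
    rw [norm_mul, norm_I, norm_real, Real.norm_eq_abs, abs_of_pos hη]; linarith
  have h2Iη : ‖2 * I * (η : ℂ)‖ ≤ 2 * η := by
    rw [norm_mul, norm_mul, norm_I, norm_real, Real.norm_eq_abs, abs_of_pos hη]; simp
  have hν : ∀ j, l ≤ ‖sin (D.y a - D.ν j - I * η) / sin (D.y a - D.ν j)‖ := fun j => by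
    refine hlM.trans (inv_ratioBound_le hδ (le_norm_sin_of_le_im ?_) ?_
      (sin_ne_zero_of_im_pos ?_))
    · simp; linarith
    · rw [sub_sub_cancel]; exact hIη
    · simp; linarith
  -- If y_b lies higher, the factor is the inverse of one bounded by B. Otherwise its modulus is at
  -- least 1.
  have hs : ∀ b, l ≤ ‖scat η (D.y a - D.y b)‖ := fun b => by
    by_cases hb : (D.y a).im < (D.y b).im
    · have h1 := hhigh b hb
      rw [show D.y b - D.y a = -(D.y a - D.y b) by ring, scat_neg, norm_inv] at h1
      have h2 := inv_anti₀ (by simpa using (hne1 b).1) h1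
      rw [inv_inv] at h2
      exact hlB.trans h2
    · exact hl1.trans (one_le_norm_scat hη (by rw [sub_im]; linarith) (hne1 b).1)
  have hr : ∀ b, l ≤ ‖sin (D.y a - conj (D.y b)) / sin (D.y a - conj (D.y b) - 2 * I * η)‖ :=
    fun b => by
    have hb := h.y_im b
    refine hlM.trans (inv_ratioBound_le hδ (le_norm_sin_of_le_im ?_) ?_
      (sin_ne_zero_of_im_pos ?_))
    · simp; linarith
    · rw [sub_right_comm, sub_self, zero_sub, norm_neg]; exact h2Iη
    · simp; linarith
  have hw : ∀ b, l ≤ ‖sin (D.y a - D.w b) / sin (D.y a - D.w b - I * η)‖ := fun b => by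
    have hb := h.w_im_le b
    refine hlM.trans (inv_ratioBound_le hδ (le_norm_sin_of_le_im ?_) ?_
      (div_ne_zero_iff.1 (hne2 b).1).2)
    · simp; linarith
    · rw [sub_right_comm, sub_self, zero_sub, norm_neg]; exact hIη
  have hw' : ∀ b, l ≤ ‖sin (D.y a - conj (D.w b)) / sin (D.y a - conj (D.w b) - I * η)‖ :=
    fun b => by
    have hb := h.w_im b
    refine hlM.trans (inv_ratioBound_le hδ (le_norm_sin_of_le_im ?_) ?_
      (div_ne_zero_iff.1 (hne2 b).2).2)
    · simp; linarith
    · rw [sub_right_comm, sub_self, zero_sub, norm_neg]; exact hIη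
  have hup' : (∏ j, ‖sin (D.y a - D.ν j - I * η) / sin (D.y a - D.ν j)‖) *
      ((∏ b, ‖scat η (D.y a - D.y b)‖) *
        ∏ b, ‖sin (D.y a - conj (D.y b)) / sin (D.y a - conj (D.y b) - 2 * I * η)‖) *
      ((∏ b, ‖sin (D.y a - D.w b) / sin (D.y a - D.w b - I * η)‖) *
        ∏ b, ‖sin (D.y a - conj (D.w b)) / sin (D.y a - conj (D.w b) - I * η)‖) ≤
      Real.exp 2 := by
    refine le_of_eq_of_le ?_ hup
    rw [upper, norm_mul, norm_mul, norm_prod, norm_prod, norm_prod, ← Finset.prod_mul_distrib,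
      ← Finset.prod_mul_distrib]
    simp only [norm_mul]
  have p1 := pow_le_prod hl0.le hν
  have p2 := pow_le_prod hl0.le hs
  have p3 := pow_le_prod hl0.le hr
  have p4 := pow_le_prod hl0.le hw
  have p5 := pow_le_prod hl0.le hw'
  have hsize : l ^ K ≤ l ^ D.nh * (l ^ D.mw * l ^ D.mw) * (l ^ D.mc * l ^ D.mc) := by
    rw [← pow_add, ← pow_add, ← pow_add, ← pow_add]
    refine pow_le_pow_of_le_one hl0.le hl1 (le_trans (le_of_eq ?_) hK)
    rw [size]; ring
  have hfin : ∀ f : ℝ, 0 ≤ f → f * (l ^ D.nh * (l ^ D.mw * l ^ D.mw) * (l ^ D.mc * l ^ D.mc)) ≤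
      Real.exp 2 → f ≤ Real.exp 2 * (M * B) ^ K := by
    intro f hf hle
    have h1 : f * l ^ K ≤ Real.exp 2 := (mul_le_mul_of_nonneg_left hsize hf).trans hle
    rw [hl, inv_pow, ← div_eq_mul_inv, div_le_iff₀ (by positivity)] at h1
    exact h1
  constructor
  · intro b
    have p2' := mul_pow_le_prod hl0.le hl1 hs b
    refine hfin _ (norm_nonneg _) (le_trans ?_ hup')
    calc ‖scat η (D.y a - D.y b)‖ *
          (l ^ D.nh * (l ^ D.mw * l ^ D.mw) * (l ^ D.mc * l ^ D.mc))
        = l ^ D.nh * ((‖scat η (D.y a - D.y b)‖ * l ^ D.mw) * l ^ D.mw) *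
          (l ^ D.mc * l ^ D.mc) := by ring
      _ ≤ _ := by gcongr
  · intro b
    have p4' := mul_pow_le_prod hl0.le hl1 hw b
    refine hfin _ (norm_nonneg _) (le_trans ?_ hup')
    calc ‖sin (D.y a - D.w b) / sin (D.y a - D.w b - I * η)‖ *
          (l ^ D.nh * (l ^ D.mw * l ^ D.mw) * (l ^ D.mc * l ^ D.mc))
        = l ^ D.nh * (l ^ D.mw * l ^ D.mw) *
          ((‖sin (D.y a - D.w b) / sin (D.y a - D.w b - I * η)‖ * l ^ D.mc) * l ^ D.mc) := by ring
      _ ≤ _ := by gcongr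

/-- A wide root stays in the region Im z ≥ 2δ after the shift by -iη, so the two values of `psi` in
`phi_mul_psi` cancel. -/
theorem upper_y_near {e : ℝ} {C₀ : ℂ} (hC₀ : C₀ ≠ 0)
    (hpsi : ∀ z : ℂ, 2 * δ ≤ z.im → Near e (D.psi η z) C₀) (a : Fin D.mw) :
    Near (2 * e) (-exp (-2 * I * Real.pi * α) * D.upper η (D.y a)) 1 := by
  have hδ := h.δ_pos
  have hδη := h.δ_le
  have hη := h.η_pos
  have hya := h.y_im a
  have h1 := D.phi_mul_psi η α (z := D.y a) (sin_ne_zero_of_im_pos (by simp; linarith))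
    (fun j => sin_ne_zero_of_im_pos (by simp; linarith))
    (fun j => sin_ne_zero_of_im_pos (by simp; linarith))
  rw [h.phi_y, one_mul] at h1
  have n1 := hpsi (D.y a) (by linarith)
  have n2 := hpsi (D.y a - I * η) (by simp; linarith)
  have h0 : D.psi η (D.y a) ≠ 0 := n1.ne_zero_iff.2 hC₀
  have h2 := n2.trans n1.symm
  rw [h1, ← mul_assoc] at h2
  have h3 := h2.div (Near.refl (D.psi η (D.y a)))
  rw [mul_div_cancel_right₀ _ h0, div_self h0] at h3
  exact h3.mono (by linarith)

/-- Induction on the number of wide roots above y_a: the highest ones need no assumption, and each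
later one uses the bounds already obtained for those above it. -/
theorem chain_bound {e : ℝ} {C₀ : ℂ} (hC₀ : C₀ ≠ 0) (he : e ≤ 1)
    (hpsi : ∀ z : ℂ, 2 * δ ≤ z.im → Near e (D.psi η z) C₀) {K : ℕ} (hK : D.size ≤ K) (j : ℕ) :
    ∀ a, D.rank a < j → (∀ b, ‖scat η (D.y a - D.y b)‖ ≤ chainBound (ratioBound η δ) K j) ∧
      ∀ b, ‖sin (D.y a - D.w b) / sin (D.y a - D.w b - I * η)‖ ≤
        chainBound (ratioBound η δ) K j := by
  induction j with
  | zero => exact fun a ha => absurd ha (Nat.not_lt_zero _)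
  | succ j ih =>
    intro a ha
    refine h.norm_upper_ge (one_le_chainBound (one_le_ratioBound h.η_pos h.δ_pos) K j)
      (fun b hb => (ih b (lt_of_lt_of_le (rank_lt_rank hb) (Nat.lt_succ_iff.1 ha))).1 a) hK ?_
    have h1 := (h.upper_y_near hC₀ hpsi a).norm_le
    rw [norm_mul, norm_neg, norm_one, mul_one, norm_exp] at h1
    simp only [neg_mul, neg_re, mul_re, re_ofNat, I_re, mul_zero, im_ofNat, I_im, mul_one,
      sub_self, ofReal_re, zero_mul, mul_im, add_zero, ofReal_im, neg_zero, Real.exp_zero,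
      one_mul] at h1
    exact h1.trans (Real.exp_le_exp.2 (by linarith))

end Good

/-- A lower bound for the denominators of the higher-level equations. -/
noncomputable def gapBound (η δ : ℝ) (K : ℕ) : ℝ :=
  min δ (min (η / (chainBound (ratioBound η δ) K K + Real.exp (2 * η) + η)) 1)

theorem gapBound_pos {η δ : ℝ} (hη : 0 < η) (hδ : 0 < δ) (K : ℕ) : 0 < gapBound η δ K := by
  have := one_le_chainBound (one_le_ratioBound hη hδ) K K
  have := Real.exp_pos (2 * η)
  refine lt_min hδ (lt_min (by positivity) one_pos)

theorem Good.gap (h : D.Good η α δ E) {e : ℝ} {C₀ : ℂ} (hC₀ : C₀ ≠ 0) (he : e ≤ 1)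
    (hpsi : ∀ z : ℂ, 2 * δ ≤ z.im → Near e (D.psi η z) C₀) {K : ℕ} (hK : D.size < K) :
    (∀ a b, gapBound η δ K ≤ ‖sin (D.y a - D.y b - I * η)‖) ∧
      ∀ a b, gapBound η δ K ≤ ‖sin (D.y a - D.w b - I * η)‖ := by
  have hη := h.η_pos
  have hM := one_le_ratioBound hη h.δ_pos
  have hB := one_le_chainBound hM K K
  -- A rank is at most `mw`, and `mw ≤ size < K`; so level K of the chain covers all wide roots. The
  -- strict inequality is needed here.
  have hr : ∀ a, D.rank a < K := fun a => by
    have := D.rank_le a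
    rw [size] at hK
    omega
  have hIη : ‖I * (η : ℂ)‖ = η := by
    rw [norm_mul, norm_I, norm_real, Real.norm_eq_abs, abs_of_pos hη, one_mul]
  have h2Iη : ‖2 * I * (η : ℂ)‖ = 2 * η := by
    rw [norm_mul, norm_mul, norm_I, norm_real, Real.norm_eq_abs, abs_of_pos hη]; simp
  have hexp : Real.exp η ≤ Real.exp (2 * η) := Real.exp_le_exp.2 (by linarith)
  have hne : ∀ a, _ := fun a => (scat_ne_zero_of_phi (D := D) (η := η) (α := α) (z := D.y a)
    (by rw [h.phi_y]; exact one_ne_zero)).2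
  have hle : gapBound η δ K ≤ η / (chainBound (ratioBound η δ) K K + Real.exp (2 * η) + η) :=
    (min_le_right _ _).trans (min_le_left _ _)
  constructor
  · intro a b
    refine hle.trans ?_
    have h1 := (h.chain_bound hC₀ he hpsi hK.le K a (hr a)).1 b
    have := sin_lower_bound (v := D.y a - D.y b - I * η) (a := 2 * I * η)
      (B := chainBound (ratioBound η δ) K K) hη (by linarith)
      (le_norm_sin_of_le_im (by simp; linarith)) (div_ne_zero_iff.1 ((hne a).1 b).1).2 (by
        rw [show D.y a - D.y b - I * η + 2 * I * η = D.y a - D.y b + I * η by ring]; exact h1)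
    rwa [h2Iη] at this
  · intro a b
    refine hle.trans ?_
    have h1 := (h.chain_bound hC₀ he hpsi hK.le K a (hr a)).2 b
    have := sin_lower_bound (v := D.y a - D.w b - I * η) (a := I * η)
      (B := chainBound (ratioBound η δ) K K) hη (by linarith)
      (le_norm_sin_of_le_im (by simp)) (div_ne_zero_iff.1 ((hne a).2 b).1).2 (by
        rw [sub_add_cancel]; exact h1)
    rw [hIη] at this
    refine le_trans ?_ this
    gcongr

end RootData


/-! ### Matching the close roots with the shifted conjugate close roots -/

/-- The number of close roots varies from solution to solution, so the constants must serve all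
degrees up to K. Since e ≤ 1, enlarging C and shrinking γ only weakens the bounds. -/
theorem exists_matching_uniform (K : ℕ) {c : ℝ} (hc : 0 < c) (hc1 : c ≤ 1 / 2) :
    ∃ C γ : ℝ, 1 ≤ C ∧ 0 < γ ∧ ∀ k ≤ K,
    ∀ (e : ℝ) (Ω : Set ℂ) (t : ℂ) (x y : Fin k → ℂ) (ε : ℂ → ℂ), 0 ≤ e → e ≤ 1 →
      4 * (C * e ^ γ) ≤ 1 → IsOpen Ω → DifferentiableOn ℂ ε Ω →
      (∀ z ∈ Ω, ‖ε z‖ ≤ e * ∏ l, (‖z - t‖ + ‖y l - t‖)) →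
      Function.Injective x →
      (∀ j, x j ≠ t ∧ Metric.closedBall (x j) (c * ‖x j - t‖) ⊆ Ω) →
      (∀ j, ∏ l, (x j - y l) = ε (x j)) →
      ∃ σ : Fin k → Fin k, Function.Injective σ ∧
        (∀ j, ‖x j - y (σ j)‖ ≤ C * e ^ γ * ‖x j - t‖) ∧
        ∃ ε' : ℂ → ℂ, (∀ z ∈ Ω, ‖ε' z‖ ≤ C * e ^ γ) ∧
          ∀ z, ∏ l, (z - y l) - ε z = (∏ j, (z - x j)) * (1 - ε' z) := by
  have key : ∀ k, ∃ C γ : ℝ, 1 ≤ C ∧ 0 < γ ∧ ∀ (C' γ' : ℝ), C ≤ C' → 0 < γ' → γ' ≤ γ →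
    ∀ (e : ℝ) (Ω : Set ℂ) (t : ℂ) (x y : Fin k → ℂ) (ε : ℂ → ℂ), 0 ≤ e → e ≤ 1 →
      4 * (C' * e ^ γ') ≤ 1 → IsOpen Ω → DifferentiableOn ℂ ε Ω →
      (∀ z ∈ Ω, ‖ε z‖ ≤ e * ∏ l, (‖z - t‖ + ‖y l - t‖)) →
      Function.Injective x →
      (∀ j, x j ≠ t ∧ Metric.closedBall (x j) (c * ‖x j - t‖) ⊆ Ω) →
      (∀ j, ∏ l, (x j - y l) = ε (x j)) →
      ∃ σ : Fin k → Fin k, Function.Injective σ ∧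
        (∀ j, ‖x j - y (σ j)‖ ≤ C' * e ^ γ' * ‖x j - t‖) ∧
        ∃ ε' : ℂ → ℂ, (∀ z ∈ Ω, ‖ε' z‖ ≤ C' * e ^ γ') ∧
          ∀ z, ∏ l, (z - y l) - ε z = (∏ j, (z - x j)) * (1 - ε' z) := by
    intro k
    obtain ⟨C, γ, hC, hγ, -, H⟩ := exists_matching k hc hc1
    refine ⟨C, γ, hC, hγ, ?_⟩
    intro C' γ' hCC hγ' hγγ e Ω t x y ε he he1 hs hΩ hε hb hinj hball hroot
    have hle : C * e ^ γ ≤ C' * e ^ γ' :=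
      mul_le_mul hCC (Real.rpow_le_rpow_of_exponent_ge' he he1 hγ'.le hγγ)
        (Real.rpow_nonneg he _) (by linarith)
    obtain ⟨σ, h1, h2, ε', h3, h4⟩ := H e Ω t x y ε he he1 (by linarith) hΩ hε hb hinj hball hroot
    exact ⟨σ, h1, fun j => (h2 j).trans (mul_le_mul_of_nonneg_right hle (norm_nonneg _)), ε',
      fun z hz => (h3 z hz).trans hle, h4⟩
  induction K with
  | zero =>
    obtain ⟨C, γ, hC, hγ, H⟩ := key 0
    refine ⟨C, γ, hC, hγ, fun k hk => ?_⟩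
    obtain rfl : k = 0 := by omega
    exact H C γ le_rfl hγ le_rfl
  | succ K ih =>
    obtain ⟨C₁, γ₁, hC₁, hγ₁, H₁⟩ := key (K + 1)
    obtain ⟨C₂, γ₂, hC₂, hγ₂, H₂⟩ := ih
    refine ⟨max C₁ C₂, min γ₁ γ₂, hC₁.trans (le_max_left _ _), lt_min hγ₁ hγ₂, fun k hk => ?_⟩
    rcases hk.eq_or_lt with rfl | hk
    · exact H₁ _ _ (le_max_left _ _) (lt_min hγ₁ hγ₂) (min_le_left _ _)
    · intro e Ω t x y ε he he1 hs hΩ hε hb hinj hball hroot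
      have hle : C₂ * e ^ γ₂ ≤ max C₁ C₂ * e ^ min γ₁ γ₂ :=
        mul_le_mul (le_max_right _ _)
          (Real.rpow_le_rpow_of_exponent_ge' he he1 (lt_min hγ₁ hγ₂).le (min_le_right _ _))
          (Real.rpow_nonneg he _) (by linarith [le_max_left C₁ C₂])
      obtain ⟨σ, h1, h2, ε', h3, h4⟩ :=
        H₂ k (by omega) e Ω t x y ε he he1 (by linarith) hΩ hε hb hinj hball hroot
      exact ⟨σ, h1, fun j => (h2 j).trans (mul_le_mul_of_nonneg_right hle (norm_nonneg _)), ε',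
        fun z hz => (h3 z hz).trans hle, h4⟩

theorem exp_sub_exp_eq_sin (z a : ℂ) :
    exp (2 * I * z) - exp (2 * I * a) = 2 * I * exp (I * (z + a)) * sin (z - a) := by
  have h1 : exp (2 * I * z) = exp (I * (z + a)) * exp ((z - a) * I) := by
    rw [← exp_add]; ring_nf
  have h2 : exp (2 * I * a) = exp (I * (z + a)) * exp (-(z - a) * I) := by
    rw [← exp_add]; ring_nf
  rw [h1, h2, Complex.sin]
  linear_combination (-exp (I * (z + a)) * (exp (-(z - a) * I) - exp ((z - a) * I))) * I_sq

theorem norm_sin_le_exp_abs_im (u : ℂ) : ‖sin u‖ ≤ Real.exp |u.im| := by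
  have h1 : ‖exp (-u * I)‖ ≤ Real.exp |u.im| := by
    rw [norm_exp, Real.exp_le_exp]; simpa using le_abs_self u.im
  have h2 : ‖exp (u * I)‖ ≤ Real.exp |u.im| := by
    rw [norm_exp, Real.exp_le_exp]; simpa using neg_le_abs u.im
  rw [Complex.sin, norm_div, norm_mul, norm_I, mul_one, Complex.norm_ofNat]
  linarith [norm_sub_le (exp (-u * I)) (exp (u * I))]

theorem prod_norm_le_pow {k : ℕ} {f : Fin k → ℂ} {c : ℝ} (h : ∀ i, ‖f i‖ ≤ c) :
    ‖∏ i, f i‖ ≤ c ^ k := by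
  rw [norm_prod]
  calc ∏ i, ‖f i‖ ≤ ∏ _i : Fin k, c :=
        Finset.prod_le_prod (fun _ _ => norm_nonneg _) fun i _ => h i
    _ = c ^ k := by simp

namespace RootData

theorem discSin_ne_zero' {a Z : ℂ} (h : ‖Z‖ ≠ Real.exp (-(2 * a.im))) : discSin a Z ≠ 0 := by
  rw [discSin, sub_ne_zero]
  intro h0
  have h1 : ‖exp (I * a)‖ = Real.exp (-a.im) := by rw [norm_exp]; simp
  have h2 : ‖exp (-(I * a))‖ = Real.exp (a.im) := by rw [norm_exp]; simp
  have h3 := congrArg norm h0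
  rw [norm_mul, h1, h2] at h3
  refine h ?_
  rw [← mul_right_cancel_iff_of_pos (Real.exp_pos a.im), ← h3, ← Real.exp_add]
  ring_nf

variable (D : RootData) (η α : ℝ)

/-- The images of the close roots of the lower half plane under the shift by `iη`. -/
noncomputable def shifted (b : Fin D.mc) : ℂ := exp (2 * I * (conj (D.w b) + I * η))

/-- The function `phi` without its poles at the shifted close roots. -/
noncomputable def eps (z : ℂ) : ℂ :=
  -exp (-2 * I * Real.pi * α) * (sin (z - I * η / 2) / sin (z + I * η / 2)) ^ D.len *
    (∏ j, scat η (z - D.x j)) * (∏ b, scat η (z - D.y b) * scat η (z - conj (D.y b))) *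
    ∏ b, scat η (z - D.w b) * (sin (z - conj (D.w b) + I * η) *
      (2 * I * exp (I * (z + (conj (D.w b) + I * η)))))

theorem phi_mul_prod {z : ℂ} (hz : ∀ b, sin (z - conj (D.w b) - I * η) ≠ 0) :
    D.phi η α z * ∏ b, (exp (2 * I * z) - D.shifted η b) = D.eps η α z := by
  rw [phi, eps, mul_assoc, ← Finset.prod_mul_distrib]
  congr 1
  refine Finset.prod_congr rfl fun b _ => ?_
  rw [shifted, exp_sub_exp_eq_sin, show z - (conj (D.w b) + I * η) = z - conj (D.w b) - I * η by
    ring, scat, scat]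
  field_simp [hz b]

/-- The function on the annulus that corresponds to `eps`, without a zero of order `k`. -/
noncomputable def discEps (k : ℕ) (Z : ℂ) : ℂ :=
  -exp (-2 * I * Real.pi * α) * ((-exp (η / 2)) ^ k * discSin (I * η / 2) Z ^ (D.len - k) /
      discSin (-(I * η / 2)) Z ^ D.len) *
    (∏ j, discSin (D.x j - I * η) Z / discSin (D.x j + I * η) Z) *
    (∏ b, discSin (D.y b - I * η) Z / discSin (D.y b + I * η) Z *
      (discSin (conj (D.y b) - I * η) Z / discSin (conj (D.y b) + I * η) Z)) *
    ∏ b, discSin (D.w b - I * η) Z / discSin (D.w b + I * η) Z *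
      (discSin (conj (D.w b) - I * η) Z * -exp (I * (conj (D.w b) + I * η)))

/-- Of the `len` zeros of `eps` at z = iη/2, that is Z = exp(-η), k are split off. They supply the
weight ‖Z - t‖^k that the matching requires, with t = exp(-η). -/
theorem eps_eq_discEps {D : RootData} (η α : ℝ) {k : ℕ} (hk : k ≤ D.len) (z : ℂ) :
    D.eps η α z = (exp (2 * I * z) - exp (-η)) ^ k * D.discEps η α k (exp (2 * I * z)) := by
  set g := I / 2 * exp (-(I * z)) with hg
  have hg0 : g ≠ 0 := by simp [hg]
  have h1 : ∀ a b : ℂ, sin (z - a + b) = g * discSin (a - b) (exp (2 * I * z)) := fun a b => by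
    rw [show z - a + b = z - (a - b) by ring, sin_eq_discSin]
  have h2 : ∀ a b : ℂ, sin (z - a - b) = g * discSin (a + b) (exp (2 * I * z)) := fun a b => by
    rw [show z - a - b = z - (a + b) by ring, sin_eq_discSin]
  have h3 : ∀ a : ℂ, scat η (z - a) =
      discSin (a - I * η) (exp (2 * I * z)) / discSin (a + I * η) (exp (2 * I * z)) := fun a => by
    rw [scat, h1, h2, mul_div_mul_left _ _ hg0]
  have h4 : sin (z + I * η / 2) = g * discSin (-(I * η / 2)) (exp (2 * I * z)) := by
    rw [← sin_eq_discSin, sub_neg_eq_add]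
  have h5 : sin (z - I * η / 2) = g * discSin (I * η / 2) (exp (2 * I * z)) := by
    rw [← sin_eq_discSin]
  have h6 : ∀ a : ℂ, g * discSin (a - I * η) (exp (2 * I * z)) *
      (2 * I * exp (I * (z + (a + I * η)))) =
      discSin (a - I * η) (exp (2 * I * z)) * -exp (I * (a + I * η)) := fun a => by
    have : g * (2 * I * exp (I * (z + (a + I * η)))) = -exp (I * (a + I * η)) := by
      rw [hg, show I * (z + (a + I * η)) = I * z + I * (a + I * η) by ring, exp_add]
      have h7 : exp (-(I * z)) * exp (I * z) = 1 := by rw [← exp_add]; simp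
      linear_combination (I ^ 2 * exp (I * (a + I * η))) * h7 + exp (I * (a + I * η)) * I_sq
    rw [← this]; ring
  have h7 : discSin (I * η / 2) (exp (2 * I * z)) =
      (exp (2 * I * z) - exp (-η)) * -exp (η / 2) := by
    have e1 : I * (I * η / 2) = -(η / 2 : ℂ) := by
      linear_combination (η / 2 : ℂ) * I_sq
    have e2 : exp (-(η : ℂ)) * exp (η / 2) = exp (-(η / 2)) := by rw [← exp_add]; ring_nf
    rw [discSin, e1, neg_neg, ← e2]
    ring
  have h8 : discSin (I * η / 2) (exp (2 * I * z)) ^ D.len =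
      (exp (2 * I * z) - exp (-η)) ^ k * ((-exp (η / 2)) ^ k *
        discSin (I * η / 2) (exp (2 * I * z)) ^ (D.len - k)) := by
    rw [← mul_assoc, ← mul_pow, ← h7, ← pow_add, Nat.add_sub_cancel' hk]
  simp only [eps, discEps, h3, h4, h5, h1, h6, mul_div_mul_left _ _ hg0, div_pow, h8]
  ring

theorem differentiableOn_discEps {D : RootData} {η : ℝ} (α : ℝ) {k : ℕ} {s : Set ℂ} (hη : 0 < η)
    (hy : ∀ b, η < (D.y b).im) (hw : ∀ b, 0 < (D.w b).im)
    (hs : ∀ Z ∈ s, ‖Z‖ < 1 ∧ Real.exp (-(2 * η)) < ‖Z‖) :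
    DifferentiableOn ℂ (D.discEps η α k) s := by
  have hd : ∀ a, DifferentiableOn ℂ (discSin a) s :=
    fun a => (differentiable_discSin a).differentiableOn
  have hne : ∀ (a : ℂ), η ≤ a.im → ∀ Z ∈ s, discSin a Z ≠ 0 := fun a ha Z hZ =>
    discSin_ne_zero' (ne_of_gt (lt_of_le_of_lt (Real.exp_le_exp.2 (by linarith)) (hs Z hZ).2))
  unfold discEps
  refine DifferentiableOn.mul (DifferentiableOn.mul (DifferentiableOn.mul
    (DifferentiableOn.const_mul (DifferentiableOn.div (DifferentiableOn.const_mul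
      ((hd _).pow _) _) ((hd _).pow _) ?_) _) ?_) ?_) ?_
  · intro Z hZ
    refine pow_ne_zero _ (discSin_ne_zero ?_ (hs Z hZ).1)
    simp
    linarith
  · exact DifferentiableOn.fun_finsetProd fun j _ => (hd _).div (hd _) (hne _ (by simp))
  · refine DifferentiableOn.fun_finsetProd fun b _ => ((hd _).div (hd _) (hne _ ?_)).mul
      ((hd _).div (hd _) fun Z hZ => discSin_ne_zero ?_ (hs Z hZ).1)
    · simp; linarith [hy b]
    · simp; linarith [hy b]
  · refine DifferentiableOn.fun_finsetProd fun b _ => ((hd _).div (hd _) (hne _ ?_)).mul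
      ((hd _).mul_const _)
    simp; linarith [hw b]

theorem norm_shifted_le {D : RootData} {η : ℝ} {b : Fin D.mc} (hb : (D.w b).im ≤ η) :
    ‖D.shifted η b‖ ≤ 1 := by
  rw [shifted, norm_exp_two_I_mul, Real.exp_le_one_iff]
  simp
  linarith

variable {D : RootData} {η α δ E : ℝ}

theorem Good.norm_phi_inv_le (h : D.Good η α δ E) {z : ℂ} (h1 : z.im ≤ -δ) (h2 : -(2 * δ) ≤ z.im) :
    ‖D.phi η α z‖⁻¹ ≤ E := by
  have := h.phi_le (conj z) (by rw [conj_im]; linarith) (by rw [conj_im]; linarith)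
  have h3 := D.conj_phi η α z
  rwa [← norm_inv, ← norm_conj, map_inv₀, h3, inv_inv]

/-- The points conj(w_b) + iη, where `upper` has poles, may come arbitrarily close to this line only
in principle; multiplying by their polynomial cancels the corresponding sines outright, and every
remaining quotient has its denominator bounded below. -/
theorem Good.norm_upper_mul_prod_le (h : D.Good η α δ E) {z : ℂ} (hz : z.im = η - 2 * δ) :
    ‖D.upper η z * ∏ b, (exp (2 * I * z) - D.shifted η b)‖ ≤
      (2 * Real.exp (2 * η) * ratioBound η δ) ^ D.size := by
  have hδ := h.δ_pos
  have hδη := h.δ_le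
  have hη := h.η_pos
  set M := ratioBound η δ with hM
  have hM1 : 1 ≤ M := one_le_ratioBound hη hδ
  have hexp : 1 ≤ Real.exp (2 * η) := Real.one_le_exp (by linarith)
  have hIη : ‖I * (η : ℂ)‖ ≤ 2 * η := by
    rw [norm_mul, norm_I, norm_real, Real.norm_eq_abs, abs_of_pos hη]; linarith
  have h2Iη : ‖2 * I * (η : ℂ)‖ ≤ 2 * η := by
    rw [norm_mul, norm_mul, norm_I, norm_real, Real.norm_eq_abs, abs_of_pos hη]; simp
  have e1 : ‖∏ j, sin (z - D.ν j - I * η) / sin (z - D.ν j)‖ ≤ M ^ D.nh := by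
    refine prod_norm_le_pow fun j => norm_sin_div_le_ratioBound hδ (le_norm_sin_of_le_im ?_) ?_
    · simp; linarith
    · rw [sub_right_comm, sub_self, zero_sub, norm_neg]; exact hIη
  have e2 : ‖∏ b, scat η (z - D.y b) *
      (sin (z - conj (D.y b)) / sin (z - conj (D.y b) - 2 * I * η))‖ ≤ (M * M) ^ D.mw := by
    refine prod_norm_le_pow fun b => ?_
    have hb := h.y_im b
    rw [norm_mul]
    refine mul_le_mul ?_ ?_ (norm_nonneg _) (by linarith)
    · refine norm_sin_div_le_ratioBound hδ (le_norm_sin_of_im_le ?_) ?_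
      · simp; linarith
      · rw [show z - D.y b + I * η - (z - D.y b - I * η) = 2 * I * η by ring]; exact h2Iη
    · refine norm_sin_div_le_ratioBound hδ (le_norm_sin_of_le_im ?_) ?_
      · simp; linarith
      · rw [sub_sub_cancel]; exact h2Iη
  have e3 : ‖(∏ b, (sin (z - D.w b) / sin (z - D.w b - I * η)) *
      (sin (z - conj (D.w b)) / sin (z - conj (D.w b) - I * η))) *
      ∏ b, (exp (2 * I * z) - D.shifted η b)‖ ≤ (M * (2 * Real.exp (2 * η))) ^ D.mc := by
    rw [← Finset.prod_mul_distrib]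
    refine prod_norm_le_pow fun b => ?_
    have hb := h.w_im b
    have hb' := h.w_im_le b
    rw [mul_assoc, norm_mul]
    refine mul_le_mul ?_ ?_ (norm_nonneg _) (by linarith)
    · refine norm_sin_div_le_ratioBound hδ (le_norm_sin_of_im_le ?_) ?_
      · simp; linarith
      · rw [sub_sub_cancel]; exact hIη
    · have hne : sin (z - conj (D.w b) - I * η) ≠ 0 := by
        apply sin_ne_zero_of_im_pos; simp; linarith
      rw [shifted, exp_sub_exp_eq_sin,
        show z - (conj (D.w b) + I * η) = z - conj (D.w b) - I * η by ring, div_mul_eq_mul_div,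
        mul_comm (sin _), mul_assoc, mul_comm (sin (z - conj (D.w b) - I * η)), ← mul_assoc,
        mul_div_cancel_right₀ _ hne, norm_mul, norm_mul, norm_mul, norm_I, Complex.norm_ofNat,
        mul_one]
      have f1 : ‖exp (I * (z + (conj (D.w b) + I * η)))‖ ≤ 1 := by
        rw [norm_exp, Real.exp_le_one_iff]; simp; linarith
      have f2 : ‖sin (z - conj (D.w b))‖ ≤ Real.exp (2 * η) := by
        refine (norm_sin_le_exp_abs_im _).trans (Real.exp_le_exp.2 ?_)
        rw [abs_le]
        simp
        constructor <;> linarith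
      calc 2 * ‖exp (I * (z + (conj (D.w b) + I * η)))‖ * ‖sin (z - conj (D.w b))‖
          ≤ 2 * 1 * Real.exp (2 * η) := by gcongr
        _ = _ := by ring
  rw [upper, mul_assoc _ _ (∏ b, (exp (2 * I * z) - D.shifted η b)), norm_mul, norm_mul]
  set B := 2 * Real.exp (2 * η) * M with hB
  have hMB : M ≤ B := le_mul_of_one_le_left (by linarith) (by linarith)
  have hMMB : M * (2 * Real.exp (2 * η)) = B := mul_comm _ _
  have hB1 : 1 ≤ B := hM1.trans hMB
  calc _ ≤ M ^ D.nh * (M * M) ^ D.mw * (M * (2 * Real.exp (2 * η))) ^ D.mc := by gcongr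
    _ ≤ B ^ D.nh * (B * B) ^ D.mw * (B * B) ^ D.mc := by
        rw [hMMB]
        gcongr
        exact le_mul_of_one_le_left (by linarith) hB1
    _ = B ^ D.size := by
        rw [size, ← pow_two, ← pow_mul, ← pow_mul, ← pow_add, ← pow_add]

/-- A bound for `eps` on the boundary of the annulus. -/
noncomputable def epsBound (η δ : ℝ) (K : ℕ) : ℝ :=
  Real.exp 2 * (2 * Real.exp (2 * η) * ratioBound η δ) ^ K

/-- On the lower line this is the decay of `phi`. On the upper line z - iη lies at height -2δ, just
below the axis, where the shift identity and the jump relation give `phi z` as 1/`phi (z - iη)`,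
which is O(E), times `upper z` and a quotient `psi`/`psiBar` of bounded modulus. -/
theorem Good.norm_eps_le (h : D.Good η α δ E) {e : ℝ} {C₀ : ℂ} (hC₀ : C₀ ≠ 0) (he : e ≤ 1)
    (hpsi : ∀ z : ℂ, 2 * δ ≤ z.im → Near e (D.psi η z) C₀)
    (hpsiBar : ∀ z : ℂ, z.im ≤ -(2 * δ) →
      Near e (D.psiBar η z) (exp (-2 * I * Real.pi * α) * C₀)) {K : ℕ} (hK : D.size ≤ K)
    {z : ℂ} (hz : z.im = δ ∨ z.im = η - 2 * δ) : ‖D.eps η α z‖ ≤ E * epsBound η δ K := by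
  have hδ := h.δ_pos
  have hδη := h.δ_le
  have hη := h.η_pos
  have hE := h.E_nonneg
  have hM1 : 1 ≤ ratioBound η δ := one_le_ratioBound hη hδ
  have hexp : 1 ≤ Real.exp (2 * η) := Real.one_le_exp (by linarith)
  have hexp2 : 1 ≤ Real.exp 2 := Real.one_le_exp (by norm_num)
  have hB2 : 2 ≤ 2 * Real.exp (2 * η) * ratioBound η δ := by nlinarith
  have hB1 : 1 ≤ 2 * Real.exp (2 * η) * ratioBound η δ := by linarith
  have hpow : (2 * Real.exp (2 * η) * ratioBound η δ) ^ D.size ≤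
      (2 * Real.exp (2 * η) * ratioBound η δ) ^ K := pow_le_pow_right₀ hB1 hK
  have hne : ∀ b, sin (z - conj (D.w b) - I * η) ≠ 0 := fun b => by
    have hb := h.w_im b
    have hb' := h.w_im_le b
    rcases hz with hz | hz
    · apply sin_ne_zero_of_im_neg; simp; linarith
    · apply sin_ne_zero_of_im_pos; simp; linarith
  rw [← D.phi_mul_prod η α hne, epsBound]
  rcases hz with hz | hz
  · rw [norm_mul]
    refine mul_le_mul (h.phi_le z hz.ge (by linarith)) ?_ (norm_nonneg _) hE
    have h1 : ‖∏ b, (exp (2 * I * z) - D.shifted η b)‖ ≤ 2 ^ D.mc := by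
      refine prod_norm_le_pow fun b => (norm_sub_le _ _).trans ?_
      have h2 : ‖exp (2 * I * z)‖ ≤ 1 := by
        rw [norm_exp_two_I_mul, Real.exp_le_one_iff]; linarith
      have h3 := norm_shifted_le (D := D) (η := η) (b := b) (by linarith [h.w_im_le b])
      linarith
    refine h1.trans ?_
    calc (2 : ℝ) ^ D.mc ≤ (2 * Real.exp (2 * η) * ratioBound η δ) ^ D.mc := by gcongr
      _ ≤ (2 * Real.exp (2 * η) * ratioBound η δ) ^ K :=
        pow_le_pow_right₀ hB1 (le_trans (by rw [size]; omega) hK)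
      _ ≤ _ := le_mul_of_one_le_left (by positivity) hexp2
  · have h1 := D.phi_mul_psi η α (z := z) (sin_ne_zero_of_im_pos (by simp; linarith))
      (fun j => sin_ne_zero_of_im_neg (by simp; linarith))
      (fun j => sin_ne_zero_of_im_pos (by simp; linarith))
    have hzim : (z - I * η).im = -(2 * δ) := by simp [hz]
    -- Just below the axis `psi` itself is not nearly constant, but `psiBar` is, so `psi` is
    -- replaced through the jump relation.
    have h2 := h.psi_eq_psiBar (z := z - I * η) (by rw [hzim, abs_neg, abs_of_pos] <;> linarith)
    have h3 := h.norm_phi_inv_le (z := z - I * η) (by linarith) (by linarith)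
    have h4 := hpsi z (by linarith)
    have h5 := hpsiBar (z - I * η) (by linarith)
    have h6 : D.phi η α (z - I * η) ≠ 0 :=
      h.phi_ne_zero (by rw [hzim, abs_neg, abs_of_pos] <;> linarith)
    have hαn : ∀ s : ℂ, s = 2 * I * Real.pi * α ∨ s = -2 * I * Real.pi * α → ‖exp s‖ = 1 := by
      rintro s (rfl | rfl) <;> · rw [norm_exp]; simp
    have h7 := (h5.symm.norm_le).trans' (le_of_eq (norm_mul _ _).symm)
    rw [hαn _ (Or.inr rfl), one_mul] at h7
    have h8 := h4.norm_le
    have hpB : 0 < ‖D.psiBar η (z - I * η)‖ := norm_pos_iff.2 (h5.ne_zero_iff.2 (by simp [hC₀]))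
    have h9 : ‖D.psi η z‖ ≤ Real.exp 2 * ‖D.psiBar η (z - I * η)‖ := by
      calc ‖D.psi η z‖ ≤ Real.exp e * (Real.exp e * ‖D.psiBar η (z - I * η)‖) :=
            h8.trans (by gcongr)
        _ = Real.exp (e + e) * ‖D.psiBar η (z - I * η)‖ := by rw [Real.exp_add]; ring
        _ ≤ _ := by gcongr; linarith
    have hφ : ‖D.phi η α z‖ ≤ E * Real.exp 2 * ‖D.upper η z‖ := by
      have h10 := congrArg norm h1
      rw [h2] at h10
      simp only [norm_mul, norm_neg, hαn _ (Or.inl rfl), hαn _ (Or.inr rfl), one_mul] at h10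
      have hp : 0 < ‖D.phi η α (z - I * η)‖ := norm_pos_iff.2 h6
      have h11 : ‖D.phi η α z‖ * ‖D.psiBar η (z - I * η)‖ ≤
          E * Real.exp 2 * ‖D.upper η z‖ * ‖D.psiBar η (z - I * η)‖ := by
        calc ‖D.phi η α z‖ * ‖D.psiBar η (z - I * η)‖
            = ‖D.phi η α (z - I * η)‖⁻¹ * (‖D.phi η α z‖ *
                (‖D.phi η α (z - I * η)‖ * ‖D.psiBar η (z - I * η)‖)) := by field_simp
          _ = ‖D.phi η α (z - I * η)‖⁻¹ * (‖D.upper η z‖ * ‖D.psi η z‖) := by rw [h10]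
          _ ≤ E * (‖D.upper η z‖ * (Real.exp 2 * ‖D.psiBar η (z - I * η)‖)) := by gcongr
          _ = _ := by ring
      exact le_of_mul_le_mul_right h11 hpB
    have h12 := h.norm_upper_mul_prod_le hz
    rw [norm_mul] at h12 ⊢
    calc ‖D.phi η α z‖ * ‖∏ b, (exp (2 * I * z) - D.shifted η b)‖
        ≤ E * Real.exp 2 * ‖D.upper η z‖ * ‖∏ b, (exp (2 * I * z) - D.shifted η b)‖ := by gcongr
      _ = E * Real.exp 2 * (‖D.upper η z‖ * ‖∏ b, (exp (2 * I * z) - D.shifted η b)‖) := by ring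
      _ ≤ E * Real.exp 2 * (2 * Real.exp (2 * η) * ratioBound η δ) ^ K := by
          gcongr
          exact h12.trans hpow
      _ = _ := by ring

/-- The annulus in which the close roots are matched. -/
def annulus (η δ : ℝ) : Set ℂ :=
  {Z | Real.exp (-(2 * (η - 2 * δ))) < ‖Z‖ ∧ ‖Z‖ < Real.exp (-(2 * δ))}

theorem isOpen_annulus (η δ : ℝ) : IsOpen (annulus η δ) :=
  (isOpen_lt continuous_const continuous_norm).inter (isOpen_lt continuous_norm continuous_const)

theorem closure_annulus_subset (η δ : ℝ) : closure (annulus η δ) ⊆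
    {Z | Real.exp (-(2 * (η - 2 * δ))) ≤ ‖Z‖ ∧ ‖Z‖ ≤ Real.exp (-(2 * δ))} :=
  closure_minimal (fun _ hZ => ⟨hZ.1.le, hZ.2.le⟩)
    ((isClosed_le continuous_const continuous_norm).inter
      (isClosed_le continuous_norm continuous_const))

/-- With X_j = exp(2i w_j), the equation `phi (w j) = 1` reads ∏(X_j - Y_l) = `eps (w j)`, Y being
the shifted conjugates. The bound for `eps` on both boundary circles extends to the annulus, so the
X are zeros of a small perturbation of the polynomial with zeros Y and can be matched with them. -/
theorem exists_close_root_matching {η δ : ℝ} (hδ : 0 < δ) (hδη : 8 * δ ≤ η) (K : ℕ) :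
    ∃ A C γ : ℝ, 1 ≤ A ∧ 1 ≤ C ∧ 0 < γ ∧ ∀ (D : RootData) (α E e : ℝ) (C₀ : ℂ),
      D.Good η α δ E → D.size ≤ K → C₀ ≠ 0 → e ≤ 1 →
      (∀ z : ℂ, 2 * δ ≤ z.im → Near e (D.psi η z) C₀) →
      (∀ z : ℂ, z.im ≤ -(2 * δ) →
        Near e (D.psiBar η z) (exp (-2 * I * Real.pi * α) * C₀)) →
      A * E ≤ 1 → 4 * (C * (A * E) ^ γ) ≤ 1 →
      ∃ σ : Fin D.mc → Fin D.mc, Function.Injective σ ∧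
        (∀ j, ‖exp (2 * I * D.w j) - D.shifted η (σ j)‖ ≤
          C * (A * E) ^ γ * ‖exp (2 * I * D.w j) - exp (-η)‖) ∧
        ∃ ε' : ℂ → ℂ, (∀ Z ∈ annulus η δ, ‖ε' Z‖ ≤ C * (A * E) ^ γ) ∧
          ∀ z, ∏ l, (exp (2 * I * z) - D.shifted η l) - D.eps η α z =
            (∏ j, (exp (2 * I * z) - exp (2 * I * D.w j))) * (1 - ε' (exp (2 * I * z))) := by
  have hη : 0 < η := by linarith
  set r₁ := Real.exp (-(2 * (η - 2 * δ))) with hr₁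
  set r₂ := Real.exp (-(2 * δ)) with hr₂
  set s := Real.exp (-η) with hs
  have hs₁ : r₁ < s := Real.exp_lt_exp.2 (by linarith)
  have hs₂ : s < r₂ := Real.exp_lt_exp.2 (by linarith)
  have hr₂1 : r₂ < 1 := (Real.exp_lt_one_iff (x := -(2 * δ))).2 (by linarith)
  have hr₁0 : 0 < r₁ := Real.exp_pos _
  set g := min (s - r₁) (r₂ - s) with hg
  have hg0 : 0 < g := lt_min (by linarith) (by linarith)
  have hg1 : g ≤ 1 := (min_le_right _ _).trans (by linarith)
  set r₁' := Real.exp (-(2 * (η - 4 * δ))) with hr₁'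
  set r₂' := Real.exp (-(2 * (3 * δ))) with hr₂'
  have hr₁r : r₁ < r₁' := Real.exp_lt_exp.2 (by linarith)
  have hr₂r : r₂' < r₂ := Real.exp_lt_exp.2 (by linarith)
  -- The close roots lie between the heights 3δ and η - 4δ. As ‖X_j - s‖ ≤ 2, the discs of radius
  -- c‖X_j - s‖ around X_j stay in the annulus.
  set c := min (1 / 2) (min ((r₁' - r₁) / 4) ((r₂ - r₂') / 4)) with hc
  have hc0 : 0 < c := lt_min (by norm_num) (lt_min (by linarith) (by linarith))
  have hc1 : c ≤ (r₁' - r₁) / 4 := (min_le_right _ _).trans (min_le_left _ _)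
  have hc2 : c ≤ (r₂ - r₂') / 4 := (min_le_right _ _).trans (min_le_right _ _)
  obtain ⟨C, γ, hC, hγ, H⟩ := exists_matching_uniform K hc0 (min_le_left _ _)
  have hM1 : 1 ≤ ratioBound η δ := one_le_ratioBound hη hδ
  have hexp : 1 ≤ Real.exp (2 * η) := Real.one_le_exp (by linarith)
  have hB1 : 1 ≤ epsBound η δ K := by
    refine one_le_mul_of_one_le_of_one_le (Real.one_le_exp (by norm_num)) (one_le_pow₀ ?_)
    nlinarith
  have hgK : g ^ K ≤ 1 := pow_le_one₀ hg0.le hg1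
  refine ⟨epsBound η δ K / g ^ K, C, γ, ?_, hC, hγ, ?_⟩
  · rw [le_div_iff₀ (by positivity)]; linarith
  intro D α E e C₀ h hK hC₀ he hpsi hpsiBar hA hsmall
  have hE := h.E_nonneg
  set A := epsBound η δ K / g ^ K with hAdef
  have hA0 : 0 ≤ A * E := by
    have : 0 < A := by positivity
    positivity
  have hkK : D.mc ≤ K := le_trans (by rw [size]; omega) hK
  have hlen : D.mc ≤ D.len := by rw [len]; omega
  have hnorm : ∀ Z : ℂ, r₁ ≤ ‖Z‖ → ‖Z‖ ≤ r₂ → Z ≠ 0 := by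
    rintro Z h1 - rfl
    simp at h1
    linarith
  have hd : DifferentiableOn ℂ (D.discEps η α D.mc) (closure (annulus η δ)) := by
    refine differentiableOn_discEps α hη h.y_wide (fun b => by linarith [h.w_im b]) fun Z hZ => ?_
    obtain ⟨h1, h2⟩ := closure_annulus_subset η δ hZ
    exact ⟨h2.trans_lt hr₂1, lt_of_lt_of_le (Real.exp_lt_exp.2 (by linarith)) h1⟩
  -- On the boundary circles ‖Z - s‖ ≥ g, so dividing out the zero of order `mc` costs at most a
  -- factor 1/g^K.
  have hbdry : ∀ Z ∈ frontier (annulus η δ), ‖D.discEps η α D.mc Z‖ ≤ A * E := by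
    intro Z hZ
    rw [(isOpen_annulus η δ).frontier_eq] at hZ
    obtain ⟨h1, h2⟩ := closure_annulus_subset η δ hZ.1
    have h3 : ‖Z‖ = r₁ ∨ ‖Z‖ = r₂ := by
      by_contra! h4
      exact hZ.2 ⟨lt_of_le_of_ne h1 (Ne.symm h4.1), lt_of_le_of_ne h2 h4.2⟩
    have hgZ : g ≤ ‖Z - s‖ := by
      have h5 := abs_norm_sub_norm_le Z s
      rw [norm_real, Real.norm_eq_abs, abs_of_pos (Real.exp_pos _)] at h5
      refine le_trans ?_ h5
      rcases h3 with h3 | h3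
      · rw [h3, abs_of_neg (by linarith)]
        exact (min_le_left _ _).trans (by linarith)
      · rw [h3, abs_of_pos (by linarith)]
        exact min_le_right _ _
    obtain ⟨z, rfl, hz⟩ := exists_exp_two_I_mul (hnorm Z h1 h2)
    have hzim : z.im = δ ∨ z.im = η - 2 * δ := by
      rcases h3 with h3 | h3
      · right; rw [hz, h3, hr₁, Real.log_exp]; ring
      · left; rw [hz, h3, hr₂, Real.log_exp]; ring
    have h6 := h.norm_eps_le hC₀ he hpsi hpsiBar hK hzim
    have hsc : exp (-(η : ℂ)) = (s : ℂ) := by rw [hs]; push_cast; rfl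
    rw [eps_eq_discEps η α hlen, norm_mul, norm_pow, hsc] at h6
    rw [hAdef, div_mul_eq_mul_div, le_div_iff₀ (by positivity)]
    calc ‖D.discEps η α D.mc (exp (2 * I * z))‖ * g ^ K
        ≤ ‖D.discEps η α D.mc (exp (2 * I * z))‖ * ‖exp (2 * I * z) - s‖ ^ D.mc := by
          refine mul_le_mul_of_nonneg_left ?_ (norm_nonneg _)
          exact (pow_le_pow_of_le_one hg0.le hg1 hkK).trans (by gcongr)
      _ ≤ E * epsBound η δ K := by rw [mul_comm]; exact h6
      _ = _ := mul_comm _ _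
  have hint : ∀ Z ∈ annulus η δ, ‖D.discEps η α D.mc Z‖ ≤ A * E := fun Z hZ =>
    Complex.norm_le_of_forall_mem_frontier_norm_le
      (Metric.isBounded_ball (x := (0 : ℂ)) (r := r₂) |>.subset fun Z hZ => by
        simpa using hZ.2) hd.diffContOnCl hbdry (subset_closure hZ)
  have hwne : ∀ j, D.phi η α (D.w j) ≠ 0 := fun j => by rw [h.phi_w]; exact one_ne_zero
  obtain ⟨σ, hσ, hσx, ε', hε', hε⟩ := H D.mc hkK (A * E) (annulus η δ) s
    (fun j => exp (2 * I * D.w j)) (D.shifted η)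
    (fun Z => (Z - s) ^ D.mc * D.discEps η α D.mc Z) hA0 hA hsmall (isOpen_annulus η δ)
    (((differentiable_id.sub_const _).pow _).differentiableOn.mul (hd.mono subset_closure))
    (fun Z hZ => by
      rw [norm_mul, norm_pow, mul_comm]
      refine mul_le_mul (hint Z hZ) ?_ (by positivity) hA0
      have := pow_le_prod (f := fun l => ‖Z - s‖ + ‖D.shifted η l - s‖) (norm_nonneg (Z - s))
        fun l => le_add_of_nonneg_right (norm_nonneg _)
      exact this)
    (fun a b hab => h.w_inj a b hab)
    (fun j => by
      have h1 := h.w_im j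
      have h2 := h.w_im_le j
      have hl : D.len ≠ 0 := by have := j.pos; omega
      have hX1 : r₁' ≤ ‖exp (2 * I * D.w j)‖ := by
        rw [norm_exp_two_I_mul, hr₁', Real.exp_le_exp]; linarith
      have hX2 : ‖exp (2 * I * D.w j)‖ ≤ r₂' := by
        rw [norm_exp_two_I_mul, hr₂', Real.exp_le_exp]; linarith
      constructor
      · intro h3
        -- X_j = exp(-η) would mean sin(w_j - iη/2) = 0, hence `phi (w j) = 0` instead of 1.
        have h4 := ((scat_ne_zero_of_phi (hwne j)).1 hl).1
        have h5 := exp_sub_exp_eq_sin (D.w j) (I * η / 2)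
        have h6 : exp (2 * I * (I * η / 2)) = s := by
          rw [hs]; push_cast
          congr 1
          linear_combination (η : ℂ) * I_sq
        rw [h6, h3, sub_self, eq_comm, mul_eq_zero] at h5
        rcases h5 with h5 | h5
        · simp at h5
        · exact h4 h5
      · intro Z hZ
        have h3 : ‖exp (2 * I * D.w j) - s‖ ≤ 2 := by
          refine (norm_sub_le _ _).trans ?_
          rw [norm_real, Real.norm_eq_abs, abs_of_pos (Real.exp_pos _)]
          linarith
        rw [mem_closedBall_iff_norm] at hZ
        have h4 : c * ‖exp (2 * I * D.w j) - s‖ ≤ c * 2 := by gcongr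
        have h5 := norm_sub_norm_le Z (exp (2 * I * D.w j))
        have h6 := norm_sub_norm_le (exp (2 * I * D.w j)) Z
        rw [norm_sub_rev] at h6
        exact ⟨by linarith, by linarith⟩)
    (fun j => by
      have h1 := D.phi_mul_prod η α (z := D.w j)
        (fun b => (div_ne_zero_iff.1 ((scat_ne_zero_of_phi (hwne j)).2.2 b).2).2)
      rw [h.phi_w, one_mul, eps_eq_discEps η α hlen] at h1
      rw [h1, hs]
      push_cast
      rfl)
  refine ⟨σ, hσ, fun j => ?_, ε', hε', fun z => ?_⟩
  · have := hσx j
    rw [hs] at this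
    push_cast at this
    exact this
  · rw [← hε, eps_eq_discEps η α hlen, hs]
    push_cast
    rfl

end RootData


/-! ### Strings and the cancellation of their deviations -/

theorem near_sin {c e : ℝ} (hc : 0 < c) (he : 2 * ((4 + 2 / c) * e) ≤ 1) {u v : ℂ}
    (h : c ≤ ‖sin u‖) (hv : ‖v - u‖ ≤ e) : Near (2 * ((4 + 2 / c) * e)) (sin v) (sin u) := by
  have h0 := norm_nonneg (v - u)
  have h1 : 0 < 2 / c := by positivity
  have h2 : (4 + 2 / c) * ‖v - u‖ ≤ (4 + 2 / c) * e := by gcongr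
  have h3 := near_sin_add hc h (d := v - u) (by nlinarith) (by linarith)
  rw [add_sub_cancel] at h3
  exact h3.mono (by linarith)

theorem near_exp {e : ℝ} {u v : ℂ} (h : ‖v - u‖ ≤ e) : Near e (exp v) (exp u) :=
  ⟨v - u, h, by rw [← exp_add, add_sub_cancel]⟩

theorem norm_sin_conj (z : ℂ) : ‖sin (conj z)‖ = ‖sin z‖ := by
  rw [sin_conj, norm_conj]

namespace RootData

/-- The close roots of the lower half plane are, up to a permutation, small perturbations of the
close roots of the upper half plane, shifted by `-iη`. -/
structure Paired (D : RootData) (η : ℝ) (σ : Fin D.mc → Fin D.mc) (d : Fin D.mc → ℂ)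
    (e : ℝ) : Prop where
  bij : Function.Bijective σ
  exp_eq : ∀ a, exp (2 * I * (D.w a + d a)) = D.shifted η (σ a)
  norm_le : ∀ a, ‖d a‖ ≤ e
  near_half : ∀ a, Near e (sin (D.w a + d a - I * η / 2)) (sin (D.w a - I * η / 2))

variable {D : RootData} {η α δ E : ℝ}

/-- The logarithm of Y/X lifts the matching from Z to z and defines the deviations d. The relative
form of the matching bound gives the clause `near_half`: the factor sin(z - iη/2) occurs with power
`len` and may itself be small at a close root, so an absolute bound on d would not control its
relative change. -/
theorem Good.exists_paired (h : D.Good η α δ E) {σ : Fin D.mc → Fin D.mc} {e : ℝ}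
    (hσ : Function.Injective σ)
    (hX : ∀ j, ‖exp (2 * I * D.w j) - D.shifted η (σ j)‖ ≤ e * ‖exp (2 * I * D.w j) - exp (-η)‖)
    (he : 4 * Real.exp (2 * η) * e ≤ 1) :
    ∃ d, D.Paired η σ d (4 * Real.exp (2 * η) * e) := by
  have hη := h.η_pos
  have hδ := h.δ_pos
  have hexp : 1 ≤ Real.exp (2 * η) := Real.one_le_exp (by linarith)
  have key : ∀ j, ∃ t : ℂ, exp (2 * I * (D.w j + t)) = D.shifted η (σ j) ∧
      ‖t‖ ≤ 2 * Real.exp (2 * η) * e ∧ exp (2 * I * D.w j) ≠ exp (-η) ∧ 0 ≤ e := by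
    intro j
    have hj := h.w_im j
    have hj' := h.w_im_le j
    have hl : D.len ≠ 0 := by have := j.pos; rw [len]; omega
    have h0 := ((scat_ne_zero_of_phi (D := D) (η := η) (α := α) (z := D.w j)
      (by rw [h.phi_w]; exact one_ne_zero)).1 hl).1
    have hs : exp (-(η : ℂ)) = exp (2 * I * (I * η / 2)) := by
      congr 1
      linear_combination -(η : ℂ) * I_sq
    have hne : exp (2 * I * D.w j) ≠ exp (-η) := by
      rw [← sub_ne_zero, hs, exp_sub_exp_eq_sin]
      exact mul_ne_zero (mul_ne_zero (by simp) (exp_ne_zero _)) h0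
    have he0 : 0 ≤ e := by
      by_contra! hneg
      have h1 := (norm_nonneg _).trans (hX j)
      have h2 := norm_pos_iff.2 (sub_ne_zero.2 hne)
      nlinarith
    have h1 : ‖exp (2 * I * D.w j) - exp (-η)‖ ≤ 2 := by
      refine (norm_sub_le _ _).trans ?_
      have h2 : ‖exp (2 * I * D.w j)‖ ≤ 1 := by
        rw [norm_exp_two_I_mul, Real.exp_le_one_iff]; linarith
      have h3 : ‖exp (-(η : ℂ))‖ ≤ 1 := by
        rw [norm_exp, Real.exp_le_one_iff]; simp; linarith
      linarith
    set X := exp (2 * I * D.w j) with hXdef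
    have hX0 : X ≠ 0 := exp_ne_zero _
    have hXinv : ‖X‖⁻¹ ≤ Real.exp (2 * η) := by
      rw [hXdef, norm_exp_two_I_mul, ← Real.exp_neg, Real.exp_le_exp]; linarith
    have h2 : ‖D.shifted η (σ j) / X - 1‖ ≤ 2 * Real.exp (2 * η) * e := by
      rw [div_sub_one hX0, norm_div, norm_sub_rev, div_eq_mul_inv]
      calc ‖X - D.shifted η (σ j)‖ * ‖X‖⁻¹ ≤ (e * 2) * Real.exp (2 * η) := by
            gcongr
            exact (hX j).trans (by gcongr)
        _ = _ := by ring
    obtain ⟨t, ht, ht'⟩ := Near.of_norm_sub_one_le h2 (by linarith)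
    refine ⟨t / (2 * I), ?_, ?_, hne, he0⟩
    · rw [mul_add, mul_div_cancel₀ _ (by simp), exp_add, ← hXdef]
      rw [one_mul] at ht'
      rw [← ht', mul_div_cancel₀ _ hX0]
    · rw [norm_div, norm_mul, norm_I, Complex.norm_ofNat, mul_one, div_le_iff₀ two_pos]
      linarith
  choose d hd using key
  refine ⟨d, ⟨Finite.injective_iff_bijective.1 hσ, fun a => (hd a).1, fun a => ?_, fun a => ?_⟩⟩
  · have := (hd a).2.1
    have := (hd a).2.2.2
    nlinarith
  · obtain ⟨h1, h2, h3, h4⟩ := hd a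
    have hs : exp (-(η : ℂ)) = exp (2 * I * (I * η / 2)) := by
      congr 1
      linear_combination -(η : ℂ) * I_sq
    have h5 : Near (2 * e) (exp (2 * I * (D.w a + d a)) - exp (-η))
        (exp (2 * I * D.w a) - exp (-η)) := by
      refine Near.of_norm_sub_le (sub_ne_zero.2 h3) ?_ (by nlinarith)
      rw [sub_sub_sub_cancel_right, h1, norm_sub_rev]
      exact hX a
    rw [hs, exp_sub_exp_eq_sin, exp_sub_exp_eq_sin] at h5
    have h6 : Near (2 * Real.exp (2 * η) * e) (2 * I * exp (I * (D.w a + d a + I * η / 2)))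
        (2 * I * exp (I * (D.w a + I * η / 2))) := by
      refine (near_exp ?_).const_mul _
      rw [← mul_sub, norm_mul, norm_I, one_mul]
      rwa [show D.w a + d a + I * η / 2 - (D.w a + I * η / 2) = d a by ring]
    have h7 := h5.div h6
    rw [mul_div_cancel_left₀ _ (by simp), mul_div_cancel_left₀ _ (by simp)] at h7
    exact h7.mono (by nlinarith)

namespace Paired

variable {σ : Fin D.mc → Fin D.mc} {d : Fin D.mc → ℂ} {e : ℝ} (hp : D.Paired η σ d e)
include hp

theorem conj_eq (a : Fin D.mc) :
    ∃ k : ℤ, conj (D.w (σ a)) = D.w a - I * η + d a + k * Real.pi := by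
  obtain ⟨k, hk⟩ := exp_eq_exp_iff_exists_int.1 (hp.exp_eq a).symm
  refine ⟨k, mul_left_cancel₀ (mul_ne_zero two_ne_zero I_ne_zero) ?_⟩
  linear_combination hk

/-- Lower close roots enter only through products of π-periodic functions, so the permutation σ and
the multiples of π disappear. -/
theorem prod_conj {f g : ℂ → ℂ} (hf : Function.Periodic f Real.pi)
    (hg : ∀ z, f (z - I * η) = g z) : ∏ b, f (conj (D.w b)) = ∏ b, g (D.w b + d b) := by
  rw [← Equiv.prod_comp (Equiv.ofBijective σ hp.bij)]
  refine Finset.prod_congr rfl fun b _ => ?_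
  obtain ⟨k, hk⟩ := hp.conj_eq b
  rw [Equiv.ofBijective_apply, hk, hf.int_mul, ← hg]
  congr 1
  ring

theorem prod_conj_div (z : ℂ) :
    ∏ b, sin (z - conj (D.w b)) / sin (z - conj (D.w b) - I * η) =
      ∏ b, sin (z - (D.w b + d b) + I * η) / sin (z - (D.w b + d b)) := by
  refine hp.prod_conj (f := fun t => sin (z - t) / sin (z - t - I * η))
    (g := fun t => sin (z - t + I * η) / sin (z - t)) (fun t => ?_) fun t => ?_
  · simp only
    rw [show z - (t + Real.pi) = z - t - Real.pi by ring,
      show z - t - Real.pi - I * η = z - t - I * η - Real.pi by ring, sin_sub_pi, sin_sub_pi,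
      neg_div_neg_eq]
  · rw [show z - (t - I * η) = z - t + I * η by ring, add_sub_cancel_right]

end Paired

end RootData

theorem norm_sin_sub_int_mul_pi (u : ℂ) (k : ℤ) : ‖sin (u - k * Real.pi)‖ = ‖sin u‖ :=
  Function.Periodic.sub_int_mul_eq (f := fun u => ‖sin u‖) (c := (Real.pi : ℂ))
    (fun u => by simp [sin_add_pi]) k

theorem near_scat {η c e : ℝ} (hc : 0 < c) (he : 2 * ((4 + 2 / c) * e) ≤ 1) {u v : ℂ}
    (h : c ≤ ‖sin (u + I * η)‖) (h' : c ≤ ‖sin (u - I * η)‖) (hv : ‖v - u‖ ≤ e) :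
    Near (2 * ((4 + 2 / c) * e) + 2 * ((4 + 2 / c) * e)) (scat η v) (scat η u) := by
  refine (near_sin hc he h ?_).div (near_sin hc he h' ?_)
  · rwa [add_sub_add_right_eq_sub]
  · rwa [sub_sub_sub_cancel_right]

namespace RootData

variable {D : RootData} {η α δ E : ℝ} {σ : Fin D.mc → Fin D.mc} {d : Fin D.mc → ℂ} {c e τ : ℝ}

/-- Every factor of `eps` has a sine bounded below, by heights or by `hgap`, except the power of
sin(z - iη/2), which is covered by `near_half`. The number of factors accounts for `len` in the
error. -/
theorem Good.near_eps (h : D.Good η α δ E) (hp : D.Paired η σ d e) (hc : 0 < c) (hcδ : c ≤ δ)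
    (hgap : ∀ a b, c ≤ ‖sin (D.y a - D.w b - I * η)‖)
    (hτ : τ = 2 * ((4 + 2 / c) * e)) (hτ1 : τ ≤ 1) (a : Fin D.mc) :
    Near (3 * D.len * τ) (D.eps η α (D.w a + d a)) (D.eps η α (D.w a)) := by
  have hη := h.η_pos
  have hδ := h.δ_pos
  have hδη := h.δ_le
  have hda := hp.norm_le a
  have he0 : 0 ≤ e := (norm_nonneg _).trans hda
  have h2c : 0 < 2 / c := by positivity
  have heτ : e ≤ τ := by rw [hτ]; nlinarith
  have hw := h.w_im a
  have hw' := h.w_im_le a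
  have hs : ∀ u v : ℂ, c ≤ ‖sin u‖ → v - u = d a → Near τ (sin v) (sin u) := fun u v hu hv => by
    rw [hτ] at hτ1 ⊢
    exact near_sin hc hτ1 hu (by rwa [hv])
  have hS : ∀ t : ℂ, c ≤ ‖sin (D.w a - t + I * η)‖ → c ≤ ‖sin (D.w a - t - I * η)‖ →
      Near (τ + τ) (scat η (D.w a + d a - t)) (scat η (D.w a - t)) := fun t h1 h2 => by
    rw [hτ] at hτ1 ⊢
    refine near_scat hc hτ1 h1 h2 ?_
    rwa [show D.w a + d a - t - (D.w a - t) = d a by ring]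
  have hl : (D.len : ℝ) = 2 * (D.nr + 2 * D.mw + 2 * D.mc) := by rw [len]; push_cast; ring
  have hmce : (D.mc : ℝ) * e ≤ D.mc * τ := by gcongr
  refine Near.mono (((((Near.refl _).mul ((((hp.near_half a).mono heτ).div
    (hs _ _ (le_norm_sin_of_le_im ?_) (by ring))).pow D.len)).mul
    (Near.prod_fin fun j => hS _ (le_norm_sin_of_le_im ?_) (le_norm_sin_of_im_le ?_))).mul
    (Near.prod_fin fun b => (hS _ ?_ (le_norm_sin_of_im_le ?_)).mul
      (hS _ (le_norm_sin_of_le_im ?_) (le_norm_sin_of_le_im ?_)))).mul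
    (Near.prod_fin fun b => (hS _ (le_norm_sin_of_le_im ?_) (le_norm_sin_of_im_le ?_)).mul
      ((hs _ _ (le_norm_sin_of_le_im ?_) (by ring)).mul
        ((near_exp (e := e) ?_).const_mul _)))) ?_
  · simp; linarith
  · simp; linarith
  · simp; linarith
  · rw [show D.w a - D.y b + I * η = -(D.y b - D.w a - I * η) by ring, sin_neg, norm_neg]
    exact hgap b a
  · have := h.y_im b; simp; linarith
  · have := h.y_im b; simp; linarith
  · have := h.y_im b; simp; linarith
  · have := h.w_im_le b; simp; linarith
  · have := h.w_im b; simp; linarith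
  · have := h.w_im b; simp; linarith
  · rw [show I * (D.w a + d a + (conj (D.w b) + I * η)) - I * (D.w a + (conj (D.w b) + I * η)) =
      I * d a by ring, norm_mul, norm_I, one_mul]
    exact hda
  · rw [hl]
    linarith

/-- Let P have zeros Y. At X_a, P equals `eps`; at Y_σ(a), P vanishes, so ∏(Y_σ(a) - X_j) is -`eps`
up to a factor close to 1. As `eps` hardly changes between the two points, the two products of small
differences agree up to the sign. This holds without any lower bound on the deviations or on the
distances between close roots. -/
theorem Good.near_prod_sin (h : D.Good η α δ E) (hp : D.Paired η σ d e) (hc : 0 < c) (hcδ : c ≤ δ)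
    (hgap : ∀ a b, c ≤ ‖sin (D.y a - D.w b - I * η)‖)
    (hτ : τ = 2 * ((4 + 2 / c) * e)) (hτ1 : τ ≤ 1) {ε' : ℂ → ℂ}
    (hε' : ∀ Z ∈ annulus η δ, 2 * ‖ε' Z‖ ≤ e)
    (hε : ∀ z, ∏ l, (exp (2 * I * z) - D.shifted η l) - D.eps η α z =
            (∏ j, (exp (2 * I * z) - exp (2 * I * D.w j))) * (1 - ε' (exp (2 * I * z))))
    (a : Fin D.mc) :
    Near (4 * D.len * τ) (∏ b, sin (D.w a + d a - D.w b)) (-∏ b, sin (D.w a - (D.w b + d b))) := by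
  have hη := h.η_pos
  have hδ := h.δ_pos
  have hδη := h.δ_le
  have he0 : 0 ≤ e := (norm_nonneg _).trans (hp.norm_le a)
  have h2c : 0 < 2 / c := by positivity
  have heτ : 8 * e ≤ τ := by rw [hτ]; nlinarith
  have h1 := hε (D.w a + d a)
  rw [hp.exp_eq a, Finset.prod_eq_zero (Finset.mem_univ (σ a)) (sub_self _), zero_sub] at h1
  have h2 : ∏ l, (exp (2 * I * D.w a) - D.shifted η (Equiv.ofBijective σ hp.bij l)) =
      D.eps η α (D.w a) := by
    have := D.phi_mul_prod η α (z := D.w a) fun b => by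
      have := scat_ne_zero_of_phi (D := D) (η := η) (α := α) (z := D.w a)
        (by rw [h.phi_w]; exact one_ne_zero)
      exact (div_ne_zero_iff.1 (this.2.2 b).2).2
    rwa [h.phi_w, one_mul, ← Equiv.prod_comp (Equiv.ofBijective σ hp.bij)] at this
  have h3 := (h.near_eps hp hc hcδ hgap hτ hτ1 a).const_mul (-1)
  rw [neg_one_mul, neg_one_mul, h1, ← h2] at h3
  have hmem : D.shifted η (σ a) ∈ annulus η δ := by
    have h4 := h.w_im (σ a)
    have h5 := h.w_im_le (σ a)
    have h6 : (conj (D.w (σ a)) + I * η).im = η - (D.w (σ a)).im := by simp; ring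
    rw [shifted, annulus, Set.mem_ofPred_eq, norm_exp_two_I_mul, h6]
    constructor <;> rw [Real.exp_lt_exp] <;> linarith
  have h4 : Near (2 * (e / 2)) (1 - ε' (D.shifted η (σ a))) 1 := by
    refine Near.of_norm_sub_one_le ?_ (by linarith)
    rw [sub_sub_cancel_left, norm_neg]
    linarith [hε' _ hmem]
  have h5 := h3.div h4
  rw [mul_div_cancel_right₀ _ (h4.ne_zero_iff.2 one_ne_zero), div_one] at h5
  have h6 : ∀ j, D.shifted η (σ a) - exp (2 * I * D.w j) =
      2 * I * exp (I * (D.w a + d a + D.w j)) * sin (D.w a + d a - D.w j) := fun j => by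
    rw [← hp.exp_eq, exp_sub_exp_eq_sin]
  have h7 : ∀ j, exp (2 * I * D.w a) - D.shifted η (Equiv.ofBijective σ hp.bij j) =
      2 * I * exp (I * (D.w a + (D.w j + d j))) * sin (D.w a - (D.w j + d j)) := fun j => by
    rw [Equiv.ofBijective_apply, ← hp.exp_eq, exp_sub_exp_eq_sin]
  simp only [h6, h7] at h5
  rw [Finset.prod_mul_distrib (f := fun j => 2 * I * exp (I * (D.w a + d a + D.w j))),
    Finset.prod_mul_distrib (f := fun j => 2 * I * exp (I * (D.w a + (D.w j + d j))))] at h5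
  have h8 : Near (D.mc * (e + e)) (∏ j, 2 * I * exp (I * (D.w a + d a + D.w j)))
      (∏ j, 2 * I * exp (I * (D.w a + (D.w j + d j)))) := by
    refine Near.prod_fin fun j => (near_exp ?_).const_mul _
    rw [← mul_sub, norm_mul, norm_I, one_mul,
      show D.w a + d a + D.w j - (D.w a + (D.w j + d j)) = d a - d j by ring]
    exact (norm_sub_le _ _).trans (add_le_add (hp.norm_le a) (hp.norm_le j))
  have h9 := h5.div h8
  have hne : ∀ f : Fin D.mc → ℂ, ∏ j, 2 * I * exp (f j) ≠ 0 := fun f =>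
    Finset.prod_ne_zero_iff.2 fun j _ => by simp
  rw [mul_div_cancel_left₀ _ (hne _), neg_div, mul_div_cancel_left₀ _ (hne _)] at h9
  refine h9.mono ?_
  have hl : (D.len : ℝ) = 2 * (D.nr + 2 * D.mw + 2 * D.mc) := by rw [len]; push_cast; ring
  have hmce : (D.mc : ℝ) * (8 * e) ≤ D.mc * τ := by gcongr
  have hmc1 : (1 : ℝ) ≤ D.mc := by exact_mod_cast a.pos
  have h10 : 1 * τ ≤ D.mc * τ := by gcongr; linarith
  have hτ0 : 0 ≤ τ := by linarith
  have h11 : 0 ≤ (D.nr : ℝ) * τ := by positivity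
  have h12 : 0 ≤ (D.mw : ℝ) * τ := by positivity
  rw [hl]
  linarith

variable (D η α) in
/-- The factor of `phi (z - iη)` without zeros at the close roots. -/
noncomputable def phiLow (z : ℂ) : ℂ :=
  -exp (-2 * I * Real.pi * α) * (sin (z - 3 * I * η / 2) / sin (z - I * η / 2)) ^ D.len *
    (∏ j, sin (z - D.x j) / sin (z - D.x j - 2 * I * η)) *
    (∏ b, (sin (z - D.y b) / sin (z - D.y b - 2 * I * η)) *
      (sin (z - conj (D.y b)) / sin (z - conj (D.y b) - 2 * I * η))) *
    ∏ b, (sin (z - D.w b - 2 * I * η))⁻¹ *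
      (sin (z - conj (D.w b)) / sin (z - conj (D.w b) - 2 * I * η))

variable (D η) in
/-- The factor of `upper` without zeros at the close roots. -/
noncomputable def upperLow (z : ℂ) : ℂ :=
  (∏ j, sin (z - D.ν j - I * η) / sin (z - D.ν j)) *
    (∏ b, scat η (z - D.y b) *
      (sin (z - conj (D.y b)) / sin (z - conj (D.y b) - 2 * I * η))) *
    ((∏ b, (sin (z - D.w b - I * η))⁻¹) *
      ∏ b, sin (z - conj (D.w b)) / sin (z - conj (D.w b) - I * η))

theorem phi_sub_eq (z : ℂ) :
    D.phi η α (z - I * η) = D.phiLow η α z * ∏ b, sin (z - D.w b) := by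
  have h1 : ∀ t : ℂ, scat η (z - I * η - t) = sin (z - t) / sin (z - t - 2 * I * η) := fun t => by
    rw [scat]; ring_nf
  rw [phi, phiLow, mul_assoc _ _ (∏ b, sin (z - D.w b)), ← Finset.prod_mul_distrib]
  simp only [h1]
  rw [show z - I * η - I * η / 2 = z - 3 * I * η / 2 by ring,
    show z - I * η + I * η / 2 = z - I * η / 2 by ring]
  congr 1
  refine Finset.prod_congr rfl fun b _ => ?_
  rw [div_eq_mul_inv (sin (z - D.w b))]
  ring

/-- The equations for the two members of a string multiplied together. The powers of length `len`
and the real roots telescope against `psiBar (z - iη)` and `psi z`. The sines of the close-root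
differences that may be small have been taken out of `phiLow` and `upperLow` beforehand. -/
theorem phiLow_mul_phi_mul_psiBar {z : ℂ} (h0 : sin (z - I * η / 2) ≠ 0)
    (h0' : sin (z - 3 * I * η / 2) ≠ 0) (hx : ∀ j, sin (z - D.x j - 2 * I * η) ≠ 0)
    (hx' : ∀ j, sin (z - D.x j - I * η) ≠ 0)
    (hν : ∀ j, sin (z - D.ν j) ≠ 0) (hy : ∀ b, sin (z - D.y b) ≠ 0)
    (hy' : ∀ b, sin (z - D.y b - 2 * I * η) ≠ 0) (hw : ∀ b, sin (z - D.w b - 2 * I * η) ≠ 0)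
    (hw' : ∀ b, sin (z - conj (D.w b) - 2 * I * η) ≠ 0) :
    D.phiLow η α z * D.phi η α z * D.psiBar η (z - I * η) =
      exp (-2 * I * Real.pi * α) * exp (-2 * I * Real.pi * α) *
        (D.upperLow η z * D.psi η z) := by
  have s1 : ∀ t : ℂ, z - I * η - t = z - t - I * η := fun t => by ring
  have s2 : ∀ t : ℂ, z - I * η - t - I * η = z - t - 2 * I * η := fun t => by ring
  have s3 : ∀ t : ℂ, z - I * η - t + I * η = z - t := fun t => by ring
  have hA : (sin (z - 3 * I * η / 2) / sin (z - I * η / 2)) ^ D.len *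
      (sin (z - I * η / 2) / sin (z + I * η / 2)) ^ D.len *
      (sin (z - I * η - I * η / 2) ^ D.len)⁻¹ = (sin (z + I * η / 2) ^ D.len)⁻¹ := by
    rw [show z - I * η - I * η / 2 = z - 3 * I * η / 2 by ring, ← mul_pow, ← inv_pow, ← mul_pow,
      ← inv_pow]
    congr 1
    generalize sin (z - 3 * I * η / 2) = t at h0' ⊢
    generalize sin (z - I * η / 2) = u at h0 ⊢
    field_simp
  have hX : (∏ j, sin (z - D.x j) / sin (z - D.x j - 2 * I * η)) *
      (∏ j, scat η (z - D.x j)) *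
      (∏ j, sin (z - I * η - D.x j) * sin (z - I * η - D.x j - I * η)) =
      ∏ j, sin (z - D.x j) * sin (z - D.x j + I * η) := by
    simp only [← Finset.prod_mul_distrib]
    refine Finset.prod_congr rfl fun j _ => ?_
    have := hx j
    have := hx' j
    rw [scat, s2, s1]
    field_simp
  have hN : ∏ j, sin (z - I * η - D.ν j) =
      (∏ j, sin (z - D.ν j - I * η) / sin (z - D.ν j)) * ∏ j, sin (z - D.ν j) := by
    rw [← Finset.prod_mul_distrib]
    refine Finset.prod_congr rfl fun j _ => ?_
    rw [s1, div_mul_cancel₀ _ (hν j)]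
  have hY : (∏ b, (sin (z - D.y b) / sin (z - D.y b - 2 * I * η)) *
        (sin (z - conj (D.y b)) / sin (z - conj (D.y b) - 2 * I * η))) *
      (∏ b, scat η (z - D.y b) * scat η (z - conj (D.y b))) *
      (∏ b, sin (z - I * η - D.y b - I * η) / sin (z - I * η - D.y b + I * η)) =
      (∏ b, scat η (z - D.y b) *
        (sin (z - conj (D.y b)) / sin (z - conj (D.y b) - 2 * I * η))) *
      ∏ b, sin (z - conj (D.y b) + I * η) / sin (z - conj (D.y b) - I * η) := by
    simp only [← Finset.prod_mul_distrib]
    refine Finset.prod_congr rfl fun b _ => ?_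
    have h1 := hy b
    have h2 := hy' b
    rw [s2, s3, scat, scat]
    generalize sin (z - D.y b + I * η) / sin (z - D.y b - I * η) = t1
    generalize sin (z - conj (D.y b) + I * η) / sin (z - conj (D.y b) - I * η) = t2
    field_simp
  have hW : (∏ b, (sin (z - D.w b - 2 * I * η))⁻¹ *
        (sin (z - conj (D.w b)) / sin (z - conj (D.w b) - 2 * I * η))) *
      (∏ b, scat η (z - D.w b) * scat η (z - conj (D.w b))) *
      (∏ b, sin (z - I * η - D.w b - I * η) * sin (z - I * η - conj (D.w b) - I * η)) =
      ((∏ b, (sin (z - D.w b - I * η))⁻¹) *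
        ∏ b, sin (z - conj (D.w b)) / sin (z - conj (D.w b) - I * η)) *
      ∏ b, sin (z - D.w b + I * η) * sin (z - conj (D.w b) + I * η) := by
    simp only [← Finset.prod_mul_distrib]
    refine Finset.prod_congr rfl fun b _ => ?_
    have h1 := hw b
    have h2 := hw' b
    rw [s2, s2, scat, scat, div_eq_mul_inv (sin (z - D.w b + I * η)),
      div_eq_mul_inv (sin (z - conj (D.w b) + I * η)),
      div_eq_mul_inv (sin (z - conj (D.w b))) (sin (z - conj (D.w b) - I * η))]
    generalize (sin (z - D.w b - I * η))⁻¹ = t1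
    generalize (sin (z - conj (D.w b) - I * η))⁻¹ = t2
    field_simp
  rw [upperLow, psi, ← hA, ← hX, phiLow, phi, psiBar, hN]
  linear_combination (exp (-2 * I * Real.pi * α) * exp (-2 * I * Real.pi * α) *
    ((sin (z - 3 * I * η / 2) / sin (z - I * η / 2)) ^ D.len *
      (sin (z - I * η / 2) / sin (z + I * η / 2)) ^ D.len *
      (sin (z - I * η - I * η / 2) ^ D.len)⁻¹) *
    ((∏ j, sin (z - D.x j) / sin (z - D.x j - 2 * I * η)) *
      (∏ j, scat η (z - D.x j)) *
      (∏ j, sin (z - I * η - D.x j) * sin (z - I * η - D.x j - I * η))) *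
    ((∏ j, sin (z - D.ν j - I * η) / sin (z - D.ν j)) * ∏ j, sin (z - D.ν j))) *
    (((∏ b, (sin (z - D.w b - 2 * I * η))⁻¹ *
        (sin (z - conj (D.w b)) / sin (z - conj (D.w b) - 2 * I * η))) *
      (∏ b, scat η (z - D.w b) * scat η (z - conj (D.w b))) *
      (∏ b, sin (z - I * η - D.w b - I * η) * sin (z - I * η - conj (D.w b) - I * η))) * hY +
      ((∏ b, scat η (z - D.y b) *
        (sin (z - conj (D.y b)) / sin (z - conj (D.y b) - 2 * I * η))) *
      ∏ b, sin (z - conj (D.y b) + I * η) / sin (z - conj (D.y b) - I * η)) * hW)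

theorem Good.near_phiLow (h : D.Good η α δ E) (hp : D.Paired η σ d e) (hc : 0 < c) (hcδ : c ≤ δ)
    (hgap : ∀ a b, c ≤ ‖sin (D.y a - D.w b - I * η)‖)
    (hτ : τ = 2 * ((4 + 2 / c) * e)) (hτ1 : τ ≤ 1) (a : Fin D.mc) :
    Near (3 * D.len * τ) (D.phiLow η α (D.w a + d a)) (D.phiLow η α (D.w a)) := by
  have hη := h.η_pos
  have hδ := h.δ_pos
  have hδη := h.δ_le
  have hda := hp.norm_le a
  have he0 : 0 ≤ e := (norm_nonneg _).trans hda
  have h2c : 0 < 2 / c := by positivity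
  have heτ : e ≤ τ := by rw [hτ]; nlinarith
  have hw := h.w_im a
  have hw' := h.w_im_le a
  have hs : ∀ u v : ℂ, c ≤ ‖sin u‖ → v - u = d a → Near τ (sin v) (sin u) := fun u v hu hv => by
    rw [hτ] at hτ1 ⊢
    exact near_sin hc hτ1 hu (by rwa [hv])
  have hs' : ∀ u v : ℂ, c ≤ ‖sin v‖ → v - u = d a → Near τ (sin v) (sin u) := fun u v hu hv => by
    rw [hτ] at hτ1 ⊢
    refine (near_sin hc hτ1 hu ?_).symm
    rwa [norm_sub_rev, hv]
  have hl : (D.len : ℝ) = 2 * (D.nr + 2 * D.mw + 2 * D.mc) := by rw [len]; push_cast; ring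
  obtain ⟨k, hk⟩ := hp.conj_eq a
  refine Near.mono (((((Near.refl _).mul (((hs _ _ (le_norm_sin_of_im_le ?_) (by ring)).div
    ((hp.near_half a).mono heτ)).pow D.len)).mul
    (Near.prod_fin fun j => (hs _ _ (le_norm_sin_of_le_im ?_) (by ring)).div
      (hs _ _ (le_norm_sin_of_im_le ?_) (by ring)))).mul
    (Near.prod_fin fun b => ((hs _ _ (le_norm_sin_of_im_le ?_) (by ring)).div
      (hs _ _ (le_norm_sin_of_im_le ?_) (by ring))).mul
      ((hs _ _ (le_norm_sin_of_le_im ?_) (by ring)).div (hs' _ _ ?_ (by ring))))).mul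
    (Near.prod_fin fun b => (hs _ _ (le_norm_sin_of_im_le ?_) (by ring)).inv.mul
      ((hs _ _ (le_norm_sin_of_le_im ?_) (by ring)).div
        (hs _ _ (le_norm_sin_of_im_le ?_) (by ring))))) ?_
  · simp; linarith
  · simp; linarith
  · simp; linarith
  · have := h.y_im b; simp; linarith
  · have := h.y_im b; simp; linarith
  · have := h.y_im b; simp; linarith
  -- The denominator sin(w_a - conj y_b - 2iη) may be small by heights alone. Up to d_a and
  -- multiples of π it is minus the conjugate of sin(y_b - w_σ(a) - iη), which is bounded below.
  · have h1 := hgap b (σ a)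
    rw [← norm_sin_conj, ← norm_neg, ← sin_neg] at h1
    rw [show D.w a + d a - conj (D.y b) - 2 * I * η =
      -(conj (D.y b - D.w (σ a) - I * η)) - k * Real.pi by simp [hk]; ring]
    rwa [norm_sin_sub_int_mul_pi]
  · have := h.w_im b; simp; linarith
  · have := h.w_im b; simp; linarith
  · have := h.w_im_le b; simp; linarith
  · rw [hl]
    have : 0 ≤ (D.mc : ℝ) * τ := by have := he0.trans heτ; positivity
    linarith

end RootData


/-! ### The higher-level Bethe equations -/

/-- A uniform lower bound for the denominators of the higher-level Bethe equations. -/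
structure Separated (η c : ℝ) {nh mw mc : ℕ} (ν : Fin nh → ℝ) (y : Fin mw → ℂ)
    (w : Fin mc → ℂ) : Prop where
  w_ν : ∀ a b, c ≤ ‖sin (w a - ν b)‖
  w_w : ∀ a b, c ≤ ‖sin (w a - w b - I * η)‖
  w_y : ∀ a b, c ≤ ‖sin (w a - y b - I * η)‖
  w_yc : ∀ a b, c ≤ ‖sin (w a - conj (y b) - 2 * I * η)‖
  y_ν : ∀ a b, c ≤ ‖sin (y a - ν b)‖
  y_w : ∀ a b, c ≤ ‖sin (y a - w b - I * η)‖
  y_y : ∀ a b, c ≤ ‖sin (y a - y b - I * η)‖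
  y_yc : ∀ a b, c ≤ ‖sin (y a - conj (y b) - 2 * I * η)‖
  yc_ν : ∀ a b, c ≤ ‖sin (conj (y a) - ν b + I * η)‖
  yc_w : ∀ a b, c ≤ ‖sin (conj (y a) - w b)‖
  yc_y : ∀ a b, c ≤ ‖sin (conj (y a) - y b)‖
  yc_yc : ∀ a b, c ≤ ‖sin (conj (y a) - conj (y b) - I * η)‖

/-- The symmetric form is an exact rewriting: after the shifts by ∓iη/2 the two-body factors of χ
are the factors of the other form, so no further estimate is needed. -/
theorem symmetricRHS_of_upper {η α : ℝ} {nh mw mc : ℕ} (ν : Fin nh → ℝ) (y : Fin mw → ℂ)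
    (w : Fin mc → ℂ) (x : ℂ) : symmetricRHS η ν (chi η y w) (x - I * η / 2) =
      exp (2 * I * Real.pi * α) * upperRHS η α ν y w x := by
  have he : exp (2 * I * Real.pi * α) * exp (-2 * I * Real.pi * α) = 1 := by
    rw [← exp_add]; simp
  have h1 : ∀ t : ℂ, x - I * η / 2 - t - I * η / 2 = x - t - I * η := fun t => by ring
  have h2 : ∀ t : ℂ, x - I * η / 2 - t + I * η / 2 = x - t := fun t => by ring
  have h3 : ∀ t : ℂ, x - I * η / 2 - (t - I * η / 2) = x - t := fun t => by ring
  have h4 : ∀ t : ℂ, x - I * η / 2 - (t + I * η / 2) + I * η = x - t := fun t => by ring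
  have h5 : ∀ t : ℂ, x - I * η / 2 - (t + I * η / 2) - I * η = x - t - 2 * I * η :=
    fun t => by ring
  simp only [symmetricRHS, upperRHS, Fintype.prod_sum_type, chi, Sum.elim_inl, Sum.elim_inr, h1, h2,
    h3, h4, h5, Finset.prod_mul_distrib, mul_div_mul_comm]
  linear_combination (-(∏ b, sin (x - ν b - I * η) / sin (x - ν b)) *
    (∏ b, sin (x - w b + I * η) / sin (x - w b - I * η)) *
    ((∏ b, sin (x - y b + I * η) / sin (x - y b - I * η)) *
      ∏ b, sin (x - conj (y b)) / sin (x - conj (y b) - 2 * I * η))) * -he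

theorem symmetricRHS_of_lower {η α : ℝ} {nh mw mc : ℕ} (ν : Fin nh → ℝ) (y : Fin mw → ℂ)
    (w : Fin mc → ℂ) (x : ℂ) : symmetricRHS η ν (chi η y w) (x + I * η / 2) =
      exp (2 * I * Real.pi * α) * lowerRHS η α ν y w x := by
  have he : exp (2 * I * Real.pi * α) * exp (-2 * I * Real.pi * α) = 1 := by
    rw [← exp_add]; simp
  have h1 : ∀ t : ℂ, x + I * η / 2 - t + I * η / 2 = x - t + I * η := fun t => by ring
  have h2 : ∀ t : ℂ, x + I * η / 2 - t - I * η / 2 = x - t := fun t => by ring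
  have h3 : ∀ t : ℂ, x + I * η / 2 - (t + I * η / 2) = x - t := fun t => by ring
  have h4 : ∀ t : ℂ, x + I * η / 2 - (t - I * η / 2) - I * η = x - t := fun t => by ring
  have h5 : ∀ t : ℂ, x + I * η / 2 - (t - I * η / 2) + I * η = x - t + 2 * I * η :=
    fun t => by ring
  simp only [symmetricRHS, lowerRHS, Fintype.prod_sum_type, chi, Sum.elim_inl, Sum.elim_inr, h1, h2,
    h3, h4, h5, Finset.prod_mul_distrib, mul_div_mul_comm]
  linear_combination (-(∏ b, sin (x - ν b) / sin (x - ν b + I * η)) *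
    (∏ b, sin (x - w b + 2 * I * η) / sin (x - w b)) *
    ((∏ b, sin (x - y b + 2 * I * η) / sin (x - y b)) *
      ∏ b, sin (x - conj (y b) + I * η) / sin (x - conj (y b) - I * η))) * -he

theorem HigherLevelBethe.of_norm_le {η α r : ℝ} {nh mw mc : ℕ} {ν : Fin nh → ℝ} {y : Fin mw → ℂ}
    {w : Fin mc → ℂ} (h1 : ∀ a, ‖1 - upperRHS η α ν y w (w a)‖ ≤ r)
    (h2 : ∀ a, ‖1 - upperRHS η α ν y w (y a)‖ ≤ r)
    (h3 : ∀ a, ‖1 - lowerRHS η α ν y w (conj (y a))‖ ≤ r) : HigherLevelBethe η α ν y w r := by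
  have he : ‖exp (2 * I * Real.pi * α)‖ = 1 := by rw [norm_exp]; simp
  have key : ∀ t : ℂ, ‖1 - t‖ ≤ r →
      ‖exp (2 * I * Real.pi * α) - exp (2 * I * Real.pi * α) * t‖ ≤ r := fun t ht => by
    rwa [← mul_one_sub, norm_mul, he, one_mul]
  refine ⟨h1, h2, h3, ?_⟩
  rintro ((a | a) | a)
  · simp only [chi, Sum.elim_inl]
    rw [← chi, symmetricRHS_of_upper (α := α)]
    exact key _ (h2 a)
  · simp only [chi, Sum.elim_inl, Sum.elim_inr]
    rw [← chi, symmetricRHS_of_lower (α := α)]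
    exact key _ (h3 a)
  · simp only [chi, Sum.elim_inr]
    rw [← chi, symmetricRHS_of_upper (α := α)]
    exact key _ (h1 a)

namespace RootData

variable {D : RootData} {η α δ E : ℝ} {σ : Fin D.mc → Fin D.mc} {d : Fin D.mc → ℂ} {c e τ e₀ : ℝ}
  {C₀ : ℂ}

theorem Paired.upper_eq (hp : D.Paired η σ d e) (z : ℂ) : D.upper η z =
    (∏ j, sin (z - D.ν j - I * η) / sin (z - D.ν j)) *
    (∏ b, scat η (z - D.y b) *
      (sin (z - conj (D.y b)) / sin (z - conj (D.y b) - 2 * I * η))) *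
    ∏ b, (sin (z - D.w b) / sin (z - D.w b - I * η)) *
      (sin (z - (D.w b + d b) + I * η) / sin (z - (D.w b + d b))) := by
  rw [upper, Finset.prod_mul_distrib (f := fun b => sin (z - D.w b) / sin (z - D.w b - I * η)),
    Finset.prod_mul_distrib (f := fun b => sin (z - D.w b) / sin (z - D.w b - I * η)),
    hp.prod_conj_div]

theorem upperRHS_eq (z : ℂ) : upperRHS η α D.ν D.y D.w z =
    -exp (-2 * I * Real.pi * α) * ((∏ j, sin (z - D.ν j - I * η) / sin (z - D.ν j)) *
    (∏ b, scat η (z - D.y b) *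
      (sin (z - conj (D.y b)) / sin (z - conj (D.y b) - 2 * I * η))) *
    ∏ b, sin (z - D.w b + I * η) / sin (z - D.w b - I * η)) := by
  simp only [upperRHS, scat, mul_div_mul_comm]
  ring

/-- `upper_y_near` is this equation with conjugate close roots. Replacing them by w - iη makes
sin(y_a - w) cancel between the two members of a string, and only the factor in `upperRHS` remains.
-/
theorem Good.near_upperRHS_y (h : D.Good η α δ E) (hp : D.Paired η σ d e) (hc : 0 < c)
    (hcδ : c ≤ δ) (hτ : τ = 2 * ((4 + 2 / c) * e)) (hτ0 : 0 ≤ τ) (hτ1 : τ ≤ 1) (hC₀ : C₀ ≠ 0)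
    (hpsi : ∀ z : ℂ, 2 * δ ≤ z.im → Near e₀ (D.psi η z) C₀) (a : Fin D.mw) :
    Near (D.len * τ + 2 * e₀) (upperRHS η α D.ν D.y D.w (D.y a)) 1 := by
  have hη := h.η_pos
  have hδ := h.δ_pos
  have hδη := h.δ_le
  have hy := h.y_im a
  have n1 := h.upper_y_near hC₀ hpsi a
  refine Near.mono (Near.trans (e := D.len * τ) ?_ n1) le_rfl
  rw [upperRHS_eq, hp.upper_eq]
  refine (Near.const_mul (Near.mono ((Near.refl _).mul (Near.prod_fin (e := τ + τ) fun b => ?_)) ?_)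
    _)
  · have hwb := h.w_im b
    have hwb' := h.w_im_le b
    have hd := hp.norm_le b
    have e1 : c ≤ ‖sin (D.y a - D.w b)‖ := le_norm_sin_of_le_im (by simp; linarith)
    have m1 : Near τ (sin (D.y a - (D.w b + d b))) (sin (D.y a - D.w b)) := by
      rw [hτ] at hτ1 ⊢
      refine near_sin hc hτ1 e1 ?_
      rwa [show D.y a - (D.w b + d b) - (D.y a - D.w b) = -d b by ring, norm_neg]
    have m2 : Near τ (sin (D.y a - (D.w b + d b) + I * η)) (sin (D.y a - D.w b + I * η)) := by
      rw [hτ] at hτ1 ⊢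
      refine near_sin hc hτ1 (le_norm_sin_of_le_im (by simp; linarith)) ?_
      rwa [show D.y a - (D.w b + d b) + I * η - (D.y a - D.w b + I * η) = -d b by ring, norm_neg]
    have m3 := ((Near.refl (sin (D.y a - D.w b) / sin (D.y a - D.w b - I * η))).mul
      (m2.div m1)).symm
    have hne := sin_ne_zero_of_norm hc e1
    rw [show sin (D.y a - D.w b) / sin (D.y a - D.w b - I * η) *
      (sin (D.y a - D.w b + I * η) / sin (D.y a - D.w b)) =
      sin (D.y a - D.w b + I * η) / sin (D.y a - D.w b - I * η) by
        rw [mul_comm, div_mul_div_cancel₀ hne]] at m3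
    exact m3.mono (by linarith)
  · have hl : (D.len : ℝ) = 2 * (D.nr + 2 * D.mw + 2 * D.mc) := by rw [len]; push_cast; ring
    have h11 : 0 ≤ (D.nr : ℝ) * τ := by positivity
    have h12 : 0 ≤ (D.mw : ℝ) * τ := by positivity
    have h13 : 0 ≤ (D.mc : ℝ) * τ := by positivity
    rw [hl]
    linarith

/-- Reflected from the upper half plane: the conjugate of `lowerRHS` at conj y is, up to the string
deviations, the inverse of -exp(-2πiα) `upper y`, which is already known to be close to 1. -/
theorem Good.near_lowerRHS (h : D.Good η α δ E) (hp : D.Paired η σ d e) (hc : 0 < c)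
    (hcδ : c ≤ δ) (hgap : ∀ a b, c ≤ ‖sin (D.y a - D.w b - I * η)‖)
    (hτ : τ = 2 * ((4 + 2 / c) * e)) (hτ0 : 0 ≤ τ) (hτ1 : τ ≤ 1) (hC₀ : C₀ ≠ 0)
    (hpsi : ∀ z : ℂ, 2 * δ ≤ z.im → Near e₀ (D.psi η z) C₀) (a : Fin D.mw) :
    Near (D.len * τ + 2 * e₀) (lowerRHS η α D.ν D.y D.w (conj (D.y a))) 1 := by
  have hη := h.η_pos
  have hδ := h.δ_pos
  have hδη := h.δ_le
  have hy := h.y_im a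
  set z := D.y a with hz
  have n1 := h.upper_y_near hC₀ hpsi a
  rw [← hz] at n1
  have hne := n1.ne_zero_iff.2 one_ne_zero
  have c1 : ∀ t : ℂ, conj (sin (conj z - t)) = sin (z - conj t) := fun t => by
    rw [← sin_conj]; simp
  have c2 : ∀ t : ℂ, conj (sin (conj z - t + I * η)) = sin (z - conj t - I * η) := fun t => by
    rw [← sin_conj]; simp [sub_eq_add_neg]
  have c3 : ∀ t : ℂ, conj (sin (conj z - t + 2 * I * η)) = sin (z - conj t - 2 * I * η) :=
    fun t => by rw [← sin_conj]; simp [sub_eq_add_neg, map_ofNat]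
  have c4 : ∀ t : ℂ, conj (sin (conj z - t - I * η)) = sin (z - conj t + I * η) := fun t => by
    rw [← sin_conj]; simp [sub_eq_add_neg]
  have c5 : conj (exp (-2 * I * Real.pi * α)) = exp (2 * I * Real.pi * α) := by
    rw [← exp_conj]; simp [map_ofNat]
  have he : exp (2 * I * Real.pi * α) * exp (-2 * I * Real.pi * α) = 1 := by
    rw [← exp_add]; simp
  have hA : (∏ j, sin (z - D.ν j) / sin (z - D.ν j - I * η)) *
      (∏ j, sin (z - D.ν j - I * η) / sin (z - D.ν j)) = 1 := by
    rw [← Finset.prod_mul_distrib]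
    refine Finset.prod_eq_one fun j _ => ?_
    have h1 : sin (z - D.ν j) ≠ 0 := sin_ne_zero_of_im_pos (by simp; linarith)
    have h2 : sin (z - D.ν j - I * η) ≠ 0 := sin_ne_zero_of_im_pos (by simp; linarith)
    field_simp
  have hne' : ∀ b, scat η (z - D.y b) ≠ 0 := fun b =>
    ((scat_ne_zero_of_phi (D := D) (η := η) (α := α) (z := z)
      (by rw [h.phi_y]; exact one_ne_zero)).2.1 b).1
  have hB : (∏ b, sin (z - conj (D.y b) - 2 * I * η) * sin (z - D.y b - I * η) /
        (sin (z - conj (D.y b)) * sin (z - D.y b + I * η))) *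
      (∏ b, scat η (z - D.y b) *
        (sin (z - conj (D.y b)) / sin (z - conj (D.y b) - 2 * I * η))) = 1 := by
    rw [← Finset.prod_mul_distrib]
    refine Finset.prod_eq_one fun b _ => ?_
    have hyb := h.y_im b
    obtain ⟨h3, h4⟩ := div_ne_zero_iff.1 (hne' b)
    have h1 : sin (z - conj (D.y b)) ≠ 0 := sin_ne_zero_of_im_pos (by simp; linarith)
    have h2 : sin (z - conj (D.y b) - 2 * I * η) ≠ 0 := sin_ne_zero_of_im_pos (by simp; linarith)
    rw [scat]
    field_simp
  have hC : ∏ b, sin (z - conj (D.w b) - 2 * I * η) / sin (z - conj (D.w b)) =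
      ∏ b, sin (z - (D.w b + d b) - I * η) / sin (z - (D.w b + d b) + I * η) := by
    refine hp.prod_conj (f := fun t => sin (z - t - 2 * I * η) / sin (z - t))
      (g := fun t => sin (z - t - I * η) / sin (z - t + I * η)) (fun t => ?_) fun t => ?_
    · simp only
      rw [show z - (t + Real.pi) = z - t - Real.pi by ring,
        show z - t - Real.pi - 2 * I * η = z - t - 2 * I * η - Real.pi by ring, sin_sub_pi,
        sin_sub_pi, neg_div_neg_eq]
    · rw [show z - (t - I * η) = z - t + I * η by ring,
        show z - t + I * η - 2 * I * η = z - t - I * η by ring]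
  have hD : Near (D.mc * (τ + τ))
      ((∏ b, sin (z - (D.w b + d b) - I * η) / sin (z - (D.w b + d b) + I * η)) *
        ∏ b, (sin (z - D.w b) / sin (z - D.w b - I * η)) *
          (sin (z - (D.w b + d b) + I * η) / sin (z - (D.w b + d b)))) 1 := by
    rw [← Finset.prod_mul_distrib, ← Finset.prod_const_one (s := (Finset.univ : Finset (Fin D.mc)))]
    refine Near.prod_fin fun b => ?_
    have hwb := h.w_im b
    have hwb' := h.w_im_le b
    have hd := hp.norm_le b
    have e1 : c ≤ ‖sin (z - D.w b)‖ := le_norm_sin_of_le_im (by simp; linarith)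
    have m1 : Near τ (sin (z - (D.w b + d b))) (sin (z - D.w b)) := by
      rw [hτ] at hτ1 ⊢
      refine near_sin hc hτ1 e1 ?_
      rwa [show z - (D.w b + d b) - (z - D.w b) = -d b by ring, norm_neg]
    have m2 : Near τ (sin (z - (D.w b + d b) - I * η)) (sin (z - D.w b - I * η)) := by
      rw [hτ] at hτ1 ⊢
      refine near_sin hc hτ1 (hgap a b) ?_
      rwa [show z - (D.w b + d b) - I * η - (z - D.w b - I * η) = -d b by ring, norm_neg]
    have m3 : Near τ (sin (z - (D.w b + d b) + I * η)) (sin (z - D.w b + I * η)) := by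
      rw [hτ] at hτ1 ⊢
      refine near_sin hc hτ1 (le_norm_sin_of_le_im (by simp; linarith)) ?_
      rwa [show z - (D.w b + d b) + I * η - (z - D.w b + I * η) = -d b by ring, norm_neg]
    have f1 := sin_ne_zero_of_norm hc e1
    have f2 := sin_ne_zero_of_norm hc (hgap a b)
    have f3 : sin (z - D.w b + I * η) ≠ 0 := sin_ne_zero_of_im_pos (by simp; linarith)
    have g3 := m3.ne_zero_iff.2 f3
    have m4 := (m2.div m1).mul (Near.refl (sin (z - D.w b) / sin (z - D.w b - I * η)))
    rw [div_mul_div_cancel₀ f1, div_self f2] at m4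
    rw [show sin (z - (D.w b + d b) - I * η) / sin (z - (D.w b + d b) + I * η) *
      (sin (z - D.w b) / sin (z - D.w b - I * η) *
        (sin (z - (D.w b + d b) + I * η) / sin (z - (D.w b + d b)))) =
      sin (z - (D.w b + d b) - I * η) / sin (z - (D.w b + d b)) *
        (sin (z - D.w b) / sin (z - D.w b - I * η)) by
        generalize sin (z - D.w b) / sin (z - D.w b - I * η) = t
        field_simp]
    exact m4.mono (by linarith)
  have key : Near (D.mc * (τ + τ)) (conj (lowerRHS η α D.ν D.y D.w (conj z)) *
      (-exp (-2 * I * Real.pi * α) * D.upper η z)) 1 := by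
    have hlow : conj (lowerRHS η α D.ν D.y D.w (conj z)) = -exp (2 * I * Real.pi * α) *
        (∏ j, sin (z - D.ν j) / sin (z - D.ν j - I * η)) *
        (∏ b, sin (z - conj (D.w b) - 2 * I * η) / sin (z - conj (D.w b))) *
        (∏ b, sin (z - conj (D.y b) - 2 * I * η) * sin (z - D.y b - I * η) /
        (sin (z - conj (D.y b)) * sin (z - D.y b + I * η))) := by
      simp only [lowerRHS, map_mul, map_neg, map_prod, map_div₀, c1, c2, c3, c4, c5, conj_ofReal,
        Complex.conj_conj]
    rw [hlow, hC, hp.upper_eq]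
    refine (Near.trans (e := 0) ?_ hD).mono (by simp)
    rw [show ∀ a1 a2 a3 a4 b1 b2 b3 b4 : ℂ, -a1 * a2 * a3 * a4 * (-b1 * (b2 * b3 * b4)) =
      (a1 * b1) * (a2 * b2) * (a4 * b3) * (a3 * b4) by intros; ring, he, hA, hB]
    simpa using Near.refl _
  have n2 := key.div n1
  rw [mul_div_cancel_right₀ _ hne, div_one] at n2
  have n3 := n2.map_conj
  rw [Complex.conj_conj, map_one] at n3
  refine n3.mono ?_
  have hl : (D.len : ℝ) = 2 * (D.nr + 2 * D.mw + 2 * D.mc) := by rw [len]; push_cast; ring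
  have h11 : 0 ≤ (D.nr : ℝ) * τ := by positivity
  have h12 : 0 ≤ (D.mw : ℝ) * τ := by positivity
  have h13 : 0 ≤ (D.mc : ℝ) * τ := by positivity
  rw [hl]
  linarith

theorem Paired.upperLow_eq (hp : D.Paired η σ d e) (z : ℂ) : D.upperLow η z =
    (∏ j, sin (z - D.ν j - I * η) / sin (z - D.ν j)) *
    (∏ b, scat η (z - D.y b) *
      (sin (z - conj (D.y b)) / sin (z - conj (D.y b) - 2 * I * η))) *
    ∏ b, (sin (z - D.w b - I * η))⁻¹ *
      (sin (z - (D.w b + d b) + I * η) / sin (z - (D.w b + d b))) := by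
  rw [upperLow, Finset.prod_mul_distrib (f := fun b => (sin (z - D.w b - I * η))⁻¹),
    hp.prod_conj_div]

/-- The equation for the lower member gives `phiLow` times ∏ sin(w_a + d_a - w_b) = 1. The product
of the two equations, with `psi` and `psiBar` nearly constant, replaces `phiLow` by `upperLow`, and
`hprod` replaces the small product by the one that cancels the small denominators of `upperLow`. -/
theorem Good.near_upperRHS_w (h : D.Good η α δ E) (hp : D.Paired η σ d e) (hc : 0 < c)
    (hcδ : c ≤ δ) (hgap : ∀ a b, c ≤ ‖sin (D.y a - D.w b - I * η)‖)
    (hτ : τ = 2 * ((4 + 2 / c) * e)) (hτ1 : τ ≤ 1) (hC₀ : C₀ ≠ 0)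
    (hpsi : ∀ z : ℂ, 2 * δ ≤ z.im → Near e₀ (D.psi η z) C₀)
    (hpsiBar : ∀ z : ℂ, z.im ≤ -(2 * δ) →
        Near e₀ (D.psiBar η z) (exp (-2 * I * Real.pi * α) * C₀)) (a : Fin D.mc)
    (hprod : Near (4 * D.len * τ) (∏ b, sin (D.w a + d a - D.w b))
      (-∏ b, sin (D.w a - (D.w b + d b)))) :
    Near (8 * D.len * τ + 2 * e₀) (upperRHS η α D.ν D.y D.w (D.w a)) 1 := by
  have hη := h.η_pos
  have hδ := h.δ_pos
  have hδη := h.δ_le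
  have hw := h.w_im a
  have hw' := h.w_im_le a
  have hl0 : D.len ≠ 0 := by have := a.pos; rw [len]; omega
  -- Modulo π this point is conj(w_σ(a)), and conjugation sends solutions of `phi = 1` to solutions.
  have h1 : D.phi η α (D.w a + d a - I * η) = 1 := by
    obtain ⟨k, hk⟩ := hp.conj_eq a
    have h2 := D.conj_phi η α (D.w (σ a))
    rw [h.phi_w, map_one, hk, (show Function.Periodic (D.phi η α) Real.pi from
      D.phi_add_pi η α).int_mul, show D.w a - I * η + d a = D.w a + d a - I * η by ring] at h2
    exact inv_eq_one.1 h2.symm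
  rw [phi_sub_eq] at h1
  have n1 := (h.near_phiLow (α := α) hp hc hcδ hgap hτ hτ1 a).mul hprod
  rw [h1] at n1
  have hJ := phiLow_mul_phi_mul_psiBar (D := D) (η := η) (α := α) (z := D.w a)
    ((scat_ne_zero_of_phi (D := D) (η := η) (α := α) (z := D.w a)
      (by rw [h.phi_w]; exact one_ne_zero)).1 hl0).1
    (sin_ne_zero_of_im_neg (by simp; linarith))
    (fun j => sin_ne_zero_of_im_neg (by simp; linarith))
    (fun j => sin_ne_zero_of_im_neg (by simp; linarith))
    (fun j => sin_ne_zero_of_im_pos (by simp; linarith))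
    (fun b => sin_ne_zero_of_im_neg (by have := h.y_im b; simp; linarith))
    (fun b => sin_ne_zero_of_im_neg (by have := h.y_im b; simp; linarith))
    (fun b => sin_ne_zero_of_im_neg (by have := h.w_im b; simp; linarith))
    (fun b => sin_ne_zero_of_im_neg (by have := h.w_im_le b; simp; linarith))
  rw [h.phi_w, mul_one] at hJ
  set q := exp (-2 * I * Real.pi * α) with hq
  have hq0 : q ≠ 0 := exp_ne_zero _
  have n2 := (Near.refl (D.phiLow η α (D.w a))).mul
    (hpsiBar (D.w a - I * η) (by simp; linarith))
  have n3 := ((Near.refl (D.upperLow η (D.w a))).mul (hpsi (D.w a) (by linarith))).const_mul (q * q)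
  rw [hJ] at n2
  have n4 := (n2.symm.trans n3).div (Near.refl (q * C₀))
  rw [mul_div_cancel_right₀ _ (mul_ne_zero hq0 hC₀),
    show q * q * (D.upperLow η (D.w a) * C₀) = q * D.upperLow η (D.w a) * (q * C₀) by ring,
    mul_div_cancel_right₀ _ (mul_ne_zero hq0 hC₀)] at n4
  have n5 := n1.trans (n4.mul (Near.refl (-∏ b, sin (D.w a - (D.w b + d b)))))
  -- Deviations are not assumed non-zero: a product close to 1 contains these sines as factors.
  have hne : ∀ b, sin (D.w a - (D.w b + d b)) ≠ 0 := by
    have := n5.symm.ne_zero_iff.2 one_ne_zero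
    rw [mul_neg, neg_ne_zero] at this
    exact fun b => Finset.prod_ne_zero_iff.1 (right_ne_zero_of_mul this) b (Finset.mem_univ b)
  have e1 : q * D.upperLow η (D.w a) * -∏ b, sin (D.w a - (D.w b + d b)) =
      -q * ((∏ j, sin (D.w a - D.ν j - I * η) / sin (D.w a - D.ν j)) *
      (∏ b, scat η (D.w a - D.y b) *
        (sin (D.w a - conj (D.y b)) / sin (D.w a - conj (D.y b) - 2 * I * η))) *
      ∏ b, sin (D.w a - (D.w b + d b) + I * η) / sin (D.w a - D.w b - I * η)) := by
    rw [hp.upperLow_eq]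
    have : ∏ b, sin (D.w a - (D.w b + d b) + I * η) / sin (D.w a - D.w b - I * η) =
        (∏ b, (sin (D.w a - D.w b - I * η))⁻¹ *
      (sin (D.w a - (D.w b + d b) + I * η) / sin (D.w a - (D.w b + d b)))) *
      ∏ b, sin (D.w a - (D.w b + d b)) := by
      rw [← Finset.prod_mul_distrib]
      refine Finset.prod_congr rfl fun b _ => ?_
      rw [mul_assoc, div_mul_cancel₀ _ (hne b), div_eq_inv_mul]
    rw [this]
    ring
  rw [e1] at n5
  have n6 : Near (D.mc * τ)
      (∏ b, sin (D.w a - (D.w b + d b) + I * η) / sin (D.w a - D.w b - I * η))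
      (∏ b, sin (D.w a - D.w b + I * η) / sin (D.w a - D.w b - I * η)) := by
    refine Near.prod_fin fun b => ?_
    have hwb := h.w_im b
    have hwb' := h.w_im_le b
    have hd := hp.norm_le b
    have m2 : Near τ (sin (D.w a - (D.w b + d b) + I * η)) (sin (D.w a - D.w b + I * η)) := by
      rw [hτ] at hτ1 ⊢
      refine near_sin hc hτ1 (le_norm_sin_of_le_im (by simp; linarith)) ?_
      rwa [show D.w a - (D.w b + d b) + I * η - (D.w a - D.w b + I * η) = -d b by ring, norm_neg]
    simpa using m2.div (Near.refl (sin (D.w a - D.w b - I * η)))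
  have n7 := n5.trans (((Near.refl ((∏ j, sin (D.w a - D.ν j - I * η) / sin (D.w a - D.ν j)) *
      (∏ b, scat η (D.w a - D.y b) *
        (sin (D.w a - conj (D.y b)) / sin (D.w a - conj (D.y b) - 2 * I * η))))).mul n6).const_mul
        (-q))
  rw [← upperRHS_eq] at n7
  refine n7.symm.mono ?_
  have he0 : 0 ≤ e := (norm_nonneg _).trans (hp.norm_le a)
  have hτ0 : 0 ≤ τ := by rw [hτ]; positivity
  have hl : (D.len : ℝ) = 2 * (D.nr + 2 * D.mw + 2 * D.mc) := by rw [len]; push_cast; ring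
  have h11 : 0 ≤ (D.nr : ℝ) * τ := by positivity
  have h12 : 0 ≤ (D.mw : ℝ) * τ := by positivity
  have h13 : 0 ≤ (D.mc : ℝ) * τ := by positivity
  rw [hl]
  linarith

end RootData


namespace RootData

variable {D : RootData} {η α δ E : ℝ} {σ : Fin D.mc → Fin D.mc} {d : Fin D.mc → ℂ} {c e τ : ℝ}

theorem Good.separated (h : D.Good η α δ E) (hp : D.Paired η σ d e) (hc : 0 < c) (hcδ : c ≤ δ)
    (hgap : ∀ a b, c ≤ ‖sin (D.y a - D.w b - I * η)‖)
    (hgap' : ∀ a b, c ≤ ‖sin (D.y a - D.y b - I * η)‖)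
    (hτ : τ = 2 * ((4 + 2 / c) * e)) (hτ1 : τ ≤ 1) : Separated η (c / 3) D.ν D.y D.w := by
  have hη := h.η_pos
  have hδ := h.δ_pos
  have hδη := h.δ_le
  have hc3 : c / 3 ≤ c := by linarith
  constructor
  · intro a b; have := h.w_im a; exact le_norm_sin_of_le_im (by simp; linarith)
  · intro a b; have := h.w_im b; have := h.w_im_le a
    exact le_norm_sin_of_im_le (by simp; linarith)
  · intro a b; have := h.y_im b; have := h.w_im_le a
    exact le_norm_sin_of_im_le (by simp; linarith)
  · intro a b
    obtain ⟨k, hk⟩ := hp.conj_eq a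
    -- By conjugation and the pairing, as for `near_phiLow`; removing d_a costs a factor exp τ ≤ 3,
    -- which explains c/3.
    have h1 := hgap b (σ a)
    rw [← norm_sin_conj, ← norm_neg, ← sin_neg, ← norm_sin_sub_int_mul_pi _ k,
      show -(conj (D.y b - D.w (σ a) - I * η)) - k * Real.pi =
      D.w a + d a - conj (D.y b) - 2 * I * η by simp [hk]; ring] at h1
    have h2 : Near τ (sin (D.w a - conj (D.y b) - 2 * I * η))
        (sin (D.w a + d a - conj (D.y b) - 2 * I * η)) := by
      rw [hτ] at hτ1 ⊢
      refine near_sin hc hτ1 h1 ?_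
      rw [norm_sub_rev, show D.w a + d a - conj (D.y b) - 2 * I * η -
        (D.w a - conj (D.y b) - 2 * I * η) = d a by ring]
      exact hp.norm_le a
    have h3 := h2.symm.norm_le
    have h4 : Real.exp τ ≤ 3 := (Real.exp_le_exp.2 hτ1).trans Real.exp_one_lt_three.le
    have h5 := norm_nonneg (sin (D.w a - conj (D.y b) - 2 * I * η))
    nlinarith
  · intro a b; have := h.y_im a; exact le_norm_sin_of_le_im (by simp; linarith)
  · exact fun a b => hc3.trans (hgap a b)
  · exact fun a b => hc3.trans (hgap' a b)
  · intro a b; have := h.y_im a; have := h.y_im b; exact le_norm_sin_of_le_im (by simp; linarith)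
  · intro a b; have := h.y_im a; exact le_norm_sin_of_im_le (by simp; linarith)
  · intro a b; have := h.y_im a; have := h.w_im b; exact le_norm_sin_of_im_le (by simp; linarith)
  · intro a b; have := h.y_im a; have := h.y_im b; exact le_norm_sin_of_im_le (by simp; linarith)
  · intro a b
    have h1 := hgap' b a
    rw [← norm_sin_conj, ← norm_neg, ← sin_neg] at h1
    rw [show conj (D.y a) - conj (D.y b) - I * η = -(conj (D.y b - D.y a - I * η)) by simp; ring]
    exact hc3.trans h1

end RootData

/-- Collects the estimates with constants that depend only on η, δ and K. The term E comes from the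
near-constancy of `psi`, E^γ from the matching, and `len + 1` from the number of factors. -/
theorem higherLevelBethe_of_good {η δ : ℝ} (hδ : 0 < δ) (hδη : 8 * δ ≤ η) (K : ℕ) :
    ∃ C γ c : ℝ, 0 < C ∧ 0 < γ ∧ 0 < c ∧ ∀ (D : RootData) (α E : ℝ), D.Good η α δ E →
      D.size < K → C * (D.len + 1) * (E + E ^ γ) ≤ 1 →
      Separated η c D.ν D.y D.w ∧
      HigherLevelBethe η α D.ν D.y D.w (C * (D.len + 1) * (E + E ^ γ)) ∧
      ∃ (σ : Fin D.mc → Fin D.mc) (d : Fin D.mc → ℂ), Function.Bijective σ ∧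
        (∀ a, ∃ k : ℤ, conj (D.w (σ a)) = D.w a - I * η + d a + k * Real.pi) ∧
        ∀ a, ‖d a‖ ≤ C * (D.len + 1) * (E + E ^ γ) := by
  have hη : 0 < η := by linarith
  obtain ⟨C₁, hC₁, H₁⟩ := RootData.exists_psi_near hδ
  obtain ⟨A, C₂, γ, hA, hC₂, hγ, H₂⟩ := RootData.exists_close_root_matching hδ hδη K
  set c := RootData.gapBound η δ K with hc
  have hc0 : 0 < c := RootData.gapBound_pos hη hδ K
  have hcδ : c ≤ δ := min_le_left _ _
  set B := 2 * ((4 + 2 / c) * (4 * Real.exp (2 * η) * (C₂ * A ^ γ))) with hB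
  have hAγ : 0 < A ^ γ := Real.rpow_pos_of_pos (by linarith) _
  have hB0 : 0 < B := by positivity
  refine ⟨4 * C₁ + A + 16 * B, γ, c / 3, by positivity, hγ, by positivity, ?_⟩
  intro D α E h hK hR
  have hE := h.E_nonneg
  set P := E ^ γ with hP
  have hP0 : 0 ≤ P := Real.rpow_nonneg hE _
  set R := (4 * C₁ + A + 16 * B) * (D.len + 1) * (E + P) with hRdef
  have hl : (0 : ℝ) ≤ D.len := Nat.cast_nonneg _
  have hA0 : 0 < A := by linarith
  -- All summands are non-negative, so R ≤ 1 gives every single smallness condition, and R bounds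
  -- every single error.
  have hsplit : R = (4 * (C₁ * E) + A * E + 16 * (D.len * (B * P)) + 16 * (B * P)) +
      ((4 * C₁ + A) * D.len * E + (4 * C₁ + A) * (D.len + 1) * P +
        16 * B * (D.len + 1) * E) := by rw [hRdef]; ring
  have hrest : 0 ≤ (4 * C₁ + A) * D.len * E + (4 * C₁ + A) * (D.len + 1) * P +
        16 * B * (D.len + 1) * E := by positivity
  have q1 : 0 ≤ C₁ * E := by positivity
  have q2 : 0 ≤ A * E := by positivity
  have q3 : 0 ≤ B * P := by positivity
  have q4 : 0 ≤ D.len * (B * P) := by positivity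
  have hC₁E : C₁ * E ≤ 1 := by linarith
  obtain ⟨C₀, hC₀, hpsi, hpsiBar⟩ := H₁ D η α E h hC₁E
  set e' := C₂ * (A * E) ^ γ with he'
  have he'0 : 0 ≤ e' := by positivity
  set e := 4 * Real.exp (2 * η) * e' with he
  have hexp : 1 ≤ Real.exp (2 * η) := Real.one_le_exp (by linarith)
  have he4 : 4 * e' ≤ e := by rw [he]; nlinarith
  have hτ : B * P = 2 * ((4 + 2 / c) * e) := by
    rw [he, he', Real.mul_rpow hA0.le hE, hB, ← hP]; ring
  have heτ : 8 * e ≤ B * P := by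
    rw [hτ]
    have : 0 < 2 / c := by positivity
    nlinarith
  obtain ⟨σ, hσ, hX, ε', hε', hε⟩ := H₂ D α E (C₁ * E) C₀ h hK.le hC₀ hC₁E hpsi hpsiBar
    (by linarith) (by linarith)
  obtain ⟨d, hp⟩ := h.exists_paired hσ hX (by linarith)
  obtain ⟨g1, g2⟩ := h.gap hC₀ hC₁E hpsi hK
  have hτ1 : B * P ≤ 1 := by linarith
  have hfin : ∀ t : ℂ, Near (8 * D.len * (B * P) + 2 * (C₁ * E)) t 1 → ‖1 - t‖ ≤ R := by
    intro t ht
    rw [norm_sub_rev]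
    refine (ht.norm_sub_one_le (by linarith)).trans (by linarith)
  refine ⟨h.separated hp hc0 hcδ g2 g1 hτ hτ1, ?_, σ, d, hp.bij, hp.conj_eq, fun a => ?_⟩
  · refine HigherLevelBethe.of_norm_le (fun a => hfin _ ?_) (fun a => hfin _ ?_)
      fun a => hfin _ ?_
    · refine h.near_upperRHS_w hp hc0 hcδ g2 hτ hτ1 hC₀ hpsi hpsiBar a ?_
      exact h.near_prod_sin hp hc0 hcδ g2 hτ hτ1 (fun Z hZ => by linarith [hε' Z hZ]) hε a
    · exact (h.near_upperRHS_y hp hc0 hcδ hτ q3 hτ1 hC₀ hpsi a).mono (by linarith)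
    · exact (h.near_lowerRHS hp hc0 hcδ g2 hτ q3 hτ1 hC₀ hpsi a).mono (by linarith)
  · exact (hp.norm_le a).trans (by linarith)


/-! ### The counting function, its exponential and its derivative -/

theorem eq_mul_exp_integral {f g : ℝ → ℂ} (hf : Continuous f)
    (hg : ∀ t, HasDerivAt g (f t * g t) t) (a b : ℝ) : g b = g a * exp (∫ t in a..b, f t) := by
  have h1 : ∀ t, HasDerivAt (fun t => g t * exp (-∫ s in a..t, f s)) 0 t := by
    intro t
    have h2 := (intervalIntegral.integral_hasDerivAt_right (hf.intervalIntegrable a t)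
      hf.stronglyMeasurable.stronglyMeasurableAtFilter hf.continuousAt).neg.cexp
    refine ((hg t).mul h2).congr_deriv ?_
    ring
  have h2 := is_const_of_deriv_eq_zero (f := fun t => g t * exp (-∫ s in a..t, f s))
    (fun t => (h1 t).differentiableAt) (fun t => (h1 t).deriv) b a
  simp only [intervalIntegral.integral_same, neg_zero, exp_zero, mul_one] at h2
  rw [← h2, mul_assoc, ← exp_add]
  simp

theorem pathIntegral_const_mul (c : ℂ) (f : ℂ → ℂ) (z : ℂ) :
    pathIntegral (fun z => c * f z) z = c * pathIntegral f z := by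
  simp only [pathIntegral, mul_assoc, intervalIntegral.integral_const_mul, mul_add]

/-- The equation g' = f g is integrated along the two segments of the path, so no branch of the
logarithm has to be chosen. The value 1 at -π/2, where the path starts, fixes the constant. -/
theorem exp_pathIntegral {f g : ℂ → ℂ} {z : ℂ}
    (h1 : Continuous fun t : ℝ => f (-(Real.pi : ℂ) / 2 + I * t))
    (h2 : Continuous fun s : ℝ => f ((s : ℂ) + I * z.im))
    (h3 : ∀ t : ℝ, HasDerivAt g (f (-(Real.pi : ℂ) / 2 + I * t) * g (-(Real.pi : ℂ) / 2 + I * t))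
      (-(Real.pi : ℂ) / 2 + I * t))
    (h4 : ∀ s : ℝ, HasDerivAt g (f ((s : ℂ) + I * z.im) * g ((s : ℂ) + I * z.im))
      ((s : ℂ) + I * z.im))
    (hg : g (-(Real.pi : ℂ) / 2) = 1) : exp (pathIntegral f z) = g z := by
  have e1 := eq_mul_exp_integral (f := fun t : ℝ => f (-(Real.pi : ℂ) / 2 + I * t) * I)
    (g := fun t : ℝ => g (-(Real.pi : ℂ) / 2 + I * t)) (h1.mul continuous_const) (fun t => by
      have h5 : HasDerivAt (fun t : ℝ => -(Real.pi : ℂ) / 2 + I * t) I t := by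
        simpa using ((hasDerivAt_id (t : ℂ)).const_mul I).const_add (-(Real.pi : ℂ) / 2)
          |>.comp_ofReal
      refine ((h3 t).comp t h5).congr_deriv ?_
      ring) 0 z.im
  have e2 := eq_mul_exp_integral (f := fun s : ℝ => f ((s : ℂ) + I * z.im))
    (g := fun s : ℝ => g ((s : ℂ) + I * z.im)) h2 (fun s => by
      have h5 : HasDerivAt (fun s : ℝ => (s : ℂ) + I * z.im) 1 s := by
        simpa using ((hasDerivAt_id (s : ℂ)).add_const (I * z.im)).comp_ofReal
      refine ((h4 s).comp s h5).congr_deriv ?_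
      ring) (-Real.pi / 2) z.re
  simp only [ofReal_zero, mul_zero, add_zero, hg, one_mul] at e1
  have h7 : ((-Real.pi / 2 : ℝ) : ℂ) = -(Real.pi : ℂ) / 2 := by push_cast; ring
  have h8 : (z.re : ℂ) + I * z.im = z := by rw [mul_comm, re_add_im]
  simp only [h7, h8] at e2
  rw [e2, e1, pathIntegral, exp_add]

theorem cos_div_sin_sub {a b : ℂ} (ha : sin a ≠ 0) (hb : sin b ≠ 0) :
    cos a / sin a - cos b / sin b = sin (b - a) / (sin a * sin b) := by
  rw [div_sub_div _ _ ha hb, sin_sub]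
  ring_nf

theorem two_pi_I_mul_kernelK {η : ℝ} {z : ℂ} (h1 : sin (z + I * η) ≠ 0)
    (h2 : sin (z - I * η) ≠ 0) : 2 * I * Real.pi * kernelK η z =
      cos (z - I * η) / sin (z - I * η) - cos (z + I * η) / sin (z + I * η) := by
  rw [cos_div_sin_sub h2 h1, show z + I * η - (z - I * η) = (2 * η : ℂ) * I by ring, sin_mul_I,
    kernelK]
  have : (Real.pi : ℂ) ≠ 0 := by simp [Real.pi_ne_zero]
  field_simp

theorem I_mul_bareMomentumDeriv {η : ℝ} {z : ℂ} (h1 : sin (z + I * η / 2) ≠ 0)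
    (h2 : sin (z - I * η / 2) ≠ 0) : I * bareMomentumDeriv η z =
      cos (z - I * η / 2) / sin (z - I * η / 2) - cos (z + I * η / 2) / sin (z + I * η / 2) := by
  rw [cos_div_sin_sub h2 h1, show z + I * η / 2 - (z - I * η / 2) = (η : ℂ) * I by ring, sin_mul_I,
    bareMomentumDeriv]
  field_simp

theorem hasDerivAt_sin_div {a b z : ℂ} (ha : sin (z + a) ≠ 0) (hb : sin (z + b) ≠ 0) :
    HasDerivAt (fun z => sin (z + a) / sin (z + b))
      ((cos (z + a) / sin (z + a) - cos (z + b) / sin (z + b)) *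
        (sin (z + a) / sin (z + b))) z := by
  have h1 := ((hasDerivAt_id z).add_const a).csin
  have h2 := ((hasDerivAt_id z).add_const b).csin
  refine (h1.div h2 hb).congr_deriv ?_
  simp only [id_eq, mul_one]
  field_simp

theorem hasDerivAt_scat {η : ℝ} {z : ℂ} (h1 : sin (z + I * η) ≠ 0) (h2 : sin (z - I * η) ≠ 0) :
    HasDerivAt (scat η) (-(2 * I * Real.pi) * kernelK η z * scat η z) z := by
  have h3 := hasDerivAt_sin_div (a := I * η) (b := -(I * η)) h1 (by rwa [← sub_eq_add_neg])
  simp only [← sub_eq_add_neg] at h3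
  have h4 := two_pi_I_mul_kernelK h1 h2
  refine h3.congr_deriv ?_
  rw [neg_mul, h4, scat]
  ring

theorem hasDerivAt_momentum {η : ℝ} {z : ℂ} (h1 : sin (z + I * η / 2) ≠ 0)
    (h2 : sin (z - I * η / 2) ≠ 0) :
    HasDerivAt (fun z => sin (z - I * η / 2) / sin (z + I * η / 2))
      (I * bareMomentumDeriv η z * (sin (z - I * η / 2) / sin (z + I * η / 2))) z := by
  have h3 := hasDerivAt_sin_div (a := -(I * η / 2)) (b := I * η / 2)
    (by rwa [← sub_eq_add_neg]) h1
  simp only [← sub_eq_add_neg] at h3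
  rwa [I_mul_bareMomentumDeriv h1 h2]

theorem sin_ne_zero_of_re {z : ℂ} (h : z.re = -(Real.pi / 2)) : sin z ≠ 0 := by
  intro h0
  have h1 := sq_norm_sin z
  rw [h0, h, Real.sin_neg, Real.sin_pi_div_two] at h1
  have h2 := sq_nonneg (Real.sinh z.im)
  simp at h1
  linarith

theorem sin_ne_zero_of_im {z : ℂ} (h : z.im ≠ 0) : sin z ≠ 0 :=
  (lt_or_gt_of_ne h).elim sin_ne_zero_of_im_neg sin_ne_zero_of_im_pos

theorem continuous_kernelK_comp {η : ℝ} {u : ℝ → ℂ} (hu : Continuous u)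
    (h1 : ∀ t, sin (u t + I * η) ≠ 0) (h2 : ∀ t, sin (u t - I * η) ≠ 0) :
    Continuous fun t => kernelK η (u t) := by
  unfold kernelK
  refine Continuous.div (by fun_prop) (by fun_prop) fun t => ?_
  exact mul_ne_zero (mul_ne_zero (by simp [Real.pi_ne_zero]) (h1 t)) (h2 t)

theorem continuous_bareMomentumDeriv_comp {η : ℝ} {u : ℝ → ℂ} (hu : Continuous u)
    (h1 : ∀ t, sin (u t + I * η / 2) ≠ 0) (h2 : ∀ t, sin (u t - I * η / 2) ≠ 0) :
    Continuous fun t => bareMomentumDeriv η (u t) := by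
  unfold bareMomentumDeriv
  exact Continuous.div (by fun_prop) (by fun_prop) fun t => mul_ne_zero (h1 t) (h2 t)

theorem exp_neg_barePhase {η : ℝ} {z : ℂ} (hz : |z.im| ≠ |η|) :
    exp (-barePhase η z) = scat η z := by
  have e1 : ∀ t : ℝ, sin (-(Real.pi : ℂ) / 2 + I * t + I * η) ≠ 0 ∧
      sin (-(Real.pi : ℂ) / 2 + I * t - I * η) ≠ 0 := fun t =>
    ⟨sin_ne_zero_of_re (by simp [neg_div]), sin_ne_zero_of_re (by simp [neg_div])⟩
  have e2 : ∀ s : ℝ, sin ((s : ℂ) + I * z.im + I * η) ≠ 0 ∧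
      sin ((s : ℂ) + I * z.im - I * η) ≠ 0 := fun s => by
    constructor <;> refine sin_ne_zero_of_im fun h => hz ?_ <;> simp at h
    · rw [eq_neg_of_add_eq_zero_left h, abs_neg]
    · rw [sub_eq_zero.1 h]
  rw [barePhase, ← neg_mul, ← pathIntegral_const_mul]
  refine exp_pathIntegral (f := fun z => -(2 * I * Real.pi) * kernelK η z)
    (continuous_const.mul (continuous_kernelK_comp (by fun_prop) (fun t => (e1 t).1)
      fun t => (e1 t).2))
    (continuous_const.mul (continuous_kernelK_comp (by fun_prop) (fun t => (e2 t).1)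
      fun t => (e2 t).2))
    (fun t => hasDerivAt_scat (e1 t).1 (e1 t).2) (fun t => hasDerivAt_scat (e2 t).1 (e2 t).2) ?_
  have h1 := (e1 0).2
  simp only [ofReal_zero, mul_zero, add_zero] at h1
  rw [scat, div_eq_one_iff_eq h1, show -(Real.pi : ℂ) / 2 + I * η = -(Real.pi / 2 - I * η) by ring,
    show -(Real.pi : ℂ) / 2 - I * η = -(Real.pi / 2 - -(I * η)) by ring, sin_neg, sin_neg,
    sin_pi_div_two_sub, sin_pi_div_two_sub, cos_neg]

theorem exp_I_mul_bareMomentum {η : ℝ} (hη : η ≠ 0) (x : ℝ) :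
    exp (I * bareMomentum η x) = sin (x - I * η / 2) / sin (x + I * η / 2) := by
  have e1 : ∀ t : ℝ, sin (-(Real.pi : ℂ) / 2 + I * t + I * η / 2) ≠ 0 ∧
      sin (-(Real.pi : ℂ) / 2 + I * t - I * η / 2) ≠ 0 := fun t =>
    ⟨sin_ne_zero_of_re (by simp [neg_div]), sin_ne_zero_of_re (by simp [neg_div])⟩
  have e2 : ∀ s : ℝ, sin ((s : ℂ) + I * (x : ℂ).im + I * η / 2) ≠ 0 ∧
      sin ((s : ℂ) + I * (x : ℂ).im - I * η / 2) ≠ 0 := fun s => by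
    constructor <;> refine sin_ne_zero_of_im ?_ <;> simp [hη]
  rw [bareMomentum, ← pathIntegral_const_mul]
  refine exp_pathIntegral (f := fun z => I * bareMomentumDeriv η z)
    (g := fun z => sin (z - I * η / 2) / sin (z + I * η / 2))
    (continuous_const.mul (continuous_bareMomentumDeriv_comp (by fun_prop) (fun t => (e1 t).1)
      fun t => (e1 t).2))
    (continuous_const.mul (continuous_bareMomentumDeriv_comp (by fun_prop) (fun t => (e2 t).1)
      fun t => (e2 t).2))
    (fun t => hasDerivAt_momentum (e1 t).1 (e1 t).2)
    (fun t => hasDerivAt_momentum (e2 t).1 (e2 t).2) ?_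
  have h1 := (e1 0).1
  simp only [ofReal_zero, mul_zero, add_zero] at h1
  rw [div_eq_one_iff_eq h1,
    show -(Real.pi : ℂ) / 2 + I * η / 2 = -(Real.pi / 2 - I * η / 2) by ring,
    show -(Real.pi : ℂ) / 2 - I * η / 2 = -(Real.pi / 2 - -(I * η / 2)) by ring, sin_neg, sin_neg,
    sin_pi_div_two_sub, sin_pi_div_two_sub, cos_neg]

/-- When x moves along the real line, the vertical segment is unchanged and only the end of the
horizontal one moves. So continuity of f on that horizontal line suffices. -/
theorem hasDerivAt_pathIntegral {f : ℂ → ℂ} {a : ℂ}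
    (hf : Continuous fun s : ℝ => f ((s : ℂ) - I * a.im)) (x : ℝ) :
    HasDerivAt (fun x : ℝ => pathIntegral f (x - a)) (f (x - a)) x := by
  have h1 : HasDerivAt (fun u : ℝ => ∫ s in (-Real.pi / 2)..u, f ((s : ℂ) - I * a.im))
      (f (((x - a.re : ℝ) : ℂ) - I * a.im)) (x - a.re) :=
    intervalIntegral.integral_hasDerivAt_right (hf.intervalIntegrable _ _)
      hf.stronglyMeasurable.stronglyMeasurableAtFilter hf.continuousAt
  have h2 := (h1.comp_sub_const x a.re).const_add
    (∫ t in (0 : ℝ)..(-a.im), f (-(Real.pi : ℂ) / 2 + I * t) * I)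
  have h3 : ((x - a.re : ℝ) : ℂ) - I * a.im = x - a := by
    apply Complex.ext <;> simp
  rw [h3] at h2
  have h4 : (fun x : ℝ => pathIntegral f (x - a)) = fun x : ℝ =>
      (∫ t in (0 : ℝ)..(-a.im), f (-(Real.pi : ℂ) / 2 + I * t) * I) +
        ∫ s in (-Real.pi / 2)..(x - a.re), f ((s : ℂ) - I * a.im) := by
    ext x
    simp only [pathIntegral, sub_im, ofReal_im, zero_sub, sub_re, ofReal_re, ofReal_neg, mul_neg,
      ← sub_eq_add_neg]
  rwa [h4]


/-- The product in the Bethe equations, as a function of the spectral parameter. -/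
noncomputable def betheFun (η α : ℝ) (L : ℕ) {N : ℕ} (μ : Fin N → ℂ) (z : ℂ) : ℂ :=
  -exp (-2 * I * Real.pi * α) * (sin (z - I * η / 2) / sin (z + I * η / 2)) ^ L *
    ∏ k, scat η (z - μ k)

/-- The derivative of the counting function. -/
noncomputable def betheDeriv (η : ℝ) (L : ℕ) {N : ℕ} (μ : Fin N → ℂ) (z : ℂ) : ℂ :=
  bareMomentumDeriv η z / (2 * Real.pi) - 1 / L * ∑ k, kernelK η (z - μ k)

section

variable {η α : ℝ} {L N : ℕ} {μ : Fin N → ℂ}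

theorem exp_countingFunction (hη : 0 < η) (hL : L ≠ 0) (hμ : ∀ k, |(μ k).im| ≠ η) (x : ℝ) :
    exp (2 * I * Real.pi * L * countingFunction η α L μ x) = betheFun η α L μ x := by
  have hL' : (L : ℂ) ≠ 0 := by exact_mod_cast hL
  have hπ : (Real.pi : ℂ) ≠ 0 := by simp [Real.pi_ne_zero]
  have h1 : 2 * I * Real.pi * L * countingFunction η α L μ x =
      (Real.pi * I + -2 * I * Real.pi * α) + L * (I * bareMomentum η x) +
        ∑ k, -barePhase η (x - μ k) := by
    rw [countingFunction, Finset.sum_neg_distrib]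
    field_simp
    ring
  have h2 : ∀ k, exp (-barePhase η (x - μ k)) = scat η (x - μ k) := fun k =>
    exp_neg_barePhase (by
      rw [sub_im, ofReal_im, zero_sub, abs_neg, abs_of_pos hη]
      exact hμ k)
  rw [h1, exp_add, exp_add, exp_add, exp_pi_mul_I, exp_nat_mul, exp_I_mul_bareMomentum hη.ne',
    exp_sum, Finset.prod_congr rfl fun k _ => h2 k, betheFun]
  ring

theorem sin_add_sub_ne_zero (hη : 0 < η) {u : ℂ} (h : |u.im| ≠ η) :
    sin (u + I * η) ≠ 0 ∧ sin (u - I * η) ≠ 0 := by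
  constructor <;> refine sin_ne_zero_of_im fun h0 => h ?_ <;> simp at h0
  · rw [eq_neg_of_add_eq_zero_left h0, abs_neg, abs_of_pos hη]
  · rw [sub_eq_zero.1 h0, abs_of_pos hη]

theorem hasDerivAt_countingFunction (hη : 0 < η) (hL : L ≠ 0) (hμ : ∀ k, |(μ k).im| ≠ η) (x : ℝ) :
    HasDerivAt (fun x : ℝ => countingFunction η α L μ x) (betheDeriv η L μ x) x := by
  have hL' : (L : ℂ) ≠ 0 := by exact_mod_cast hL
  have hπ : (Real.pi : ℂ) ≠ 0 := by simp [Real.pi_ne_zero]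
  have h1 : HasDerivAt (fun x : ℝ => bareMomentum η x) (bareMomentumDeriv η x) x := by
    have := hasDerivAt_pathIntegral (f := bareMomentumDeriv η) (a := 0)
      (continuous_bareMomentumDeriv_comp (by fun_prop)
        (fun t => sin_ne_zero_of_im (by simp [hη.ne']))
        (fun t => sin_ne_zero_of_im (by simp [hη.ne']))) x
    simp only [sub_zero] at this
    exact this
  have h2 : ∀ k, HasDerivAt (fun x : ℝ => barePhase η (x - μ k))
      (2 * I * Real.pi * kernelK η (x - μ k)) x := fun k => by
    have hne : ∀ t : ℝ, sin ((t : ℂ) - I * (μ k).im + I * η) ≠ 0 ∧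
        sin ((t : ℂ) - I * (μ k).im - I * η) ≠ 0 := fun t =>
      sin_add_sub_ne_zero hη (by simpa using hμ k)
    exact (hasDerivAt_pathIntegral (continuous_kernelK_comp (by fun_prop) (fun t => (hne t).1)
      fun t => (hne t).2) x).const_mul _
  have h3 := ((h1.div_const (2 * Real.pi : ℂ)).sub ((HasDerivAt.fun_sum
    fun k (_ : k ∈ Finset.univ) =>
    h2 k).const_mul (1 / (2 * I * Real.pi * L)))).add_const ((1 - 2 * (α : ℂ)) / (2 * L))
  refine h3.congr_deriv ?_
  rw [betheDeriv, ← Finset.mul_sum]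
  field_simp

theorem hasDerivAt_prod_of_log {ι : Type*} (s : Finset ι) {f : ι → ℂ → ℂ} {c : ι → ℂ} {z : ℂ}
    (h : ∀ i ∈ s, HasDerivAt (f i) (c i * f i z) z) :
    HasDerivAt (fun z => ∏ i ∈ s, f i z) ((∑ i ∈ s, c i) * ∏ i ∈ s, f i z) z := by
  classical
  induction s using Finset.induction_on with
  | empty => simpa using hasDerivAt_const z (1 : ℂ)
  | insert i s hi ih =>
    simp only [Finset.prod_insert hi, Finset.sum_insert hi]
    refine ((h i (Finset.mem_insert_self i s)).mul
      (ih fun j hj => h j (Finset.mem_insert_of_mem hj))).congr_deriv ?_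
    ring

theorem hasDerivAt_betheFun (hL : L ≠ 0) {z : ℂ} (h1 : sin (z + I * η / 2) ≠ 0)
    (h2 : sin (z - I * η / 2) ≠ 0) (h3 : ∀ k, sin (z - μ k + I * η) ≠ 0)
    (h4 : ∀ k, sin (z - μ k - I * η) ≠ 0) :
    HasDerivAt (betheFun η α L μ) (2 * I * Real.pi * L * betheDeriv η L μ z * betheFun η α L μ z)
      z := by
  have hL' : (L : ℂ) ≠ 0 := by exact_mod_cast hL
  have hπ : (Real.pi : ℂ) ≠ 0 := by simp [Real.pi_ne_zero]
  have e1 : HasDerivAt (fun z => (sin (z - I * η / 2) / sin (z + I * η / 2)) ^ L)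
      (L * (I * bareMomentumDeriv η z) * (sin (z - I * η / 2) / sin (z + I * η / 2)) ^ L) z := by
    refine ((hasDerivAt_momentum h1 h2).pow L).congr_deriv ?_
    rw [← mul_pow_sub_one hL]
    ring
  have e2 := hasDerivAt_prod_of_log Finset.univ fun k (_ : k ∈ Finset.univ) =>
    HasDerivAt.comp_sub_const z (μ k) (hasDerivAt_scat (h3 k) (h4 k))
  have e3 := (e1.const_mul (-exp (-2 * I * Real.pi * α))).mul e2
  refine e3.congr_deriv ?_
  rw [betheDeriv, ← Finset.mul_sum, betheFun]
  field_simp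
  ring

theorem norm_cot_sub_le {a b : ℂ} {c : ℝ} (hc : 0 < c) (ha : c ≤ ‖sin a‖) (hb : c ≤ ‖sin b‖)
    (hab : ‖b - a‖ ≤ 1) :
    ‖cos a / sin a - cos b / sin b‖ ≤ 2 * ‖b - a‖ / c ^ 2 := by
  rw [cos_div_sin_sub (sin_ne_zero_of_norm hc ha) (sin_ne_zero_of_norm hc hb), norm_div, norm_mul,
    pow_two]
  gcongr
  exact norm_sin_le_two_mul hab

theorem norm_kernelK_sub_le {z h : ℂ} {c : ℝ} (hc : 0 < c) (h1 : c ≤ ‖sin (z + I * η)‖)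
    (h2 : c ≤ ‖sin (z - I * η)‖) (h3 : c ≤ ‖sin (z + h + I * η)‖)
    (h4 : c ≤ ‖sin (z + h - I * η)‖) (hh : ‖h‖ ≤ 1) :
    2 * Real.pi * ‖kernelK η (z + h) - kernelK η z‖ ≤ 4 * ‖h‖ / c ^ 2 := by
  have e : 2 * Real.pi * ‖kernelK η (z + h) - kernelK η z‖ =
      ‖(cos (z + h - I * η) / sin (z + h - I * η) - cos (z - I * η) / sin (z - I * η)) -
        (cos (z + h + I * η) / sin (z + h + I * η) - cos (z + I * η) / sin (z + I * η))‖ := by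
    rw [sub_sub_sub_comm, ← two_pi_I_mul_kernelK (sin_ne_zero_of_norm hc h3)
      (sin_ne_zero_of_norm hc h4), ← two_pi_I_mul_kernelK (sin_ne_zero_of_norm hc h1)
      (sin_ne_zero_of_norm hc h2), ← mul_sub, norm_mul, norm_mul, norm_mul, norm_I,
      Complex.norm_ofNat, norm_real, Real.norm_eq_abs, abs_of_pos Real.pi_pos, mul_one]
  have n1 := norm_cot_sub_le hc h4 h2 (by rwa [show z - I * η - (z + h - I * η) = -h by ring,
    norm_neg])
  have n2 := norm_cot_sub_le hc h3 h1 (by rwa [show z + I * η - (z + h + I * η) = -h by ring,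
    norm_neg])
  rw [show z - I * η - (z + h - I * η) = -h by ring, norm_neg] at n1
  rw [show z + I * η - (z + h + I * η) = -h by ring, norm_neg] at n2
  rw [e]
  refine (norm_sub_le _ _).trans ((add_le_add n1 n2).trans (le_of_eq ?_))
  ring

theorem norm_bareMomentumDeriv_sub_le {z h : ℂ} {c : ℝ} (hc : 0 < c)
    (h1 : c ≤ ‖sin (z + I * η / 2)‖) (h2 : c ≤ ‖sin (z - I * η / 2)‖)
    (h3 : c ≤ ‖sin (z + h + I * η / 2)‖) (h4 : c ≤ ‖sin (z + h - I * η / 2)‖) (hh : ‖h‖ ≤ 1) :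
    ‖bareMomentumDeriv η (z + h) - bareMomentumDeriv η z‖ ≤ 4 * ‖h‖ / c ^ 2 := by
  have e : ‖bareMomentumDeriv η (z + h) - bareMomentumDeriv η z‖ =
      ‖(cos (z + h - I * η / 2) / sin (z + h - I * η / 2) -
          cos (z - I * η / 2) / sin (z - I * η / 2)) -
        (cos (z + h + I * η / 2) / sin (z + h + I * η / 2) -
          cos (z + I * η / 2) / sin (z + I * η / 2))‖ := by
    rw [sub_sub_sub_comm, ← I_mul_bareMomentumDeriv (sin_ne_zero_of_norm hc h3)
      (sin_ne_zero_of_norm hc h4), ← I_mul_bareMomentumDeriv (sin_ne_zero_of_norm hc h1)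
      (sin_ne_zero_of_norm hc h2), ← mul_sub, norm_mul, norm_I, one_mul]
  have n1 := norm_cot_sub_le hc h4 h2 (by
    rwa [show z - I * η / 2 - (z + h - I * η / 2) = -h by ring, norm_neg])
  have n2 := norm_cot_sub_le hc h3 h1 (by
    rwa [show z + I * η / 2 - (z + h + I * η / 2) = -h by ring, norm_neg])
  rw [show z - I * η / 2 - (z + h - I * η / 2) = -h by ring, norm_neg] at n1
  rw [show z + I * η / 2 - (z + h + I * η / 2) = -h by ring, norm_neg] at n2
  rw [e]
  refine (norm_sub_le _ _).trans ((add_le_add n1 n2).trans (le_of_eq ?_))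
  ring

/-- The Lipschitz constant does not depend on L: at most L/2 kernels are summed and the sum is
divided by L. -/
theorem norm_betheDeriv_sub_le {z h : ℂ} {c : ℝ} (hN : 2 * N ≤ L) (hc : 0 < c)
    (h1 : c ≤ ‖sin (z + I * η / 2)‖) (h2 : c ≤ ‖sin (z - I * η / 2)‖)
    (h3 : c ≤ ‖sin (z + h + I * η / 2)‖) (h4 : c ≤ ‖sin (z + h - I * η / 2)‖)
    (h5 : ∀ k, c ≤ ‖sin (z - μ k + I * η)‖) (h6 : ∀ k, c ≤ ‖sin (z - μ k - I * η)‖)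
    (h7 : ∀ k, c ≤ ‖sin (z + h - μ k + I * η)‖) (h8 : ∀ k, c ≤ ‖sin (z + h - μ k - I * η)‖)
    (hh : ‖h‖ ≤ 1) : ‖betheDeriv η L μ (z + h) - betheDeriv η L μ z‖ ≤ ‖h‖ / c ^ 2 := by
  have hπ := Real.pi_gt_three
  have n1 := norm_bareMomentumDeriv_sub_le hc h1 h2 h3 h4 hh
  have n2 : ∀ k, ‖kernelK η (z + h - μ k) - kernelK η (z - μ k)‖ ≤
      4 * ‖h‖ / c ^ 2 / (2 * Real.pi) := fun k => by
    rw [le_div_iff₀ (by positivity), mul_comm, add_sub_right_comm]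
    refine norm_kernelK_sub_le hc (h5 k) (h6 k) ?_ ?_ hh
    · rw [← add_sub_right_comm]; exact h7 k
    · rw [← add_sub_right_comm]; exact h8 k
  have n3 : ‖∑ k, (kernelK η (z + h - μ k) - kernelK η (z - μ k))‖ ≤
      N * (4 * ‖h‖ / c ^ 2 / (2 * Real.pi)) := by
    refine (norm_sum_le _ _).trans ((Finset.sum_le_sum fun k _ => n2 k).trans (le_of_eq ?_))
    simp
  have e : betheDeriv η L μ (z + h) - betheDeriv η L μ z =
      (bareMomentumDeriv η (z + h) - bareMomentumDeriv η z) / (2 * Real.pi) -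
        1 / L * ∑ k, (kernelK η (z + h - μ k) - kernelK η (z - μ k)) := by
    rw [betheDeriv, betheDeriv, Finset.sum_sub_distrib]
    ring
  rw [e]
  refine (norm_sub_le _ _).trans ?_
  rw [norm_div, norm_mul, norm_mul, norm_div, norm_one, Complex.norm_ofNat, norm_real,
    Real.norm_eq_abs, abs_of_pos Real.pi_pos, norm_natCast]
  set T := ‖h‖ / c ^ 2 with hT
  have hT0 : 0 ≤ T := by positivity
  have m1 : ‖bareMomentumDeriv η (z + h) - bareMomentumDeriv η z‖ / (2 * Real.pi) ≤ 2 / 3 * T := by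
    rw [div_le_iff₀ (by positivity)]
    refine n1.trans ?_
    rw [mul_div_assoc, ← hT]
    nlinarith
  have m2 : 1 / (L : ℝ) * ‖∑ k, (kernelK η (z + h - μ k) - kernelK η (z - μ k))‖ ≤ 1 / 3 * T := by
    rcases Nat.eq_zero_or_pos L with hL | hL
    · rw [hL, Nat.cast_zero, div_zero, zero_mul]; positivity
    have hL' : (0 : ℝ) < L := by exact_mod_cast hL
    have hN' : (N : ℝ) ≤ L / 2 := by
      rw [le_div_iff₀ two_pos, mul_comm]; exact_mod_cast hN
    rw [div_mul_eq_mul_div, one_mul, div_le_iff₀ hL']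
    refine n3.trans ?_
    have : 4 * ‖h‖ / c ^ 2 / (2 * Real.pi) ≤ 2 / 3 * T := by
      rw [mul_div_assoc, ← hT, div_le_iff₀ (by positivity)]
      nlinarith
    calc (N : ℝ) * (4 * ‖h‖ / c ^ 2 / (2 * Real.pi)) ≤ (L / 2) * (2 / 3 * T) := by gcongr
      _ = _ := by ring
  linarith

end

theorem hasDerivAt_re {f : ℝ → ℂ} {f' : ℂ} {x : ℝ} (h : HasDerivAt f f' x) :
    HasDerivAt (fun x => (f x).re) f'.re x :=
  reCLM.hasFDerivAt.comp_hasDerivAt x h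

theorem norm_le_of_hasDerivAt_mul {G a : ℝ → ℂ} {T : ℝ} (hT : 0 ≤ T)
    (hG : ∀ t ∈ Set.Icc 0 T, HasDerivAt G (a t * G t) t) (ha : ∀ t ∈ Set.Icc 0 T, (a t).re ≤ 0) :
    ‖G T‖ ≤ ‖G 0‖ := by
  have h1 : ∀ t ∈ Set.Icc 0 T, HasDerivAt (fun t => ‖G t‖ ^ 2) (2 * (a t).re * ‖G t‖ ^ 2) t := by
    intro t ht
    refine (hG t ht).norm_sq.congr_deriv ?_
    rw [Complex.inner, mul_assoc, mul_conj, re_mul_ofReal, normSq_eq_norm_sq]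
    ring
  have h2 : AntitoneOn (fun t => ‖G t‖ ^ 2) (Set.Icc 0 T) := by
    refine antitoneOn_of_deriv_nonpos (convex_Icc 0 T)
      (fun t ht => (h1 t ht).continuousAt.continuousWithinAt)
      (fun t ht => (h1 t (interior_subset ht)).differentiableAt.differentiableWithinAt)
      fun t ht => ?_
    rw [(h1 t (interior_subset ht)).deriv]
    have := ha t (interior_subset ht)
    nlinarith [sq_nonneg ‖G t‖]
  have h3 := h2 ⟨le_rfl, hT⟩ ⟨hT, le_rfl⟩ hT
  exact le_of_sq_le_sq (by simpa using h3) (norm_nonneg _)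


/-! ### The set of roots is closed under conjugation -/

theorem eq_of_exp_two_I_mul_eq {a b : ℂ} (ha : a.re ∈ Set.Ico (-Real.pi / 2) (Real.pi / 2))
    (hb : b.re ∈ Set.Ico (-Real.pi / 2) (Real.pi / 2)) (h : exp (2 * I * a) = exp (2 * I * b)) :
    a = b := by
  obtain ⟨k, hk⟩ := exp_eq_exp_iff_exists_int.1 h
  have h1 : a = b + k * Real.pi := by
    refine mul_left_cancel₀ (mul_ne_zero two_ne_zero I_ne_zero) ?_
    linear_combination hk
  have h2 : a.re = b.re + k * Real.pi := by rw [h1]; simp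
  have hπ := Real.pi_pos
  have h3 : (k : ℝ) < 1 := by
    by_contra! h4
    have := mul_le_mul_of_nonneg_right h4 hπ.le
    linarith [ha.2, hb.1]
  have h4 : (-1 : ℝ) < k := by
    by_contra! h4
    have := mul_le_mul_of_nonneg_right h4 hπ.le
    linarith [ha.1, hb.2]
  have h5 : k = 0 := by
    have : k < 1 := by exact_mod_cast h3
    have : -1 < k := by exact_mod_cast h4
    omega
  simpa [h5] using h1

theorem exists_sub_int_mul_pi_mem (x : ℝ) :
    ∃ k : ℤ, x - k * Real.pi ∈ Set.Ico (-Real.pi / 2) (Real.pi / 2) := by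
  obtain ⟨k, hk, -⟩ := existsUnique_sub_zsmul_mem_Ico Real.pi_pos x (-Real.pi / 2)
  refine ⟨k, ?_⟩
  rw [zsmul_eq_mul] at hk
  exact ⟨hk.1, by linarith [hk.2]⟩

/-- The hypothesis says that the difference of the multiplicities in m and m' is invariant under
multiplication by p². As ‖p‖ > 1, a non-zero difference would persist at infinitely many points. -/
theorem count_eq_of_shift {m m' : Multiset ℂ} {p : ℂ} (hp : 1 < ‖p‖)
    (h : m.map (· * p) + m'.map (· * p⁻¹) = m.map (· * p⁻¹) + m'.map (· * p)) {Z : ℂ}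
    (hZ : Z ≠ 0) : m.count Z = m'.count Z := by
  have hp0 : p ≠ 0 := by rintro rfl; simp at hp; linarith
  have h1 : ∀ (s : Multiset ℂ) (q W : ℂ), q ≠ 0 → (s.map (· * q)).count (W * q) = s.count W :=
    fun s q W hq => Multiset.count_map_eq_count' _ s (mul_left_injective₀ hq) W
  have h2 : ∀ W, (m.count W : ℤ) - m'.count W = m.count (W * p ^ 2) - m'.count (W * p ^ 2) := by
    intro W
    have h3 := congrArg (Multiset.count (W * p)) h
    rw [Multiset.count_add, Multiset.count_add, h1 _ _ _ hp0, h1 _ _ _ hp0,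
      show W * p = W * p ^ 2 * p⁻¹ by field_simp, h1 _ _ _ (inv_ne_zero hp0),
      h1 _ _ _ (inv_ne_zero hp0)] at h3
    omega
  have h3 : ∀ j : ℕ, (m.count Z : ℤ) - m'.count Z =
      m.count (Z * (p ^ 2) ^ j) - m'.count (Z * (p ^ 2) ^ j) := by
    intro j
    induction j with
    | zero => simp
    | succ j ih => rw [ih, h2, pow_succ (p ^ 2) j, mul_assoc]
  by_contra hne
  have h4 : ∀ j : ℕ, Z * (p ^ 2) ^ j ∈ (m + m').toFinset := by
    intro j
    rw [Multiset.mem_toFinset, Multiset.mem_add, ← Multiset.count_pos, ← Multiset.count_pos]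
    have := h3 j
    omega
  refine Set.infinite_of_injective_forall_mem (f := fun j : ℕ => Z * (p ^ 2) ^ j) ?_ h4
    (Finset.finite_toSet _)
  intro i j hij
  have h5 := congrArg norm (mul_left_cancel₀ hZ hij)
  rw [norm_pow, norm_pow _ j] at h5
  refine (pow_right_strictMono₀ ?_).injective h5
  rw [norm_pow]
  exact one_lt_pow₀ hp two_ne_zero

/-- Cleared of denominators, the identity is one between polynomials in exp(2ix), hence between the
multisets of their zeros. These are the roots and their conjugates, shifted by ±iη, so
`count_eq_of_shift` applies with p = exp(2η). -/
theorem exists_conj_of_prod_scat {η : ℝ} {N : ℕ} {μ : Fin N → ℂ} (hη : 0 < η)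
    (hμ : ∀ k, |(μ k).im| ≠ η)
    (hre : ∀ k, (μ k).re ∈ Set.Ico (-Real.pi / 2) (Real.pi / 2))
    (h : ∀ x : ℝ, ∏ k, scat η (x - μ k) = ∏ k, scat η (x - conj (μ k))) (k : Fin N) :
    ∃ l, μ l = conj (μ k) := by
  set e : ℂ → ℂ := fun a => exp (2 * I * a) with he
  set A : Multiset ℂ := Finset.univ.val.map (fun k => e (μ k - I * η)) +
    Finset.univ.val.map (fun k => e (conj (μ k) + I * η)) with hA
  set B : Multiset ℂ := Finset.univ.val.map (fun k => e (μ k + I * η)) +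
    Finset.univ.val.map (fun k => e (conj (μ k) - I * η)) with hB
  have hev : ∀ (s t : Fin N → ℂ) (Z : ℂ), ((Finset.univ.val.map s + Finset.univ.val.map t).map
      fun a => Polynomial.X - Polynomial.C a).prod.eval Z = ∏ k, (Z - s k) * (Z - t k) := by
    intro s t Z
    rw [Polynomial.eval_multiset_prod, Multiset.map_map, Multiset.map_add, Multiset.prod_add,
      Multiset.map_map, Multiset.map_map, Finset.prod_mul_distrib]
    simp [Finset.prod]
  have hAB : (A.map fun a => Polynomial.X - Polynomial.C a).prod =
      (B.map fun a => Polynomial.X - Polynomial.C a).prod := by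
    -- A real interval gives infinitely many points exp(2ix), enough to identify the polynomials.
    have hinj : Set.InjOn (fun x : ℝ => e x) (Set.Ioo 0 1) := by
      intro x hx y hy hxy
      refine ofReal_injective (eq_of_exp_two_I_mul_eq ?_ ?_ hxy)
      · have := Real.pi_gt_three
        exact ⟨by rw [ofReal_re]; linarith [hx.1], by rw [ofReal_re]; linarith [hx.2]⟩
      · have := Real.pi_gt_three
        exact ⟨by rw [ofReal_re]; linarith [hy.1], by rw [ofReal_re]; linarith [hy.2]⟩
    refine Polynomial.eq_of_infinite_eval_eq _ _
      (((Set.Ioo_infinite one_pos).image hinj).mono ?_)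
    rintro _ ⟨x, -, rfl⟩
    rw [Set.mem_ofPred_eq, hA, hB, hev, hev]
    have hne : ∀ k, (sin (x - μ k + I * η) ≠ 0 ∧ sin (x - μ k - I * η) ≠ 0) ∧
        sin (x - conj (μ k) + I * η) ≠ 0 ∧ sin (x - conj (μ k) - I * η) ≠ 0 := fun k =>
      ⟨sin_add_sub_ne_zero hη (by simpa using hμ k), sin_add_sub_ne_zero hη (by simpa using hμ k)⟩
    have h1 := h x
    have hd1 : ∏ k, sin (x - μ k - I * η) ≠ 0 := Finset.prod_ne_zero_iff.2 fun k _ => (hne k).1.2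
    have hd2 : ∏ k, sin (x - conj (μ k) - I * η) ≠ 0 :=
      Finset.prod_ne_zero_iff.2 fun k _ => (hne k).2.2
    simp only [scat, Finset.prod_div_distrib] at h1
    rw [div_eq_div_iff hd1 hd2] at h1
    have h2 : ∀ k, (e x - e (μ k - I * η)) * (e x - e (conj (μ k) + I * η)) =
        ((2 * I) ^ 2 * exp (I * (2 * x + μ k + conj (μ k)))) *
          (sin (x - μ k + I * η) * sin (x - conj (μ k) - I * η)) := fun k => by
      simp only [he]
      rw [exp_sub_exp_eq_sin, exp_sub_exp_eq_sin, show I * (2 * x + μ k + conj (μ k)) =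
        I * (x + (μ k - I * η)) + I * (x + (conj (μ k) + I * η)) by ring, exp_add,
        show (x : ℂ) - (μ k - I * η) = x - μ k + I * η by ring,
        show (x : ℂ) - (conj (μ k) + I * η) = x - conj (μ k) - I * η by ring]
      ring
    have h3 : ∀ k, (e x - e (μ k + I * η)) * (e x - e (conj (μ k) - I * η)) =
        ((2 * I) ^ 2 * exp (I * (2 * x + μ k + conj (μ k)))) *
          (sin (x - μ k - I * η) * sin (x - conj (μ k) + I * η)) := fun k => by
      simp only [he]
      rw [exp_sub_exp_eq_sin, exp_sub_exp_eq_sin, show I * (2 * x + μ k + conj (μ k)) =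
        I * (x + (μ k + I * η)) + I * (x + (conj (μ k) - I * η)) by ring, exp_add,
        show (x : ℂ) - (μ k + I * η) = x - μ k - I * η by ring,
        show (x : ℂ) - (conj (μ k) - I * η) = x - conj (μ k) + I * η by ring]
      ring
    simp only [h2, h3, Finset.prod_mul_distrib]
    rw [h1]
    ring
  have hAB' : A = B := by
    rw [← Polynomial.roots_multiset_prod_X_sub_C A, hAB, Polynomial.roots_multiset_prod_X_sub_C]
  set p : ℂ := exp (2 * η) with hp
  have hpinv : p⁻¹ = exp (-(2 * η)) := by rw [hp, exp_neg]
  have s1 : ∀ a : ℂ, e (a - I * η) = e a * p := fun a => by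
    simp only [he]
    rw [hp, ← exp_add]
    congr 1
    linear_combination (-(2 * η : ℂ)) * I_sq
  have s2 : ∀ a : ℂ, e (a + I * η) = e a * p⁻¹ := fun a => by
    simp only [he]
    rw [hpinv, ← exp_add]
    congr 1
    linear_combination (2 * η : ℂ) * I_sq
  have hcount := count_eq_of_shift (m := Finset.univ.val.map fun k => e (μ k))
    (m' := Finset.univ.val.map fun k => e (conj (μ k))) (p := p) (by
      rw [hp, norm_exp]; simpa using hη) (by
      simp only [Multiset.map_map, Function.comp_def, ← s1, ← s2]
      exact hAB') (Z := e (conj (μ k))) (exp_ne_zero _)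
  have hmem : e (conj (μ k)) ∈ Finset.univ.val.map fun k => e (μ k) := by
    rw [← Multiset.count_pos, hcount, Multiset.count_pos]
    exact Multiset.mem_map_of_mem _ (Finset.mem_univ k)
  obtain ⟨l, -, hl⟩ := Multiset.mem_map.1 hmem
  exact ⟨l, eq_of_exp_two_I_mul_eq (hre l) (by simpa using hre k) hl⟩

section

variable {η α : ℝ} {L N : ℕ} {μ : Fin N → ℂ}

theorem betheFun_add_pi (z : ℂ) : betheFun η α L μ (z + Real.pi) = betheFun η α L μ z := by
  have h1 : ∀ a : ℂ, scat η (z + Real.pi - a) = scat η (z - a) := fun a => by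
    rw [show z + Real.pi - a = z - a + Real.pi by ring, scat_add_pi]
  have h4 : sin (z + Real.pi + I * η / 2) = -sin (z + I * η / 2) := by
    rw [show z + Real.pi + I * η / 2 = z + I * η / 2 + Real.pi by ring, sin_add_pi]
  have h5 : sin (z + Real.pi - I * η / 2) = -sin (z - I * η / 2) := by
    rw [show z + Real.pi - I * η / 2 = z - I * η / 2 + Real.pi by ring, sin_add_pi]
  simp only [betheFun, h1, h4, h5, neg_div_neg_eq]

theorem betheDeriv_add_pi (z : ℂ) : betheDeriv η L μ (z + Real.pi) = betheDeriv η L μ z := by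
  have h4 : sin (z + Real.pi + I * η / 2) = -sin (z + I * η / 2) := by
    rw [show z + Real.pi + I * η / 2 = z + I * η / 2 + Real.pi by ring, sin_add_pi]
  have h5 : sin (z + Real.pi - I * η / 2) = -sin (z - I * η / 2) := by
    rw [show z + Real.pi - I * η / 2 = z - I * η / 2 + Real.pi by ring, sin_add_pi]
  have h1 : ∀ a : ℂ, kernelK η (z + Real.pi - a) = kernelK η (z - a) := fun a => by
    rw [kernelK, kernelK, show z + Real.pi - a + I * η = z - a + I * η + Real.pi by ring,
      show z + Real.pi - a - I * η = z - a - I * η + Real.pi by ring, sin_add_pi, sin_add_pi]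
    ring_nf
  simp only [betheDeriv, bareMomentumDeriv, h1, h4, h5, neg_mul_neg]

theorem betheFun_of_bethe (h : BetheEquations η α L μ) (a : Fin N) :
    betheFun η α L μ (μ a) = 1 := by
  have h1 := h a
  have h2 : exp (-2 * I * Real.pi * α) * exp (2 * I * Real.pi * α) = 1 := by
    rw [← exp_add]; simp
  rw [betheFun, mul_assoc]
  unfold scat
  rw [← h1, neg_mul_neg, h2]

variable {κ ε : ℝ} {n : ℕ} {μ : Fin (L / 2) → ℂ}

theorem AwayFromLines.min_le (hη : 0 < η) (ha : AwayFromLines η ε μ) (k : Fin (L / 2)) :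
    min ε η ≤ |(|(μ k).im| - η)| := by
  by_cases h0 : (μ k).im = 0
  · rw [h0, abs_zero, zero_sub, abs_neg, abs_of_pos hη]
    exact min_le_right _ _
  · exact (min_le_left _ _).trans (ha k h0)

theorem AwayFromLines.ne (hη : 0 < η) (hε : 0 < ε) (ha : AwayFromLines η ε μ) (k : Fin (L / 2)) :
    |(μ k).im| ≠ η := by
  intro h0
  have := ha.min_le hη k
  rw [h0, sub_self, abs_zero] at this
  exact absurd this (lt_min hε hη).not_ge

namespace AdmissibleSolution

variable (h : AdmissibleSolution η α κ n L μ) (ha : AwayFromLines η ε μ) (hη : 0 < η) (hε : 0 < ε)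
  (hL : L ≠ 0)
include h ha hη hε hL

theorem norm_betheFun_ofReal (x : ℝ) : ‖betheFun η α L μ x‖ = 1 := by
  obtain ⟨k, hk⟩ := exists_sub_int_mul_pi_mem x
  have h1 : betheFun η α L μ ((x - k * Real.pi : ℝ) : ℂ) = betheFun η α L μ x := by
    push_cast
    exact (show Function.Periodic (betheFun η α L μ) Real.pi from betheFun_add_pi).sub_int_mul_eq k
  rw [← h1, ← exp_countingFunction hη hL (ha.ne hη hε), norm_exp]
  have h2 := h.counting_real _ (Set.Ico_subset_Icc_self hk)
  rw [show 2 * I * Real.pi * L * countingFunction η α L μ ((x - k * Real.pi : ℝ) : ℂ) =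
    ((2 * Real.pi * L : ℝ) : ℂ) * (I * countingFunction η α L μ ((x - k * Real.pi : ℝ) : ℂ)) by
      push_cast; ring, re_ofReal_mul, I_mul_re, h2]
  simp

/-- Reality of the counting function gives modulus 1 on the axis; the momentum factor and the twist
have modulus 1 as well, so the scattering product has. -/
theorem exists_conj (k : Fin (L / 2)) : ∃ l, μ l = conj (μ k) := by
  refine exists_conj_of_prod_scat hη (ha.ne hη hε) h.reduced (fun x => ?_) k
  have h1 := h.norm_betheFun_ofReal ha hη hε hL x
  have h2 : ‖sin (x - I * η / 2) / sin (x + I * η / 2)‖ = 1 := by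
    rw [norm_div, ← norm_sin_conj, show conj ((x : ℂ) - I * η / 2) = x + I * η / 2 by
      simp [map_ofNat, neg_div, sub_eq_add_neg], div_self]
    exact norm_ne_zero_iff.2 (sin_ne_zero_of_im (by simp [hη.ne']))
  have h3 : ‖exp (-2 * I * Real.pi * α)‖ = 1 := by rw [norm_exp]; simp
  rw [betheFun, norm_mul, norm_mul, norm_neg, h3, norm_pow, h2, one_pow, one_mul, one_mul] at h1
  have h4 : (∏ k, scat η (x - μ k)) * conj (∏ k, scat η (x - μ k)) = 1 := by
    rw [mul_conj, normSq_eq_norm_sq, h1]; simp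
  have h5 : conj (∏ k, scat η (x - μ k)) = (∏ k, scat η (x - conj (μ k)))⁻¹ := by
    rw [map_prod, ← Finset.prod_inv_distrib]
    refine Finset.prod_congr rfl fun k _ => ?_
    rw [conj_scat, map_sub, conj_ofReal]
  rw [h5] at h4
  exact eq_of_mul_inv_eq_one h4

theorem lt_re_betheDeriv (x : ℝ) : κ < (betheDeriv η L μ x).re := by
  obtain ⟨k, hk⟩ := exists_sub_int_mul_pi_mem x
  have h1 : betheDeriv η L μ ((x - k * Real.pi : ℝ) : ℂ) = betheDeriv η L μ x := by
    push_cast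
    exact (show Function.Periodic (betheDeriv η L μ) Real.pi from
      betheDeriv_add_pi).sub_int_mul_eq k
  have h2 := h.counting_deriv _ (Set.Ico_subset_Icc_self hk)
  have h3 := hasDerivAt_re
    (hasDerivAt_countingFunction (α := α) hη hL (ha.ne hη hε) (x - k * Real.pi))
  rwa [h3.deriv, h1] at h2

end AdmissibleSolution

end


/-! ### The winding of the counting function -/

/-- For Im c > 0 the principal logarithm of 1 - exp(2i(x + c)) is smooth and π-periodic in x, so the
increment comes from the linear term alone. -/
theorem exists_cot_primitive {c : ℂ} (hc : 0 < c.im) : ∃ P : ℝ → ℂ,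
    (∀ x : ℝ, HasDerivAt P (cos (x + c) / sin (x + c)) x) ∧
      P (Real.pi / 2) - P (-(Real.pi / 2)) = -(I * Real.pi) := by
  have key : ∀ x : ℝ, ‖exp (2 * I * (x + c))‖ < 1 := fun x => by
    rw [norm_exp_two_I_mul, Real.exp_lt_one_iff]; simp [hc]
  refine ⟨fun x => -(I * x) + log (1 - exp (2 * I * (x + c))), fun x => ?_, ?_⟩
  · have h1 : HasDerivAt (fun x : ℝ => 2 * I * ((x : ℂ) + c)) (2 * I) x := by
      simpa using (((hasDerivAt_id (x : ℂ)).add_const c).const_mul (2 * I)).comp_ofReal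
    have h2 : 1 - exp (2 * I * (x + c)) ∈ slitPlane :=
      mem_slitPlane_of_norm_lt_one (z := -exp (2 * I * (x + c))) (by rw [norm_neg]; exact key x)
    have h3 := (h1.cexp.const_sub 1).clog_real h2
    have h4 : HasDerivAt (fun x : ℝ => -(I * (x : ℂ))) (-I) x :=
      ((hasDerivAt_id (x : ℂ)).const_mul I).comp_ofReal.neg.congr_deriv (by simp)
    refine (h4.add h3).congr_deriv ?_
    have h5 : exp (2 * I * (x + c)) = exp ((x + c) * I) * exp ((x + c) * I) := by
      rw [← exp_add]; ring_nf
    have h6 : exp (-(x + c) * I) = (exp ((x + c) * I))⁻¹ := by rw [← exp_neg]; ring_nf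
    have h7 := slitPlane_ne_zero h2
    rw [Complex.cos, Complex.sin, h6]
    rw [h5] at h7 ⊢
    have h8 : exp ((x + c) * I) ≠ 0 := exp_ne_zero _
    generalize exp ((x + c) * I) = t at h7 h8 ⊢
    have h9 : t⁻¹ - t ≠ 0 := by
      intro h0
      apply h7
      have : t * (t⁻¹ - t) = 1 - t * t := by field_simp
      rw [← this, h0, mul_zero]
    field_simp
    have h10 : (1 - t ^ 2) ≠ 0 := by rwa [pow_two]
    field_simp
    ring_nf
    simp only [I_sq]
    ring
  · have h1 : exp (2 * I * (((Real.pi / 2 : ℝ) : ℂ) + c)) =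
        exp (2 * I * (((-(Real.pi / 2) : ℝ) : ℂ) + c)) := by
      rw [show 2 * I * (((Real.pi / 2 : ℝ) : ℂ) + c) =
        2 * I * (((-(Real.pi / 2) : ℝ) : ℂ) + c) + 2 * Real.pi * I by push_cast; ring, exp_add,
        exp_two_pi_mul_I, mul_one]
    simp only [h1]
    push_cast
    ring

theorem exists_cot_primitive' {c : ℂ} (hc : c.im < 0) : ∃ P : ℝ → ℂ,
    (∀ x : ℝ, HasDerivAt P (cos (x + c) / sin (x + c)) x) ∧
      P (Real.pi / 2) - P (-(Real.pi / 2)) = I * Real.pi := by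
  obtain ⟨P, h1, h2⟩ := exists_cot_primitive (c := -c) (by simpa using hc)
  refine ⟨fun x => P (-x), fun x => ?_, ?_⟩
  · refine ((h1 (-x)).scomp x (hasDerivAt_neg x)).congr_deriv ?_
    rw [show ((-x : ℝ) : ℂ) + -c = -(x + c) by push_cast; ring, cos_neg, sin_neg]
    simp [div_neg]
  · simp only [neg_neg]
    rw [← neg_sub, h2, neg_neg]

/-- The kernel is a difference of cotangents with shifts -a ∓ iη. Their increments add up if these
lie in opposite half planes, that is for |Im a| < η, and cancel otherwise: wide roots do not
contribute to the winding. -/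
theorem exists_kernel_primitive {η : ℝ} (hη : 0 < η) {a : ℂ} (ha : |a.im| ≠ η) : ∃ P : ℝ → ℂ,
    (∀ x : ℝ, HasDerivAt P (kernelK η (x - a)) x) ∧
      P (Real.pi / 2) - P (-(Real.pi / 2)) = if |a.im| < η then 1 else 0 := by
  have hπ : (Real.pi : ℂ) ≠ 0 := by simp [Real.pi_ne_zero]
  have key : ∀ P Q : ℝ → ℂ,
      (∀ x : ℝ, HasDerivAt P (cos (x + (-a - I * η)) / sin (x + (-a - I * η))) x) →
      (∀ x : ℝ, HasDerivAt Q (cos (x + (-a + I * η)) / sin (x + (-a + I * η))) x) →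
      ∀ x : ℝ, HasDerivAt (fun x => (P x - Q x) / (2 * I * Real.pi)) (kernelK η (x - a)) x := by
    intro P Q hP hQ x
    refine (((hP x).sub (hQ x)).div_const (2 * I * Real.pi)).congr_deriv ?_
    have hne := sin_add_sub_ne_zero hη (u := x - a) (by simpa using ha)
    rw [div_eq_iff (by simp [Real.pi_ne_zero]), mul_comm (kernelK η _),
      two_pi_I_mul_kernelK hne.1 hne.2]
    ring_nf
  rcases lt_or_gt_of_ne ha with h | h
  · obtain ⟨h1, h2⟩ := abs_lt.1 h
    obtain ⟨P, hP, hP'⟩ := exists_cot_primitive' (c := -a - I * η) (by simp; linarith)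
    obtain ⟨Q, hQ, hQ'⟩ := exists_cot_primitive (c := -a + I * η) (by simp; linarith)
    refine ⟨_, key P Q hP hQ, ?_⟩
    rw [if_pos h, ← sub_div, sub_sub_sub_comm, hP', hQ',
      div_eq_one_iff_eq (by simp [Real.pi_ne_zero])]
    ring
  · have h0 := h
    rw [lt_abs] at h
    rw [if_neg h0.not_gt]
    rcases h with h | h
    · obtain ⟨P, hP, hP'⟩ := exists_cot_primitive' (c := -a - I * η) (by simp; linarith)
      obtain ⟨Q, hQ, hQ'⟩ := exists_cot_primitive' (c := -a + I * η) (by simp; linarith)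
      refine ⟨_, key P Q hP hQ, ?_⟩
      rw [← sub_div, sub_sub_sub_comm, hP', hQ', sub_self, zero_div]
    · obtain ⟨P, hP, hP'⟩ := exists_cot_primitive (c := -a - I * η) (by simp; linarith)
      obtain ⟨Q, hQ, hQ'⟩ := exists_cot_primitive (c := -a + I * η) (by simp; linarith)
      refine ⟨_, key P Q hP hQ, ?_⟩
      rw [← sub_div, sub_sub_sub_comm, hP', hQ', sub_self, zero_div]

theorem exists_momentum_primitive {η : ℝ} (hη : 0 < η) : ∃ P : ℝ → ℂ,
    (∀ x : ℝ, HasDerivAt P (bareMomentumDeriv η x) x) ∧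
      P (Real.pi / 2) - P (-(Real.pi / 2)) = 2 * Real.pi := by
  obtain ⟨P, hP, hP'⟩ := exists_cot_primitive' (c := -(I * η / 2)) (by simp; linarith)
  obtain ⟨Q, hQ, hQ'⟩ := exists_cot_primitive (c := I * η / 2) (by simp; linarith)
  refine ⟨fun x => (P x - Q x) / I, fun x => ?_, ?_⟩
  · refine (((hP x).sub (hQ x)).div_const I).congr_deriv ?_
    rw [div_eq_iff I_ne_zero, mul_comm (bareMomentumDeriv η _), I_mul_bareMomentumDeriv
      (sin_ne_zero_of_im (by simp [hη.ne'])) (sin_ne_zero_of_im (by simp [hη.ne'])),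
      ← sub_eq_add_neg]
  · rw [← sub_div, sub_sub_sub_comm, hP', hQ', div_eq_iff I_ne_zero]
    ring

theorem sub_eq_of_hasDerivAt {f g f' : ℝ → ℂ} (hf : ∀ x, HasDerivAt f (f' x) x)
    (hg : ∀ x, HasDerivAt g (f' x) x) (a b : ℝ) : f b - f a = g b - g a := by
  have h1 : ∀ x, HasDerivAt (fun x => f x - g x) 0 x := fun x =>
    ((hf x).sub (hg x)).congr_deriv (sub_self _)
  have := is_const_of_deriv_eq_zero (fun x => (h1 x).differentiableAt) (fun x => (h1 x).deriv) b a
  linear_combination this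

theorem countingFunction_sub {η α : ℝ} {L N : ℕ} {μ : Fin N → ℂ} (hη : 0 < η) (hL : L ≠ 0)
    (hμ : ∀ k, |(μ k).im| ≠ η) : countingFunction η α L μ ((Real.pi / 2 : ℝ) : ℂ) -
      countingFunction η α L μ ((-(Real.pi / 2) : ℝ) : ℂ) =
      1 - 1 / L * ∑ k, if |(μ k).im| < η then (1 : ℂ) else 0 := by
  obtain ⟨P, hP, hP'⟩ := exists_momentum_primitive hη
  choose Q hQ hQ' using fun k => exists_kernel_primitive hη (hμ k)
  have hπ : (Real.pi : ℂ) ≠ 0 := by simp [Real.pi_ne_zero]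
  have h1 := sub_eq_of_hasDerivAt (g := fun x => P x / (2 * Real.pi) - 1 / L * ∑ k, Q k x)
    (hasDerivAt_countingFunction (α := α) hη hL hμ) (fun x =>
      ((hP x).div_const _).sub ((HasDerivAt.fun_sum fun k _ => hQ k x).const_mul _))
      (-(Real.pi / 2)) (Real.pi / 2)
  rw [h1, ← Finset.sum_congr rfl fun k _ => hQ' k, Finset.sum_sub_distrib]
  have h2 : (P (Real.pi / 2) - P (-(Real.pi / 2))) / (2 * Real.pi) = 1 := by
    rw [hP', div_self (by simp [Real.pi_ne_zero])]
  linear_combination h2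

/-! ### Integer values of a monotone function -/

theorem ncard_int_values {G : ℝ → ℝ} {a b : ℝ} {M : ℕ} (hab : a ≤ b)
    (hG : ContinuousOn G (Set.Icc a b)) (hm : StrictMonoOn G (Set.Icc a b)) (hM : G b = G a + M) :
    {x | x ∈ Set.Ico a b ∧ ∃ m : ℤ, G x = m}.ncard = M := by
  set S := {x | x ∈ Set.Ico a b ∧ ∃ m : ℤ, G x = m} with hS
  have hinj : Set.InjOn G S := hm.injOn.mono fun x hx => Set.Ico_subset_Icc_self hx.1
  -- The half-open interval on both sides makes the count exactly M, also when G a is an integer.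
  have himg : G '' S = (fun m : ℤ => (m : ℝ)) '' (Finset.Ico ⌈G a⌉ ⌈G b⌉ : Finset ℤ) := by
    ext t
    constructor
    · rintro ⟨x, ⟨hx, m, hm'⟩, rfl⟩
      refine ⟨m, ?_, hm'.symm⟩
      rw [Finset.coe_Ico, Set.mem_Ico, Int.ceil_le, Int.lt_ceil, ← hm']
      exact ⟨hm.monotoneOn ⟨le_rfl, hab⟩ (Set.Ico_subset_Icc_self hx) hx.1,
        hm (Set.Ico_subset_Icc_self hx) ⟨hab, le_rfl⟩ hx.2⟩
    · rintro ⟨m, hmem, rfl⟩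
      rw [Finset.coe_Ico, Set.mem_Ico, Int.ceil_le, Int.lt_ceil] at hmem
      obtain ⟨x, hx, hxm⟩ := intermediate_value_Icc hab hG ⟨hmem.1, hmem.2.le⟩
      refine ⟨x, ⟨⟨hx.1, lt_of_le_of_ne hx.2 ?_⟩, m, hxm⟩, hxm⟩
      rintro rfl
      exact hmem.2.ne hxm.symm
  rw [← hinj.ncard_image, himg, Set.ncard_image_of_injective _ Int.cast_injective,
    Set.ncard_coe_finset, Int.card_Ico, hM, Int.ceil_add_natCast]
  simp

theorem exists_int_value {G : ℝ → ℝ} {a b : ℝ} (hab : a ≤ b) (hG : ContinuousOn G (Set.Icc a b))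
    (h : G a + 1 ≤ G b) : ∃ x ∈ Set.Ico a b, ∃ m : ℤ, G x = m := by
  have h1 := Int.le_ceil (G a)
  have h2 := Int.ceil_lt_add_one (G a)
  obtain ⟨x, hx, hxm⟩ := intermediate_value_Icc hab hG ⟨h1, by linarith⟩
  refine ⟨x, ⟨hx.1, lt_of_le_of_ne hx.2 ?_⟩, _, hxm⟩
  rintro rfl
  linarith

namespace AdmissibleSolution

variable {η α κ ε : ℝ} {n L : ℕ} {μ : Fin (L / 2) → ℂ}
  (h : AdmissibleSolution η α κ n L μ) (ha : AwayFromLines η ε μ) (hη : 0 < η) (hε : 0 < ε)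
  (hL : L ≠ 0)

include ha hη hε hL in
theorem mem_realSolutions_iff (x : ℝ) : x ∈ realSolutions η α L μ ↔
    x ∈ Set.Ico (-Real.pi / 2) (Real.pi / 2) ∧ betheFun η α L μ x = 1 := by
  rw [realSolutions, Set.mem_ofPred_eq, exp_countingFunction hη hL (ha.ne hη hε)]

include h in
theorem exp_counting_eq_one_iff {x : ℝ} (hx : x ∈ Set.Icc (-Real.pi / 2) (Real.pi / 2)) :
    exp (2 * I * Real.pi * L * countingFunction η α L μ x) = 1 ↔
      ∃ m : ℤ, L * (countingFunction η α L μ x).re = m := by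
  have h1 : countingFunction η α L μ x = ((countingFunction η α L μ x).re : ℂ) :=
    Complex.ext rfl (by rw [ofReal_im, h.counting_real x hx])
  rw [h1, Complex.exp_eq_one_iff, ofReal_re]
  refine exists_congr fun m => ?_
  rw [← ofReal_inj, ofReal_mul, ofReal_natCast, ofReal_intCast]
  constructor
  · intro h2
    refine mul_left_cancel₀ (a := 2 * Real.pi * I) (by simp [Real.pi_ne_zero]) ?_
    linear_combination h2
  · intro h2
    linear_combination (2 * Real.pi * I) * h2

include ha hη hε hL in
theorem hasDerivAt_re_counting (x : ℝ) :
    HasDerivAt (fun x : ℝ => L * (countingFunction η α L μ x).re)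
      (L * (betheDeriv η L μ x).re) x :=
  (hasDerivAt_re (hasDerivAt_countingFunction hη hL (ha.ne hη hε) x)).const_mul _

include h ha hη hε hL

/-- L times the increment of the counting function is L minus the number of roots with |Im| < η,
hence L/2 + m, where m is the number of the others. -/
theorem ncard_realSolutions {m : ℕ}
    (hm : (Finset.univ.filter fun k => |(μ k).im| < η).card + m = L / 2) :
    (realSolutions η α L μ).ncard = L / 2 + m := by
  have hπ := Real.pi_pos
  have hL' : (0 : ℝ) < L := by exact_mod_cast Nat.pos_of_ne_zero hL
  have h1 : realSolutions η α L μ = {x | x ∈ Set.Ico (-Real.pi / 2) (Real.pi / 2) ∧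
      ∃ m : ℤ, L * (countingFunction η α L μ x).re = m} := by
    ext x
    refine and_congr_right fun hx => ?_
    exact h.exp_counting_eq_one_iff (Set.Ico_subset_Icc_self hx)
  rw [h1]
  refine ncard_int_values (by linarith)
    (fun x _ => (hasDerivAt_re_counting ha hη hε hL x).continuousAt.continuousWithinAt)
    (fun x hx y hy hxy => mul_lt_mul_of_pos_left (h.counting_strictMono hx hy hxy) hL') ?_
  have h2 := congrArg re (countingFunction_sub (α := α) hη hL (ha.ne hη hε))
  rw [Finset.sum_boole, sub_re, neg_div'] at h2
  obtain ⟨l, hl⟩ := h.even_length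
  have h3 : (L : ℝ) = 2 * (L / 2 : ℕ) := by
    have : L = 2 * (L / 2) := by omega
    exact_mod_cast this
  have h4 : ((Finset.univ.filter fun k => |(μ k).im| < η).card : ℝ) + m = (L / 2 : ℕ) := by
    exact_mod_cast hm
  have h5 : (1 - 1 / (L : ℂ) * ((Finset.univ.filter fun k => |(μ k).im| < η).card : ℂ)).re =
      1 - 1 / (L : ℝ) * (Finset.univ.filter fun k => |(μ k).im| < η).card := by
    rw [← ofReal_natCast, ← ofReal_natCast, ← ofReal_one, ← ofReal_div, ← ofReal_mul, ← ofReal_sub,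
      ofReal_re]
  rw [h5] at h2
  have h6 : (L : ℝ) * (1 - 1 / (L : ℝ) * (Finset.univ.filter fun k => |(μ k).im| < η).card) =
      L - (Finset.univ.filter fun k => |(μ k).im| < η).card := by
    field_simp
  rw [← h2] at h6
  rw [Nat.cast_add]
  linarith

/-- On an interval of length 1/(κL) the function L ξ grows by at least 1, so it takes an integer
value. -/
theorem exists_realSolution_near (hκ : 0 < κ) (hLκ : 1 / (κ * L) ≤ Real.pi / 2) {x : ℝ}
    (hx : x ∈ Set.Icc (-Real.pi / 2) (Real.pi / 2)) :
    ∃ ν ∈ realSolutions η α L μ, |x - ν| ≤ 1 / (κ * L) := by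
  have hπ := Real.pi_pos
  have hL' : (0 : ℝ) < L := by exact_mod_cast Nat.pos_of_ne_zero hL
  set s := 1 / (κ * L) with hs
  have hs0 : 0 < s := by positivity
  set G := fun x : ℝ => L * (countingFunction η α L μ x).re with hG
  have hd := hasDerivAt_re_counting (α := α) ha hη hε hL
  have hgrow : ∀ u, G u + 1 ≤ G (u + s) := by
    intro u
    have := mul_sub_le_image_sub_of_le_deriv (f := G) (C := L * κ)
      (fun x => (hd x).differentiableAt) (fun x => by
        rw [(hd x).deriv]
        gcongr
        exact (h.lt_re_betheDeriv ha hη hε hL x).le) (x := u) (y := u + s) (by linarith)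
    rw [add_sub_cancel_left, show L * κ * s = 1 by rw [hs]; field_simp] at this
    linarith
  have key : ∀ u, -Real.pi / 2 ≤ u → u + s ≤ Real.pi / 2 →
      ∃ ν ∈ realSolutions η α L μ, ν ∈ Set.Ico u (u + s) := by
    intro u hu hu'
    obtain ⟨ν, hν, hm⟩ := exists_int_value (G := G) (by linarith : u ≤ u + s)
      (fun x _ => (hd x).continuousAt.continuousWithinAt) (hgrow u)
    have hν' : ν ∈ Set.Ico (-Real.pi / 2) (Real.pi / 2) :=
      ⟨hu.trans hν.1, hν.2.trans_le hu'⟩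
    exact ⟨ν, ⟨hν', (h.exp_counting_eq_one_iff (Set.Ico_subset_Icc_self hν')).2 hm⟩, hν⟩
  -- Near the right end the interval is placed to the left of x; `hLκ` leaves room for it.
  by_cases hxs : x + s ≤ Real.pi / 2
  · obtain ⟨ν, hν, hν'⟩ := key x hx.1 hxs
    exact ⟨ν, hν, abs_le.2 ⟨by linarith [hν'.2], by linarith [hν'.1]⟩⟩
  · obtain ⟨ν, hν, hν'⟩ := key (x - s) (by linarith) (by linarith [hx.2])
    rw [sub_add_cancel] at hν'
    exact ⟨ν, hν, abs_le.2 ⟨by linarith [hν'.2], by linarith [hν'.1]⟩⟩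

/-! ### Decay off the real axis -/

omit h hε hL in
theorem le_norm_sin {c : ℝ} (hc : 4 * c ≤ min ε η) {z : ℂ} (hz : |z.im| ≤ c) :
    (c ≤ ‖sin (z + I * η / 2)‖ ∧ c ≤ ‖sin (z - I * η / 2)‖) ∧
      ∀ k, c ≤ ‖sin (z - μ k + I * η)‖ ∧ c ≤ ‖sin (z - μ k - I * η)‖ := by
  have hcη : 4 * c ≤ η := hc.trans (min_le_right _ _)
  obtain ⟨h1, h2⟩ := abs_le.1 hz
  refine ⟨⟨le_norm_sin_of_le_im ?_, le_norm_sin_of_im_le ?_⟩, fun k => ?_⟩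
  · simp; linarith
  · simp; linarith
  have h3 := hc.trans (ha.min_le hη k)
  constructor
  · refine le_trans ?_ (abs_im_le_norm_sin _)
    have h4 : |(|(μ k).im| - η)| ≤ |(-(μ k).im + η)| := by
      have := abs_abs_sub_abs_le (μ k).im η
      rw [abs_of_pos hη] at this
      rwa [neg_add_eq_sub, abs_sub_comm η]
    have h5 : (z - μ k + I * η).im = z.im + (-(μ k).im + η) := by simp; ring
    rw [h5]
    have h6 := abs_sub_abs_le_abs_sub (-(μ k).im + η) (-z.im)
    rw [abs_neg, sub_neg_eq_add, add_comm _ z.im] at h6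
    linarith
  · refine le_trans ?_ (abs_im_le_norm_sin _)
    have h4 : |(|(μ k).im| - η)| ≤ |(-(μ k).im - η)| := by
      have := abs_abs_sub_abs_le (-(μ k).im) η
      rwa [abs_of_pos hη, abs_neg] at this
    have h5 : (z - μ k - I * η).im = z.im + (-(μ k).im - η) := by simp; ring
    rw [h5]
    have h6 := abs_sub_abs_le_abs_sub (-(μ k).im - η) (-z.im)
    rw [abs_neg, sub_neg_eq_add, add_comm _ z.im] at h6
    linarith

omit h hε in
theorem hasDerivAt_betheFun {c : ℝ} (hc0 : 0 < c) (hc : 4 * c ≤ min ε η) {z : ℂ}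
    (hz : |z.im| ≤ c) : HasDerivAt (betheFun η α L μ)
      (2 * I * Real.pi * L * betheDeriv η L μ z * betheFun η α L μ z) z := by
  obtain ⟨⟨h1, h2⟩, h3⟩ := le_norm_sin ha hη hc hz
  exact XXZ.hasDerivAt_betheFun hL (sin_ne_zero_of_norm hc0 h1) (sin_ne_zero_of_norm hc0 h2)
    (fun k => sin_ne_zero_of_norm hc0 (h3 k).1) fun k => sin_ne_zero_of_norm hc0 (h3 k).2

/-- The derivative of log|phi(x + it)| in t is -2πL Re ξ'(x + it). On the axis Re ξ' > κ, and the
uniform Lipschitz bound keeps it above κ/2 up to height r. On the axis the modulus is 1. -/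
theorem norm_betheFun_le {c r : ℝ} (hc0 : 0 < c) (hc : 4 * c ≤ min ε η) (hrc : r ≤ c) (hr1 : r ≤ 1)
    (hrκ : r / c ^ 2 ≤ κ / 2) {z : ℂ} (hz0 : 0 ≤ z.im) (hz : z.im ≤ r) :
    ‖betheFun η α L μ z‖ ≤ Real.exp (-(Real.pi * L * κ * z.im)) := by
  set x := z.re with hx
  have hπ := Real.pi_pos
  have hL' : (0 : ℝ) < L := by exact_mod_cast Nat.pos_of_ne_zero hL
  have him : ∀ t : ℝ, ((x : ℂ) + I * t).im = t := fun t => by simp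
  have hN : 2 * (L / 2) ≤ L := Nat.mul_div_le L 2
  have key := norm_le_of_hasDerivAt_mul (T := z.im)
    (G := fun t : ℝ => betheFun η α L μ (x + I * t) * exp ((Real.pi * L * κ : ℝ) * t))
    (a := fun t : ℝ => 2 * I * Real.pi * L * betheDeriv η L μ (x + I * t) * I +
      (Real.pi * L * κ : ℝ)) hz0 (fun t ht => by
      have h5 : HasDerivAt (fun t : ℝ => (x : ℂ) + I * t) I t := by
        simpa using ((hasDerivAt_id (t : ℂ)).const_mul I).const_add (x : ℂ) |>.comp_ofReal
      have h6 := (hasDerivAt_betheFun (α := α) ha hη hL hc0 hc (z := x + I * t) (by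
        rw [him, abs_of_nonneg ht.1]; linarith [ht.2])).comp t h5
      have h7 : HasDerivAt (fun t : ℝ => exp ((Real.pi * L * κ : ℝ) * t))
          (exp ((Real.pi * L * κ : ℝ) * t) * (Real.pi * L * κ : ℝ)) t := by
        have := ((hasDerivAt_id (t : ℂ)).const_mul ((Real.pi * L * κ : ℝ) : ℂ)).cexp.comp_ofReal
        simpa using this
      refine (h6.mul h7).congr_deriv ?_
      simp only [Function.comp_apply]
      ring) (fun t ht => by
      have ht1 : |t| ≤ c := by rw [abs_of_nonneg ht.1]; linarith [ht.2]
      obtain ⟨⟨a1, a2⟩, a3⟩ := le_norm_sin ha hη hc (z := x) (by simpa using hc0.le)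
      obtain ⟨⟨b1, b2⟩, b3⟩ := le_norm_sin ha hη hc (z := x + I * t) (by rwa [him])
      have hIt : ‖I * (t : ℂ)‖ = t := by
        rw [norm_mul, norm_I, norm_real, Real.norm_eq_abs, abs_of_nonneg ht.1, one_mul]
      have h8 := norm_betheDeriv_sub_le (h := I * t) hN hc0 a1 a2 b1 b2 (fun k => (a3 k).1)
        (fun k => (a3 k).2) (fun k => (b3 k).1) (fun k => (b3 k).2)
        (by rw [hIt]; linarith [ht.2])
      rw [hIt] at h8
      have h9 := (abs_le.1 (abs_re_le_norm
        (betheDeriv η L μ (x + I * t) - betheDeriv η L μ x))).1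
      rw [sub_re] at h9
      have h10 := h.lt_re_betheDeriv ha hη hε hL x
      have h11 : t / c ^ 2 ≤ r / c ^ 2 := by gcongr; linarith [ht.2]
      have h12 : κ / 2 ≤ (betheDeriv η L μ (x + I * t)).re := by linarith
      rw [show 2 * I * Real.pi * L * betheDeriv η L μ (x + I * t) * I + ((Real.pi * L * κ : ℝ) : ℂ)
        = ((2 * Real.pi * L : ℝ) : ℂ) * -betheDeriv η L μ (x + I * t) +
          ((Real.pi * L * κ : ℝ) : ℂ) by
          push_cast
          linear_combination (2 * Real.pi * L * betheDeriv η L μ (x + I * t)) * I_sq,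
        add_re, re_ofReal_mul, ofReal_re, neg_re]
      have := mul_le_mul_of_nonneg_left h12 (by positivity : 0 ≤ 2 * Real.pi * L)
      linarith)
  have hz' : (x : ℂ) + I * z.im = z := by rw [mul_comm, hx, re_add_im]
  simp only [hz', ofReal_zero, mul_zero, add_zero, exp_zero, mul_one] at key
  rw [h.norm_betheFun_ofReal ha hη hε hL, norm_mul, norm_exp, ← ofReal_mul, ofReal_re] at key
  rw [Real.exp_neg, ← one_div, le_div_iff₀ (Real.exp_pos _)]
  exact key

end AdmissibleSolution


/-! ### Enumerations of roots and holes, and their properties -/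

theorem exists_enumeration {X : Type*} {S : Set X} (hS : S.Finite) {k : ℕ} (hk : S.ncard = k) :
    ∃ f : Fin k → X, Function.Injective f ∧ Set.range f = S := by
  have : Finite S := hS
  have e : Fin k ≃ S := (finCongr hk.symm).trans (Finite.equivFin S).symm
  exact ⟨fun i => e i, Subtype.val_injective.comp e.injective, by
    rw [show (fun i => (e i : X)) = Subtype.val ∘ e from rfl, Set.range_comp, e.range_eq_univ,
      Set.image_univ, Subtype.range_coe]⟩

theorem injective_of_ncard_range {ι X : Type*} [Fintype ι] {g : ι → X}
    (h : (Set.range g).ncard = Fintype.card ι) : Function.Injective g := by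
  classical
  rw [← Set.image_univ, ← Finset.coe_univ, ← Finset.coe_image, Set.ncard_coe_finset] at h
  have := Finset.card_image_iff.1 (h.trans Finset.card_univ.symm)
  rwa [Finset.coe_univ, Set.injOn_univ] at this

theorem ncard_range_of_injective {ι X : Type*} [Fintype ι] {g : ι → X}
    (h : Function.Injective g) : (Set.range g).ncard = Fintype.card ι := by
  rw [← Set.image_univ, Set.ncard_image_of_injective _ h, Set.ncard_univ, Nat.card_eq_fintype_card]

theorem exists_equiv_of_range_eq {ι κ X : Type*} {g : ι → X} {f : κ → X}
    (hg : Function.Injective g) (hf : Function.Injective f) (h : Set.range g = Set.range f) :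
    ∃ e : ι ≃ κ, ∀ i, f (e i) = g i := by
  refine ⟨(Equiv.ofInjective g hg).trans ((Equiv.setCongr h).trans (Equiv.ofInjective f hf).symm),
    fun i => ?_⟩
  simp [Equiv.apply_ofInjective_symm]

/-- The roots `y`, `w` and their conjugates. -/
noncomputable def withConj {mw mc : ℕ} (y : Fin mw → ℂ) (w : Fin mc → ℂ) :
    (Fin mw ⊕ Fin mw) ⊕ (Fin mc ⊕ Fin mc) → ℂ :=
  Sum.elim (Sum.elim y fun b => conj (y b)) (Sum.elim w fun b => conj (w b))

theorem withConj_injective {η : ℝ} {mw mc : ℕ} {y : Fin mw → ℂ} {w : Fin mc → ℂ}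
    (hy : Function.Injective y) (hw : Function.Injective w) (hη : 0 < η) (hy' : ∀ b, η < (y b).im)
    (hw' : ∀ b, 0 < (w b).im ∧ (w b).im < η) : Function.Injective (withConj y w) := by
  have hc : Function.Injective (conj : ℂ → ℂ) := (starRingEnd ℂ).injective
  refine (hy.sumElim (hc.comp hy) fun a b hab => ?_).sumElim
    (hw.sumElim (hc.comp hw) fun a b hab => ?_) ?_
  · have := congrArg im hab
    simp only [Function.comp_apply, conj_im] at this
    linarith [hy' a, hy' b]
  · have := congrArg im hab
    simp only [conj_im] at this
    linarith [(hw' a).1, (hw' b).1]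
  · rintro (a | a) (b | b) hab
    all_goals
      have h1 := congrArg im hab
      have h2 := hy' a
      obtain ⟨h3, h4⟩ := hw' b
      simp only [Sum.elim_inl, Sum.elim_inr, Function.comp_apply, conj_im] at h1
      linarith

/-- The root data list the real roots, the holes and the non-real roots of the upper half plane of
a solution of the Bethe equations. -/
structure Enumerates (η α : ℝ) (L : ℕ) {N : ℕ} (μ : Fin N → ℂ) (D : RootData) : Prop where
  x_injective : Function.Injective D.x
  x_range : Set.range D.x = {x : ℝ | (x : ℂ) ∈ Set.range μ}
  ν_range : Set.range D.ν = holeSet η α L μ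
  y_injective : Function.Injective D.y
  y_range : Set.range D.y = {z | z ∈ Set.range μ ∧ η < z.im}
  w_injective : Function.Injective D.w
  w_range : Set.range D.w = {z | z ∈ Set.range μ ∧ 0 < z.im ∧ z.im < η}
  holes : D.nh = 2 * D.mc + 4 * D.mw

theorem range_withConj {η : ℝ} {N mw mc : ℕ} {μ : Fin N → ℂ} {y : Fin mw → ℂ} {w : Fin mc → ℂ}
    (hη : 0 < η) (hμ : ∀ k, |(μ k).im| ≠ η) (hconj : ∀ k, ∃ l, μ l = conj (μ k))
    (hy : Set.range y = {z | z ∈ Set.range μ ∧ η < z.im})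
    (hw : Set.range w = {z | z ∈ Set.range μ ∧ 0 < z.im ∧ z.im < η}) :
    Set.range (withConj y w) = {z | z ∈ Set.range μ ∧ z.im ≠ 0} := by
  have hy1 : ∀ b, y b ∈ Set.range μ ∧ η < (y b).im := fun b => hy.le ⟨b, rfl⟩
  have hw1 : ∀ b, w b ∈ Set.range μ ∧ 0 < (w b).im ∧ (w b).im < η := fun b => hw.le ⟨b, rfl⟩
  have hc : ∀ z ∈ Set.range μ, conj z ∈ Set.range μ := by
    rintro _ ⟨k, rfl⟩
    exact hconj k
  ext z
  constructor
  · rintro ⟨((b | b) | (b | b)), rfl⟩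
    · exact ⟨(hy1 b).1, (hη.trans (hy1 b).2).ne'⟩
    · exact ⟨hc _ (hy1 b).1, by
        simp only [withConj, Sum.elim_inl, Sum.elim_inr, conj_im, neg_ne_zero]
        exact (hη.trans (hy1 b).2).ne'⟩
    · exact ⟨(hw1 b).1, (hw1 b).2.1.ne'⟩
    · exact ⟨hc _ (hw1 b).1, by
        simp only [withConj, Sum.elim_inr, conj_im, neg_ne_zero]
        exact (hw1 b).2.1.ne'⟩
  · rintro ⟨hz, hz0⟩
    have hne : |z.im| ≠ η := by obtain ⟨k, rfl⟩ := hz; exact hμ k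
    rcases lt_or_gt_of_ne hz0 with h0 | h0
    · rw [abs_of_neg h0] at hne
      rcases lt_or_gt_of_ne hne with h1 | h1
      · obtain ⟨b, hb⟩ := hw.ge ⟨hc z hz, by rw [conj_im]; linarith, by rwa [conj_im]⟩
        exact ⟨Sum.inr (Sum.inr b), by simp [withConj, hb]⟩
      · obtain ⟨b, hb⟩ := hy.ge ⟨hc z hz, by rwa [conj_im]⟩
        exact ⟨Sum.inl (Sum.inr b), by simp [withConj, hb]⟩
    · rw [abs_of_pos h0] at hne
      rcases lt_or_gt_of_ne hne with h1 | h1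
      · obtain ⟨b, hb⟩ := hw.ge ⟨hz, h0, h1⟩
        exact ⟨Sum.inr (Sum.inl b), by simp [withConj, hb]⟩
      · obtain ⟨b, hb⟩ := hy.ge ⟨hz, h1⟩
        exact ⟨Sum.inl (Sum.inl b), by simp [withConj, hb]⟩

theorem exists_equiv_roots {η : ℝ} {N nr mw mc : ℕ} {μ : Fin N → ℂ} {x : Fin nr → ℝ}
    {y : Fin mw → ℂ} {w : Fin mc → ℂ}
    (hη : 0 < η) (hμi : Function.Injective μ) (hμ : ∀ k, |(μ k).im| ≠ η)
    (hconj : ∀ k, ∃ l, μ l = conj (μ k))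
    (hx' : Function.Injective x) (hx : Set.range x = {x : ℝ | (x : ℂ) ∈ Set.range μ})
    (hy' : Function.Injective y) (hy : Set.range y = {z | z ∈ Set.range μ ∧ η < z.im})
    (hw' : Function.Injective w)
    (hw : Set.range w = {z | z ∈ Set.range μ ∧ 0 < z.im ∧ z.im < η}) :
    ∃ e : (Fin nr ⊕ ((Fin mw ⊕ Fin mw) ⊕ (Fin mc ⊕ Fin mc))) ≃ Fin N,
      ∀ i, μ (e i) = Sum.elim (fun j => (x j : ℂ)) (withConj y w) i := by
  have hr := range_withConj hη hμ hconj hy hw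
  refine exists_equiv_of_range_eq (Function.Injective.sumElim (ofReal_injective.comp hx')
    (withConj_injective hy' hw' hη (fun b => (hy.le ⟨b, rfl⟩).2) fun b => (hw.le ⟨b, rfl⟩).2)
    fun j b hjb => ?_) hμi ?_
  · have h1 : (withConj y w b).im ≠ 0 := (hr.le ⟨b, rfl⟩).2
    rw [← hjb] at h1
    exact h1 (ofReal_im _)
  · rw [Set.Sum.elim_range, hr]
    ext z
    constructor
    · rintro (⟨j, rfl⟩ | hz)
      · exact hx.le ⟨j, rfl⟩
      · exact hz.1
    · intro hz
      by_cases h0 : z.im = 0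
      · left
        have h1 : ((z.re : ℝ) : ℂ) = z := Complex.ext rfl (by rw [ofReal_im, h0])
        obtain ⟨j, hj⟩ := hx.ge (show z.re ∈ {x : ℝ | (x : ℂ) ∈ Set.range μ} by
          rw [Set.mem_ofPred_eq, h1]; exact hz)
        exact ⟨j, by simp only [hj, h1]⟩
      · exact Or.inr ⟨hz, h0⟩

namespace AdmissibleSolution

variable {η α κ ε : ℝ} {n L : ℕ} {μ : Fin (L / 2) → ℂ}
  (h : AdmissibleSolution η α κ n L μ) (ha : AwayFromLines η ε μ) (hη : 0 < η) (hε : 0 < ε)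
  (hL : L ≠ 0)
include h ha hη hε hL

theorem ncard_nonreal {mw mc : ℕ} {y : Fin mw → ℂ} {w : Fin mc → ℂ}
    (hy : Set.range y = {z | z ∈ Set.range μ ∧ η < z.im})
    (hw : Set.range w = {z | z ∈ Set.range μ ∧ 0 < z.im ∧ z.im < η}) :
    (Set.range (withConj y w)).ncard = n := by
  rw [range_withConj hη (ha.ne hη hε) (h.exists_conj ha hη hε hL) hy hw, ← h.complex_count,
    ← Set.ncard_image_of_injective _ h.distinct]
  congr 1
  ext z
  constructor
  · rintro ⟨⟨k, rfl⟩, hk⟩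
    exact ⟨k, hk, rfl⟩
  · rintro ⟨k, hk, rfl⟩
    exact ⟨⟨k, rfl⟩, hk⟩

theorem real_root_mem {x : ℝ} (hx : (x : ℂ) ∈ Set.range μ) : x ∈ realSolutions η α L μ := by
  obtain ⟨k, hk⟩ := hx
  rw [mem_realSolutions_iff ha hη hε hL]
  refine ⟨?_, ?_⟩
  · have := h.reduced k
    rwa [hk, ofReal_re] at this
  · rw [← hk]
    exact betheFun_of_bethe h.bethe k

/-- Closure under conjugation makes the non-real roots the y, the w and their conjugates, so nr =
L/2 - 2mw - 2mc. Of the L/2 + 2mw real solutions nr are roots; this leaves 4mw + 2mc = n + 2mw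
holes. -/
theorem exists_enumerates : ∃ (nr mw mc : ℕ) (x : Fin nr → ℝ) (ν : Fin (n + 2 * mw) → ℝ)
    (y : Fin mw → ℂ) (w : Fin mc → ℂ), 2 * mw + 2 * mc = n ∧ Function.Injective ν ∧
      (realSolutions η α L μ).ncard = L / 2 + 2 * mw ∧
      Enumerates η α L μ ⟨nr, n + 2 * mw, mw, mc, x, ν, y, w⟩ := by
  have hfin : (Set.range μ).Finite := Set.finite_range μ
  have hxfin : {x : ℝ | (x : ℂ) ∈ Set.range μ}.Finite :=
    hfin.preimage ofReal_injective.injOn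
  have hyfin : {z | z ∈ Set.range μ ∧ η < z.im}.Finite := hfin.subset fun z hz => hz.1
  have hwfin : {z | z ∈ Set.range μ ∧ 0 < z.im ∧ z.im < η}.Finite := hfin.subset fun z hz => hz.1
  obtain ⟨nr, hnr⟩ : ∃ k, {x : ℝ | (x : ℂ) ∈ Set.range μ}.ncard = k := ⟨_, rfl⟩
  obtain ⟨mw, hmw⟩ : ∃ k, {z | z ∈ Set.range μ ∧ η < z.im}.ncard = k := ⟨_, rfl⟩
  obtain ⟨mc, hmc⟩ : ∃ k, {z | z ∈ Set.range μ ∧ 0 < z.im ∧ z.im < η}.ncard = k := ⟨_, rfl⟩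
  obtain ⟨x, hx', hx⟩ := exists_enumeration hxfin hnr
  obtain ⟨y, hy', hy⟩ := exists_enumeration hyfin hmw
  obtain ⟨w, hw', hw⟩ := exists_enumeration hwfin hmc
  have hyim : ∀ b, η < (y b).im := fun b => (hy.le ⟨b, rfl⟩).2
  have hwim : ∀ b, 0 < (w b).im ∧ (w b).im < η := fun b => (hw.le ⟨b, rfl⟩).2
  have hn : 2 * mw + 2 * mc = n := by
    rw [← h.ncard_nonreal ha hη hε hL hy hw,
      ncard_range_of_injective (withConj_injective hy' hw' hη hyim hwim)]
    simp
    ring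
  obtain ⟨e, he⟩ := exists_equiv_roots hη h.distinct (ha.ne hη hε) (h.exists_conj ha hη hε hL)
    hx' hx hy' hy hw' hw
  have hcard : nr + 2 * mw + 2 * mc = L / 2 := by
    have := Fintype.card_congr e
    simp only [Fintype.card_sum, Fintype.card_fin] at this
    omega
  have hfilter : (Finset.univ.filter fun k => |(μ k).im| < η).card + 2 * mw = L / 2 := by
    have h1 : (Finset.univ.filter fun k => |(μ k).im| < η).card = nr + 2 * mc := by
      rw [Finset.card_filter, ← Equiv.sum_comp e]
      simp only [he, Fintype.sum_sum_type, Sum.elim_inl, Sum.elim_inr, withConj, conj_im, abs_neg,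
        ofReal_im, abs_zero, hη, if_true]
      have h2 : ∀ b, ¬ |(y b).im| < η := fun b => by
        rw [abs_of_pos (hη.trans (hyim b))]; exact (hyim b).not_gt
      have h3 : ∀ b, |(w b).im| < η := fun b => by
        rw [abs_of_pos (hwim b).1]; exact (hwim b).2
      simp only [h2, h3, if_true, if_false]
      simp
      ring
    omega
  have hreal := h.ncard_realSolutions ha hη hε hL hfilter
  have hpos : 0 < L / 2 := by
    obtain ⟨l, hl⟩ := h.even_length
    omega
  -- Infinite sets have `ncard` 0, so a positive count already gives finiteness.
  have hrfin : (realSolutions η α L μ).Finite := Set.finite_of_ncard_pos (by omega)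
  have hhole : holeSet η α L μ = realSolutions η α L μ \ {x : ℝ | (x : ℂ) ∈ Set.range μ} := by
    ext t
    refine and_congr_right fun _ => ?_
    simp
  have hholes : (holeSet η α L μ).ncard = n + 2 * mw := by
    rw [hhole, Set.ncard_sdiff (show {x : ℝ | (x : ℂ) ∈ Set.range μ} ⊆ realSolutions η α L μ from
      fun t ht => h.real_root_mem ha hη hε hL ht) hxfin, hreal, hnr]
    omega
  obtain ⟨ν, hν', hν⟩ := exists_enumeration (hrfin.subset fun t ht => ht.1) hholes
  exact ⟨nr, mw, mc, x, ν, y, w, hn, hν', hreal, hx', hx, hν, hy', hy, hw', hw, by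
    change n + 2 * mw = 2 * mc + 4 * mw
    omega⟩

variable {D : RootData} (hD : Enumerates η α L μ D)
include hD

theorem phi_eq_and_len : D.phi η α = betheFun η α L μ ∧ D.len = L := by
  obtain ⟨e, he⟩ := exists_equiv_roots hη h.distinct (ha.ne hη hε) (h.exists_conj ha hη hε hL)
    hD.x_injective hD.x_range hD.y_injective hD.y_range hD.w_injective hD.w_range
  have hlen : D.len = L := by
    have := Fintype.card_congr e
    simp only [Fintype.card_sum, Fintype.card_fin] at this
    obtain ⟨l, hl⟩ := h.even_length
    rw [RootData.len]
    omega
  refine ⟨?_, hlen⟩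
  ext z
  rw [RootData.phi, betheFun, hlen, ← Equiv.prod_comp e]
  simp only [he, Fintype.prod_sum_type, Sum.elim_inl, Sum.elim_inr, withConj,
    Finset.prod_mul_distrib]
  ring

theorem size_lt : D.size < 3 * n + 1 := by
  have h1 := h.ncard_nonreal ha hη hε hL hD.y_range hD.w_range
  rw [ncard_range_of_injective (withConj_injective hD.y_injective hD.w_injective hη
    (fun b => (hD.y_range.le ⟨b, rfl⟩).2) fun b => (hD.w_range.le ⟨b, rfl⟩).2)] at h1
  simp only [Fintype.card_sum, Fintype.card_fin] at h1
  have := hD.holes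
  rw [RootData.size]
  omega

/-- In the strip of half-width 3δ, |`phi`| < 1 above the axis and, by reflection, > 1 below it. So
solutions of `phi = 1` there are real, and they are simple because Re ξ' > κ. Distances of roots to
the lines Im z = ±η come from ε. -/
theorem good (hκ : 0 < κ) {c δ : ℝ} (hc0 : 0 < c) (hc : 4 * c ≤ min ε η) (hδ : 0 < δ)
    (hδη : 8 * δ ≤ η) (hδε : 4 * δ ≤ ε) (hδc : 3 * δ ≤ c) (hδ1 : 3 * δ ≤ 1)
    (hδκ : 3 * δ / c ^ 2 ≤ κ / 2) :
    D.Good η α δ (Real.exp (-(Real.pi * L * κ * δ))) := by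
  obtain ⟨hphi, -⟩ := h.phi_eq_and_len ha hη hε hL hD
  have hL' : (0 : ℝ) < L := by exact_mod_cast Nat.pos_of_ne_zero hL
  have hK : 0 < Real.pi * L * κ := mul_pos (mul_pos Real.pi_pos hL') hκ
  have hdec : ∀ z : ℂ, 0 ≤ z.im → z.im ≤ 3 * δ →
      ‖D.phi η α z‖ ≤ Real.exp (-(Real.pi * L * κ * z.im)) := fun z h1 h2 => by
    rw [hphi]
    exact h.norm_betheFun_le ha hη hε hL hc0 hc hδc hδ1 hδκ h1 h2
  have hlt : ∀ z : ℂ, 0 < z.im → z.im ≤ 3 * δ → ‖D.phi η α z‖ < 1 := fun z h1 h2 =>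
    (hdec z h1.le h2).trans_lt (by rw [Real.exp_lt_one_iff, neg_lt_zero]; positivity)
  have hy : ∀ b, D.y b ∈ Set.range μ ∧ η < (D.y b).im := fun b => hD.y_range.le ⟨b, rfl⟩
  have hw : ∀ b, D.w b ∈ Set.range μ ∧ 0 < (D.w b).im ∧ (D.w b).im < η :=
    fun b => hD.w_range.le ⟨b, rfl⟩
  have hroot : ∀ z ∈ Set.range μ, D.phi η α z = 1 := by
    rintro _ ⟨k, rfl⟩
    rw [hphi]
    exact betheFun_of_bethe h.bethe k
  have haway : ∀ z ∈ Set.range μ, z.im ≠ 0 → ε ≤ |(|z.im| - η)| := by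
    rintro _ ⟨k, rfl⟩ hk
    exact ha k hk
  have hred : ∀ z ∈ Set.range μ, z.re ∈ Set.Ico (-Real.pi / 2) (Real.pi / 2) := by
    rintro _ ⟨k, rfl⟩
    exact h.reduced k
  have hreal : ∀ z : ℂ, |z.im| < 3 * δ → D.phi η α z = 1 → z.im = 0 := by
    intro z hz hz1
    obtain ⟨h1, h2⟩ := abs_lt.1 hz
    by_contra h0
    rcases lt_or_gt_of_ne h0 with h0 | h0
    · have h3 := hlt (conj z) (by rw [conj_im]; linarith) (by rw [conj_im]; linarith)
      have h4 := D.conj_phi η α z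
      rw [hz1, map_one] at h4
      rw [inv_eq_one.1 h4.symm, norm_one] at h3
      exact lt_irrefl _ h3
    · have h3 := hlt z h0 (by linarith)
      rw [hz1, norm_one] at h3
      exact lt_irrefl _ h3
  refine ⟨hδ, hδη, (Real.exp_pos _).le, hD.holes, fun b => ?_, fun b => ?_, fun b => ?_, ?_,
    fun b => hroot _ (hy b).1, fun b => hroot _ (hw b).1, fun z h1 h2 => ?_, fun z hz hz1 => ?_,
    fun z hz hz1 => ?_⟩
  · have h1 := haway _ (hy b).1 (hη.trans (hy b).2).ne'
    rw [abs_of_pos (hη.trans (hy b).2), abs_of_pos (sub_pos.2 (hy b).2)] at h1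
    linarith
  -- No lower bound on the height of close roots is assumed: a close root of height at most 3δ would
  -- violate |`phi`| < 1.
  · by_contra! h1
    have h2 := hlt _ (hw b).2.1 h1.le
    rw [hroot _ (hw b).1, norm_one] at h2
    exact lt_irrefl _ h2
  · have h1 := haway _ (hw b).1 (hw b).2.1.ne'
    rw [abs_of_pos (hw b).2.1, abs_of_neg (sub_neg.2 (hw b).2.2)] at h1
    linarith
  · intro a b hab
    exact hD.w_injective (eq_of_exp_two_I_mul_eq (hred _ (hw a).1) (hred _ (hw b).1) hab)
  · refine (hdec z (by linarith) (by linarith)).trans (Real.exp_le_exp.2 ?_)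
    have := mul_le_mul_of_nonneg_left h1 hK.le
    linarith
  · have hz0 := hreal z hz hz1
    obtain ⟨k, hk⟩ := exists_sub_int_mul_pi_mem z.re
    have hz' : (z.re : ℂ) = z := Complex.ext rfl (by rw [ofReal_im, hz0])
    have h1 : D.phi η α ((z.re - k * Real.pi : ℝ) : ℂ) = 1 := by
      rw [← hz1]
      push_cast
      rw [hz']
      exact (show Function.Periodic (D.phi η α) Real.pi from D.phi_add_pi η α).sub_int_mul_eq k
    have h2 : (z.re - k * Real.pi) ∈ realSolutions η α L μ := by
      rw [mem_realSolutions_iff ha hη hε hL, ← hphi]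
      exact ⟨hk, h1⟩
    have h3 : ∀ t : ℝ, t = z.re - k * Real.pi → sin (z - t) = 0 := by
      rintro t rfl
      rw [sin_eq_zero_iff]
      refine ⟨k, ?_⟩
      push_cast
      rw [hz']
      ring
    by_cases h4 : ((z.re - k * Real.pi : ℝ) : ℂ) ∈ Set.range μ
    · obtain ⟨j, hj⟩ := hD.x_range.ge h4
      exact Or.inl ⟨j, h3 _ hj⟩
    · obtain ⟨j, hj⟩ := hD.ν_range.ge ⟨h2, fun a ha' => h4 ⟨a, ha'⟩⟩
      exact Or.inr ⟨j, h3 _ hj⟩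
  · have hz0 := hreal z hz hz1
    have hz' : (z.re : ℂ) = z := Complex.ext rfl (by rw [ofReal_im, hz0])
    rw [hphi, (hasDerivAt_betheFun (α := α) ha hη hL hc0 hc (z := z)
      (by rw [hz0]; simpa using hc0.le)).deriv, ← hphi, hz1, mul_one]
    have h1 := h.lt_re_betheDeriv ha hη hε hL z.re
    rw [hz'] at h1
    refine mul_ne_zero ?_ fun h2 => ?_
    · simp [Real.pi_ne_zero, hL]
    · rw [h2, zero_re] at h1
      linarith

end AdmissibleSolution


/-! ### Uniform bounds and passage to the limit -/

theorem rapidlyDecreasing_mul_exp_neg {b : ℝ} (hb : 0 < b) (C : ℝ) :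
    RapidlyDecreasing fun L => C * ((L + 1) * Real.exp (-(b * L))) := by
  intro m
  have h1 : (fun L : ℕ => Real.exp (-b * L)) =O[atTop] fun L : ℕ => ((L : ℝ) ^ (m + 1))⁻¹ := by
    refine ((isLittleO_exp_neg_mul_rpow_atTop hb (-((m + 1 : ℕ) : ℝ))).isBigO.comp_tendsto
      tendsto_natCast_atTop_atTop).congr (fun _ => rfl) fun L => ?_
    rw [Function.comp_apply, Real.rpow_neg (Nat.cast_nonneg _), Real.rpow_natCast]
  have h2 : (fun L : ℕ => (L : ℝ) + 1) =O[atTop] fun L : ℕ => (L : ℝ) := by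
    refine (isBigO_refl _ _).add (IsBigO.of_bound 1 ?_)
    filter_upwards [eventually_ge_atTop 1] with L hL
    simpa using hL
  refine ((h2.mul h1).const_mul_left C).congr' ?_ ?_
  · exact Eventually.of_forall fun L => by simp
  · filter_upwards [eventually_ge_atTop 1] with L hL
    have : (L : ℝ) ≠ 0 := by positivity
    field_simp
    rw [pow_succ']

theorem RapidlyDecreasing.add {ρ ρ' : ℕ → ℝ} (h : RapidlyDecreasing ρ)
    (h' : RapidlyDecreasing ρ') : RapidlyDecreasing fun L => ρ L + ρ' L :=
  fun m => (h m).add (h' m)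

theorem RapidlyDecreasing.tendsto_zero {ρ : ℕ → ℝ} (h : RapidlyDecreasing ρ) :
    Tendsto ρ atTop (𝓝 0) := by
  refine (h 1).trans_tendsto ?_
  simpa only [pow_one] using tendsto_inv_atTop_nhds_zero_nat (𝕜 := ℝ)

/-- Uniform bounds for all solutions of sufficiently large length. -/
theorem exists_uniform_bounds {η κ ε : ℝ} (n : ℕ) (hη : 0 < η) (hκ : 0 < κ) (hε : 0 < ε) :
    ∃ (L₀ : ℕ) (d ρ : ℕ → ℝ) (c : ℝ), Tendsto d atTop (𝓝 0) ∧ RapidlyDecreasing ρ ∧ 0 < c ∧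
      ∀ L : ℕ, L₀ ≤ L → ∀ (α : ℝ) (μ : Fin (L / 2) → ℂ), AdmissibleSolution η α κ n L μ →
        AwayFromLines η ε μ → L ≠ 0 ∧
        (∀ x ∈ Set.Icc (-Real.pi / 2) (Real.pi / 2), ∃ ν ∈ realSolutions η α L μ,
          |x - ν| ≤ d L) ∧
        ∀ D : RootData, Enumerates η α L μ D → Separated η c D.ν D.y D.w ∧
          HigherLevelBethe η α D.ν D.y D.w (ρ L) ∧
          ∃ (σ : Fin D.mc → Fin D.mc) (δ : Fin D.mc → ℂ), Function.Bijective σ ∧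
            (∀ a, ∃ k : ℤ, conj (D.w (σ a)) = D.w a - I * η + δ a + k * Real.pi) ∧
            ∀ a, ‖δ a‖ ≤ ρ L := by
  set c := min ε η / 4 with hc
  have hc0 : 0 < c := by positivity
  -- With r = 3δ these are the conditions r ≤ c, r/c² ≤ κ/2 and r ≤ 1 of `norm_betheFun_le`.
  set δ := min (c / 3) (min (κ * c ^ 2 / 6) (1 / 3)) with hδdef
  have hδ : 0 < δ := by positivity
  have hδ1 : δ ≤ c / 3 := min_le_left _ _
  have hδ2 : δ ≤ κ * c ^ 2 / 6 := (min_le_right _ _).trans (min_le_left _ _)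
  have hδ3 : δ ≤ 1 / 3 := (min_le_right _ _).trans (min_le_right _ _)
  have hcε : 4 * c ≤ ε := by rw [hc]; linarith [min_le_left ε η]
  have hcη : 4 * c ≤ η := by rw [hc]; linarith [min_le_right ε η]
  have hδκ : 3 * δ / c ^ 2 ≤ κ / 2 := by
    rw [div_le_iff₀ (by positivity)]
    linarith
  -- There are n non-real roots and at most 2n holes, so 3n + 1 exceeds every size.
  obtain ⟨C, γ, c', hC, hγ, hc', H⟩ :=
    higherLevelBethe_of_good hδ (show 8 * δ ≤ η by linarith) (3 * n + 1)
  have hb : 0 < Real.pi * κ * δ := mul_pos (mul_pos Real.pi_pos hκ) hδ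
  set ρ : ℕ → ℝ := fun L => C * (L + 1) * (Real.exp (-(Real.pi * L * κ * δ)) +
    Real.exp (-(Real.pi * L * κ * δ)) ^ γ) with hρ
  have hρr : RapidlyDecreasing ρ := by
    convert (rapidlyDecreasing_mul_exp_neg hb C).add
      (rapidlyDecreasing_mul_exp_neg (mul_pos hb hγ) C) using 2 with L
    simp only [hρ, ← Real.exp_mul]
    ring_nf
  have hd : Tendsto (fun L : ℕ => 1 / (κ * L)) atTop (𝓝 0) := by
    refine Tendsto.div_atTop tendsto_const_nhds ?_
    exact (tendsto_natCast_atTop_atTop (R := ℝ)).const_mul_atTop hκ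
  obtain ⟨L₀, hL₀⟩ := eventually_atTop.1 ((eventually_ge_atTop 1).and
    ((hρr.tendsto_zero.eventually_le_const one_pos).and
      (hd.eventually_le_const (show 0 < Real.pi / 2 by positivity))))
  refine ⟨L₀, _, ρ, c', hd, hρr, hc', fun L hL α μ h ha => ?_⟩
  obtain ⟨h1, h2, h3⟩ := hL₀ L hL
  have hL0 : L ≠ 0 := by omega
  refine ⟨hL0, fun x hx => h.exists_realSolution_near ha hη hε hL0 hκ h3 hx, fun D hD => ?_⟩
  have hG := h.good ha hη hε hL0 hD hκ hc0 (by rw [hc]; linarith) hδ (by linarith) (by linarith)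
    (by linarith) (by linarith) hδκ
  have hlen := (h.phi_eq_and_len ha hη hε hL0 hD).2
  have := H D α _ hG (h.size_lt ha hη hε hL0 hD)
  rw [hlen] at this
  exact this h2

section Limit

variable {η α c : ℝ} {nh mw mc : ℕ} {p : ℕ → (Fin nh → ℝ) × (Fin mw → ℂ) × (Fin mc → ℂ)}
  {q : (Fin nh → ℝ) × (Fin mw → ℂ) × (Fin mc → ℂ)}

theorem Separated.of_tendsto (hp : Tendsto p atTop (𝓝 q))
    (h : ∀ᶠ k in atTop, Separated η c (p k).1 (p k).2.1 (p k).2.2) :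
    Separated η c q.1 q.2.1 q.2.2 := by
  have key : ∀ g : (Fin nh → ℝ) × (Fin mw → ℂ) × (Fin mc → ℂ) → ℂ, Continuous g →
      (∀ r, Separated η c r.1 r.2.1 r.2.2 → c ≤ ‖g r‖) → c ≤ ‖g q‖ := fun g hg hs =>
    ge_of_tendsto ((hg.tendsto q).comp hp).norm (h.mono fun k hk => hs _ hk)
  exact
    ⟨fun a b => key (fun r => sin (r.2.2 a - r.1 b)) (by fun_prop) fun _ hr => hr.w_ν a b,
    fun a b => key (fun r => sin (r.2.2 a - r.2.2 b - I * η)) (by fun_prop) fun _ hr => hr.w_w a b,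
    fun a b => key (fun r => sin (r.2.2 a - r.2.1 b - I * η)) (by fun_prop) fun _ hr => hr.w_y a b,
    fun a b => key (fun r => sin (r.2.2 a - conj (r.2.1 b) - 2 * I * η)) (by fun_prop)
      fun _ hr => hr.w_yc a b,
    fun a b => key (fun r => sin (r.2.1 a - r.1 b)) (by fun_prop) fun _ hr => hr.y_ν a b,
    fun a b => key (fun r => sin (r.2.1 a - r.2.2 b - I * η)) (by fun_prop) fun _ hr => hr.y_w a b,
    fun a b => key (fun r => sin (r.2.1 a - r.2.1 b - I * η)) (by fun_prop) fun _ hr => hr.y_y a b,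
    fun a b => key (fun r => sin (r.2.1 a - conj (r.2.1 b) - 2 * I * η)) (by fun_prop)
      fun _ hr => hr.y_yc a b,
    fun a b => key (fun r => sin (conj (r.2.1 a) - r.1 b + I * η)) (by fun_prop)
      fun _ hr => hr.yc_ν a b,
    fun a b => key (fun r => sin (conj (r.2.1 a) - r.2.2 b)) (by fun_prop)
      fun _ hr => hr.yc_w a b,
    fun a b => key (fun r => sin (conj (r.2.1 a) - r.2.1 b)) (by fun_prop)
      fun _ hr => hr.yc_y a b,
    fun a b => key (fun r => sin (conj (r.2.1 a) - conj (r.2.1 b) - I * η)) (by fun_prop)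
      fun _ hr => hr.yc_yc a b⟩

theorem continuousAt_upperRHS (hc : 0 < c)
    {x : (Fin nh → ℝ) × (Fin mw → ℂ) × (Fin mc → ℂ) → ℂ} (hx : Continuous x)
    (h1 : ∀ b, c ≤ ‖sin (x q - q.1 b)‖) (h2 : ∀ b, c ≤ ‖sin (x q - q.2.2 b - I * η)‖)
    (h3 : ∀ b, c ≤ ‖sin (x q - q.2.1 b - I * η)‖)
    (h4 : ∀ b, c ≤ ‖sin (x q - conj (q.2.1 b) - 2 * I * η)‖) :
    ContinuousAt (fun r => upperRHS η α r.1 r.2.1 r.2.2 (x r)) q := by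
  have ne : ∀ {t : ℂ}, c ≤ ‖t‖ → t ≠ 0 := fun ht => norm_pos_iff.1 (hc.trans_le ht)
  refine ((continuousAt_const.mul ?_).mul ?_).mul ?_
  · exact tendsto_finsetProd _ fun b _ => ContinuousAt.div (by fun_prop) (by fun_prop) (ne (h1 b))
  · exact tendsto_finsetProd _ fun b _ => ContinuousAt.div (by fun_prop) (by fun_prop) (ne (h2 b))
  · exact tendsto_finsetProd _ fun b _ => ContinuousAt.div (by fun_prop) (by fun_prop)
      (mul_ne_zero (ne (h3 b)) (ne (h4 b)))

theorem continuousAt_lowerRHS (hc : 0 < c)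
    {x : (Fin nh → ℝ) × (Fin mw → ℂ) × (Fin mc → ℂ) → ℂ} (hx : Continuous x)
    (h1 : ∀ b, c ≤ ‖sin (x q - q.1 b + I * η)‖) (h2 : ∀ b, c ≤ ‖sin (x q - q.2.2 b)‖)
    (h3 : ∀ b, c ≤ ‖sin (x q - q.2.1 b)‖)
    (h4 : ∀ b, c ≤ ‖sin (x q - conj (q.2.1 b) - I * η)‖) :
    ContinuousAt (fun r => lowerRHS η α r.1 r.2.1 r.2.2 (x r)) q := by
  have ne : ∀ {t : ℂ}, c ≤ ‖t‖ → t ≠ 0 := fun ht => norm_pos_iff.1 (hc.trans_le ht)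
  refine ((continuousAt_const.mul ?_).mul ?_).mul ?_
  · exact tendsto_finsetProd _ fun b _ => ContinuousAt.div (by fun_prop) (by fun_prop) (ne (h1 b))
  · exact tendsto_finsetProd _ fun b _ => ContinuousAt.div (by fun_prop) (by fun_prop) (ne (h2 b))
  · exact tendsto_finsetProd _ fun b _ => ContinuousAt.div (by fun_prop) (by fun_prop)
      (mul_ne_zero (ne (h3 b)) (ne (h4 b)))

/-- Approximate solutions of the higher-level Bethe equations whose denominators stay away from
zero converge to exact solutions. -/
theorem HigherLevelBethe.of_tendsto (hc : 0 < c) {ρ : ℕ → ℝ} (hρ : Tendsto ρ atTop (𝓝 0))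
    (hp : Tendsto p atTop (𝓝 q))
    (hs : ∀ᶠ k in atTop, Separated η c (p k).1 (p k).2.1 (p k).2.2)
    (h : ∀ᶠ k in atTop, HigherLevelBethe η α (p k).1 (p k).2.1 (p k).2.2 (ρ k)) :
    HigherLevelBethe η α q.1 q.2.1 q.2.2 0 := by
  have hq := Separated.of_tendsto hp hs
  have key : ∀ g : (Fin nh → ℝ) × (Fin mw → ℂ) × (Fin mc → ℂ) → ℂ, ContinuousAt g q →
      (∀ r s, HigherLevelBethe η α r.1 r.2.1 r.2.2 s → ‖1 - g r‖ ≤ s) → ‖1 - g q‖ ≤ 0 :=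
    fun g hg hs => le_of_tendsto_of_tendsto (tendsto_const_nhds.sub (hg.tendsto.comp hp)).norm hρ
      (h.mono fun k hk => hs _ _ hk)
  refine HigherLevelBethe.of_norm_le (fun a => ?_) (fun a => ?_) fun a => ?_
  · exact key (fun r => upperRHS η α r.1 r.2.1 r.2.2 (r.2.2 a))
      (continuousAt_upperRHS hc (by fun_prop) (hq.w_ν a) (hq.w_w a) (hq.w_y a) (hq.w_yc a))
      fun r s hr => hr.close a
  · exact key (fun r => upperRHS η α r.1 r.2.1 r.2.2 (r.2.1 a))
      (continuousAt_upperRHS hc (by fun_prop) (hq.y_ν a) (hq.y_w a) (hq.y_y a) (hq.y_yc a))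
      fun r s hr => hr.wide_upper a
  · exact key (fun r => lowerRHS η α r.1 r.2.1 r.2.2 (conj (r.2.1 a)))
      (continuousAt_lowerRHS hc (by fun_prop) (hq.yc_ν a) (hq.yc_w a) (hq.yc_y a) (hq.yc_yc a))
      fun r s hr => hr.wide_lower a

end Limit

/-- The lower members of the strings are the conjugates of the w, listed in the order given by σ;
its surjectivity ensures that none is missed. -/
theorem rootPattern_of_enumerates {η α κ ε : ℝ} {n L nr mw mc : ℕ} {μ : Fin (L / 2) → ℂ}
    {x : Fin nr → ℝ} {ν : Fin (n + 2 * mw) → ℝ} {y : Fin mw → ℂ} {w : Fin mc → ℂ}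
    (h : AdmissibleSolution η α κ n L μ) (ha : AwayFromLines η ε μ) (hη : 0 < η) (hε : 0 < ε)
    (hL : L ≠ 0) (hD : Enumerates η α L μ ⟨nr, n + 2 * mw, mw, mc, x, ν, y, w⟩)
    (hcount : 2 * mw + 2 * mc = n) (hν : Function.Injective ν) {σ : Fin mc → Fin mc}
    {δ : Fin mc → ℂ} (hσ : Function.Bijective σ)
    (hw : ∀ a, ∃ k : ℤ, conj (w (σ a)) = w a - I * η + δ a + k * Real.pi) :
    RootPattern η α n L μ mw mc ν y w δ := by
  choose s hs using hw
  have hwim : ∀ a, 0 < (w a).im ∧ (w a).im < η := fun a => (hD.w_range.le ⟨a, rfl⟩).2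
  have him : ∀ a, (w a - I * η + δ a).im = -(w (σ a)).im := fun a => by
    rw [← conj_im, hs a, add_im (w a - I * η + δ a), ← ofReal_intCast, ← ofReal_mul,
      ofReal_im, add_zero]
  refine ⟨hcount, fun a => (hD.y_range.le ⟨a, rfl⟩).2, hwim, fun a => ?_, ⟨s, ?_⟩, hν, hD.ν_range⟩
  · rw [him]
    exact ⟨neg_lt_neg (hwim _).2, neg_lt_zero.2 (hwim _).1⟩
  · rw [← range_withConj hη (ha.ne hη hε) (h.exists_conj ha hη hε hL) hD.y_range hD.w_range,
      withConj, Set.Sum.elim_range, Set.Sum.elim_range, Set.Sum.elim_range]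
    congr 2
    rw [← hσ.surjective.range_comp fun b => conj (w b)]
    exact congrArg Set.range (funext hs)

/-- Any given pattern, not only the one constructed above, is an enumeration: the imaginary parts
decide which roots are y and which are w. So the uniform bounds apply to arbitrary sequences of
patterns. -/
theorem RootPattern.exists_enumerates {η α κ ε : ℝ} {n L mw mc : ℕ} {μ : Fin (L / 2) → ℂ}
    {ν : Fin (n + 2 * mw) → ℝ} {y : Fin mw → ℂ} {w δ : Fin mc → ℂ}
    (hR : RootPattern η α n L μ mw mc ν y w δ)
    (h : AdmissibleSolution η α κ n L μ) (ha : AwayFromLines η ε μ) (hη : 0 < η) (hε : 0 < ε)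
    (hL : L ≠ 0) :
    ∃ (nr : ℕ) (x : Fin nr → ℝ), Enumerates η α L μ ⟨nr, n + 2 * mw, mw, mc, x, ν, y, w⟩ := by
  obtain ⟨s, hs⟩ := hR.roots
  have hlow : ∀ a, (w a - I * η + δ a + s a * Real.pi).im < 0 := fun a => by
    rw [add_im (w a - I * η + δ a), ← ofReal_intCast, ← ofReal_mul, ofReal_im, add_zero]
    exact (hR.close_lower a).2
  have hy : Set.range y = {z | z ∈ Set.range μ ∧ η < z.im} := by
    ext z
    constructor
    · rintro ⟨a, rfl⟩
      exact ⟨(hs.ge (Or.inl (Or.inl ⟨a, rfl⟩))).1, hR.wide a⟩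
    · rintro ⟨hz, hzη⟩
      rcases hs.le ⟨hz, (hη.trans hzη).ne'⟩ with (hz | ⟨a, rfl⟩) | ⟨a, rfl⟩ | ⟨a, rfl⟩
      · exact hz
      · have h1 := hR.wide a
        rw [conj_im] at hzη
        linarith
      · exact absurd hzη (hR.close_upper a).2.not_gt
      · exact absurd (hη.trans hzη) (hlow a).not_gt
  have hw : Set.range w = {z | z ∈ Set.range μ ∧ 0 < z.im ∧ z.im < η} := by
    ext z
    constructor
    · rintro ⟨a, rfl⟩
      exact ⟨(hs.ge (Or.inr (Or.inl ⟨a, rfl⟩))).1, hR.close_upper a⟩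
    · rintro ⟨hz, hz0, hzη⟩
      rcases hs.le ⟨hz, hz0.ne'⟩ with (⟨a, rfl⟩ | ⟨a, rfl⟩) | hz | ⟨a, rfl⟩
      · exact absurd hzη (hR.wide a).not_gt
      · have h1 := hR.wide a
        rw [conj_im] at hz0
        linarith
      · exact hz
      · exact absurd hz0 (hlow a).not_gt
  have hinj : Function.Injective (withConj y w) := by
    refine injective_of_ncard_range ?_
    -- The range has n elements and the index type has 2mw + 2mc = n, so the listing has no
    -- repetitions.
    rw [h.ncard_nonreal ha hη hε hL hy hw, ← hR.count]
    simp only [Fintype.card_sum, Fintype.card_fin]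
    ring
  have hxfin : {x : ℝ | (x : ℂ) ∈ Set.range μ}.Finite :=
    (Set.finite_range μ).preimage ofReal_injective.injOn
  obtain ⟨x, hx', hx⟩ := exists_enumeration hxfin rfl
  refine ⟨_, x, hx', hx, hR.holes_range, (hinj.comp Sum.inl_injective).comp Sum.inl_injective, hy,
    (hinj.comp Sum.inr_injective).comp Sum.inl_injective, hw, ?_⟩
  have := hR.count
  change n + 2 * mw = 2 * mc + 4 * mw
  omega

end XXZ

theorem mainTheorem3 (η α κ ε : ℝ) (n : ℕ) (hη : 0 < η) (hκ : 0 < κ) (hε : 0 < ε) :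
    (∃ (L₀ : ℕ) (d ρ : ℕ → ℝ), Tendsto d atTop (𝓝 0) ∧ XXZ.RapidlyDecreasing ρ ∧
      ∀ L : ℕ, L₀ ≤ L → ∀ μ : Fin (L / 2) → ℂ,
        XXZ.AdmissibleSolution η α κ n L μ → XXZ.AwayFromLines η ε μ →
        (∀ x ∈ Set.Icc (-Real.pi / 2) (Real.pi / 2),
          ∃ ν ∈ XXZ.realSolutions η α L μ, |x - ν| ≤ d L) ∧
        ∃ (mw mc : ℕ) (ν : Fin (n + 2 * mw) → ℝ) (y : Fin mw → ℂ) (w δ : Fin mc → ℂ),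
          XXZ.RootPattern η α n L μ mw mc ν y w δ ∧
          (XXZ.realSolutions η α L μ).ncard = L / 2 + 2 * mw ∧
          (∀ a, ‖δ a‖ ≤ ρ L) ∧
          XXZ.HigherLevelBethe η α ν y w (ρ L)) ∧
    (∀ (L : ℕ → ℕ) (μ : ∀ k, Fin (L k / 2) → ℂ), Tendsto L atTop atTop →
      (∀ k, XXZ.AdmissibleSolution η α κ n (L k) (μ k)) →
      (∀ k, XXZ.AwayFromLines η ε (μ k)) →
      ∀ (mw mc : ℕ) (ν : ℕ → Fin (n + 2 * mw) → ℝ) (y : ℕ → Fin mw → ℂ)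
        (w δ : ℕ → Fin mc → ℂ),
        (∀ k, XXZ.RootPattern η α n (L k) (μ k) mw mc (ν k) (y k) (w k) (δ k)) →
        Tendsto δ atTop (𝓝 0) →
        ∀ (νlim : Fin (n + 2 * mw) → ℝ) (ylim : Fin mw → ℂ) (wlim : Fin mc → ℂ),
          Tendsto ν atTop (𝓝 νlim) → Tendsto y atTop (𝓝 ylim) → Tendsto w atTop (𝓝 wlim) →
          XXZ.HigherLevelBethe η α νlim ylim wlim 0) := by
  obtain ⟨L₀, d, ρ, c, hd, hρ, hc, H⟩ := XXZ.exists_uniform_bounds n hη hκ hε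
  constructor
  · refine ⟨L₀, d, ρ, hd, hρ, fun L hL μ h ha => ?_⟩
    obtain ⟨hL0, hdense, HD⟩ := H L hL α μ h ha
    obtain ⟨nr, mw, mc, x, ν, y, w, hn, hν, hcard, hD⟩ := h.exists_enumerates ha hη hε hL0
    obtain ⟨-, hB, σ, δ, hσ, hw, hδ⟩ := HD _ hD
    exact ⟨hdense, mw, mc, ν, y, w, δ,
      XXZ.rootPattern_of_enumerates h ha hη hε hL0 hD hn hν hσ hw, hcard, hδ, hB⟩
  · intro L μ hL h ha mw mc ν y w δ hR _ νlim ylim wlim hν hy hw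
    -- The same c serves all large k, so the denominators stay away from zero in the limit.
    have hev : ∀ᶠ k in atTop, XXZ.Separated η c (ν k) (y k) (w k) ∧
        XXZ.HigherLevelBethe η α (ν k) (y k) (w k) (ρ (L k)) := by
      filter_upwards [hL.eventually_ge_atTop L₀] with k hk
      obtain ⟨hL0, -, HD⟩ := H (L k) hk α (μ k) (h k) (ha k)
      obtain ⟨nr, x, hD⟩ := (hR k).exists_enumerates (h k) (ha k) hη hε hL0
      obtain ⟨hS, hB, -⟩ := HD _ hD
      exact ⟨hS, hB⟩
    exact XXZ.HigherLevelBethe.of_tendsto (p := fun k => (ν k, y k, w k)) (q := (νlim, ylim, wlim))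
      hc (hρ.tendsto_zero.comp hL) (hν.prodMk_nhds (hy.prodMk_nhds hw))
      (hev.mono fun k hk => hk.1) (hev.mono fun k hk => hk.2)
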